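/- Let $p$ be a prime and let $\mathcal O$ be a complete discrete valuation ring with field of fractions $K$ of characteristic $0$ and algebraically closed residue field $k$ of characteristic $p$; let $\overline K$ be an algebraic closure of $K$. Let $G$ and $H$ be finite groups, and let $B$ and $C$ be blocks of $\mathcal OG$ and $\mathcal OH$, with corresponding blocks $kB$ of $kG$ and $kC$ of $kH$. For $g\in G$ write $g=g_pg_{p'}$ for the decomposition into $p$-part and $p'$-part, and for a commutative ring $R$ let $\zeta_G:RG\to RG$ be the $R$-linear map with $\zeta_G(g)=g_p\,g_{p'}^{1/p}$, where $g_{p'}^{1/p}$ is the $p$-th root of $g_{p'}$ in $\langle g_{p'}\rangle$. For $n\ge 1$ put $q=p^n$. The block $(kB)^{(q)}$ of $kG$ is the image of $kB$ under the ring automorphism $\sum\alpha_gg\mapsto\sum\alpha_g^{\,q}g$. The block $B^{(q)}$ of $\mathcal OG$ is the block that contains $\chi^{(q)}$ for $\chi\in\operatorname{Irr}(B)$ (irreducible characters over $\overline K$), where the values of $\chi^{(q)}$ are obtained from those of $\chi$ by the automorphism $\omega_p\omega_{p'}\mapsto\omega_p\omega_{p'}^{\,q}$ of the universal cyclotomic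 extension of $\mathbb Q$ (here $\omega_p$ is a $p$-power root of unity and $\omega_{p'}$ a root of unity of order prime to $p$); it satisfies $k(B^{(q)})=(kB)^{(q)}$. For a simple module $S$ of $kB$ (equivalently, of $B$), $S^{(q)}$ is the module of $(kB)^{(q)}$ (hence of $B^{(q)}$) with the same underlying group on which $\sum\alpha_g^{\,q}g$ acts as $\sum\alpha_gg\in kB$ acts on $S$. A strong Frobenius isomorphism of degree $n$ of $kB$ (respectively a strong $\mathcal O$-Frobenius isomorphism of degree $n$ of $B$) is a $k$-algebra isomorphism $\phi:kB\to (kB)^{(q)}$ (respectively an $\mathcal O$-algebra isomorphism $\phi:B\to B^{(q)}$) such that (1) $\phi$ agrees with $\zeta_G^{\circ n}$ on the centre, and (2) for every simple module $S$, the module obtained by transporting $S$ through $\phi$ is isomorphic to $S^{(q)}$. The strong Frobenius number $\mathrm{SF}(kB)$ (respectively the strong $\mathcal O$-Frobenius number $\mathrm{SOF}(B)$) is the smallest $n\ge 1$ for which such an isomorphism of degree $n$ exists. Suppose that $B$ and $C$ are Morita equivalent as $\mathcal O$-algebras. Then $\mathrm{SF}(kB)=\mathrm{SF}(kC)$. If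 moreover Frobenius twists are available over $\mathcal O$, i.e. there are a ring automorphism $\sigma$ of $\mathcal O$ inducing $\lambda\mapsto\lambda^p$ on $k$ and an extension of $\sigma$ to an automorphism of $\overline K$ whose restriction to the universal cyclotomic extension of $\mathbb Q$ is $\omega_p\omega_{p'}\mapsto\omega_p\omega_{p'}^{\,p}$ (for example $\mathcal O=W(k)$ or $\mathcal O=W(k)[\zeta_{p^m}]$), then $\mathrm{SOF}(B)=\mathrm{SOF}(C)$. -/

import Mathlib

universe u v w

noncomputable section

open IsLocalRing

/-! ### The `p`-part and the `p'`-part of a group element, and the map `ζ_G` -/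

section PParts

variable {G : Type v} [Group G]

/-- The `p`-part `g_p` of `g`. With `orderOf g = p ^ a * m`, `p ∤ m`, the exponent
`m ^ φ(p ^ a)` is `1` modulo `p ^ a` and `0` modulo `m`. -/
def pPart (p : ℕ) (g : G) : G :=
  g ^ (ordCompl[p] (orderOf g)) ^ Nat.totient (ordProj[p] (orderOf g))

/-- The `p'`-part `g_{p'}` of `g`. With `orderOf g = p ^ a * m`, `p ∤ m`, the exponent
`(p ^ a) ^ φ(m)` is `0` modulo `p ^ a` and `1` modulo `m`. -/
def pPrimePart (p : ℕ) (g : G) : G :=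
  g ^ (ordProj[p] (orderOf g)) ^ Nat.totient (ordCompl[p] (orderOf g))

/-- For `x` of (finite) order `m` prime to `p`, the unique `p`-th root `x ^ (1 / p)` of `x` in the
cyclic group generated by `x`; the exponent `p ^ (φ(m) - 1)` is inverse to `p` modulo `m`. -/
def pRoot (p : ℕ) (x : G) : G :=
  x ^ p ^ (Nat.totient (orderOf x) - 1)

/-- The map `g ↦ g_p g_{p'} ^ (1 / p)` on a finite group. -/
def zetaElt (p : ℕ) (g : G) : G :=
  pPart p g * pRoot p (pPrimePart p g)

theorem commute_pPart_pPrimePart (p : ℕ) (g : G) : Commute (pPart p g) (pPrimePart p g) :=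
  (Commute.refl g).pow_pow _ _

theorem pPart_pow_eq_one (p : ℕ) (g : G) : pPart p g ^ (ordProj[p] (orderOf g)) = 1 := by
  have hApos : 0 < ordProj[p] (orderOf g) := Nat.ordProj_pos _ _
  rw [pPart, ← pow_mul, ← orderOf_dvd_iff_pow_eq_one, mul_comm]
  nth_rewrite 1 [← Nat.ordProj_mul_ordCompl_eq_self (orderOf g) p]
  exact mul_dvd_mul_left _ (dvd_pow_self _ (Nat.totient_pos.2 hApos).ne')

variable [Finite G]

theorem pPart_mul_pPrimePart (p : ℕ) [hp : Fact p.Prime] (g : G) :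
    pPart p g * pPrimePart p g = g := by
  have h0 : orderOf g ≠ 0 := (orderOf_pos g).ne'
  set A := ordProj[p] (orderOf g) with hA
  set M := ordCompl[p] (orderOf g) with hM
  have hAM : A * M = orderOf g := Nat.ordProj_mul_ordCompl_eq_self _ _
  have hc : Nat.Coprime A M := (Nat.coprime_ordCompl hp.out h0).pow_left _
  have hApos : 0 < A := Nat.ordProj_pos _ _
  have hMpos : 0 < M := Nat.ordCompl_pos _ h0
  have key : M ^ Nat.totient A + A ^ Nat.totient M ≡ 1 [MOD A * M] := by
    refine (Nat.modEq_and_modEq_iff_modEq_mul hc).1 ⟨?_, ?_⟩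
    · have h1 := Nat.ModEq.pow_totient hc.symm
      have h2 : A ^ Nat.totient M ≡ 0 [MOD A] :=
        (Nat.modEq_zero_iff_dvd).2 (dvd_pow_self _ (Nat.totient_pos.2 hMpos).ne')
      exact h1.add h2
    · have h1 := Nat.ModEq.pow_totient hc
      have h2 : M ^ Nat.totient A ≡ 0 [MOD M] :=
        (Nat.modEq_zero_iff_dvd).2 (dvd_pow_self _ (Nat.totient_pos.2 hApos).ne')
      exact h2.add h1
  rw [hAM] at key
  have := pow_eq_pow_iff_modEq.2 key
  rw [pow_one] at this
  rw [pPart, pPrimePart, ← pow_add]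
  exact this

theorem pPrimePart_pow_eq_one (p : ℕ) (g : G) :
    pPrimePart p g ^ (ordCompl[p] (orderOf g)) = 1 := by
  have hMpos : 0 < ordCompl[p] (orderOf g) := Nat.ordCompl_pos _ (orderOf_pos g).ne'
  rw [pPrimePart, ← pow_mul, ← orderOf_dvd_iff_pow_eq_one]
  nth_rewrite 1 [← Nat.ordProj_mul_ordCompl_eq_self (orderOf g) p]
  exact mul_dvd_mul_right (dvd_pow_self _ (Nat.totient_pos.2 hMpos).ne') _

theorem coprime_orderOf_pPrimePart (p : ℕ) [hp : Fact p.Prime] (g : G) :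
    p.Coprime (orderOf (pPrimePart p g)) :=
  (Nat.coprime_ordCompl hp.out (orderOf_pos g).ne').coprime_dvd_right
    (orderOf_dvd_of_pow_eq_one (pPrimePart_pow_eq_one p g))

theorem pRoot_pow (p : ℕ) (x : G) (hx : p.Coprime (orderOf x)) : pRoot p x ^ p = x := by
  have h := Nat.totient_pos.2 (orderOf_pos x)
  rw [pRoot, ← pow_mul, ← pow_succ, Nat.sub_add_cancel h]
  simpa using pow_eq_pow_iff_modEq.2 (Nat.ModEq.pow_totient hx)

end PParts

/-- The `R`-linear map `ζ_G : R G → R G` extending `g ↦ g_p g_{p'} ^ (1 / p)`. -/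
def zeta (p : ℕ) {R : Type u} [CommRing R] {G : Type v} [Group G] (x : MonoidAlgebra R G) :
    MonoidAlgebra R G :=
  MonoidAlgebra.mapDomain (zetaElt p) x

/-! ### Central idempotents, blocks and block algebras -/

/-- A central idempotent of the group algebra `R G`. -/
structure CentralIdempotent (R : Type u) [CommRing R] (G : Type v) [Group G] where
  /-- the underlying element of the group algebra -/
  e : MonoidAlgebra R G
  idem : IsIdempotentElem e
  central : ∀ x : MonoidAlgebra R G, e * x = x * e

namespace CentralIdempotent

variable {R : Type u} [CommRing R] {G : Type v} [Group G]

/-- `e` is a block idempotent: a central idempotent which is nonzero and primitive as such. -/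
structure IsBlock (B : CentralIdempotent R G) : Prop where
  ne_zero : B.e ≠ 0
  primitive : ∀ f : CentralIdempotent R G, B.e * f.e = f.e → f.e = 0 ∨ f.e = B.e

/-- The algebra `R G e = e (R G) e` with identity `e`. -/
abbrev Alg (B : CentralIdempotent R G) : Type (max u v) := B.idem.Corner

instance (B : CentralIdempotent R G) : Algebra R B.Alg where
  smul r x := ⟨r • x.1, by
    obtain ⟨a, ha⟩ := x.2
    exact ⟨r • a, by rw [← ha]; simp⟩⟩
  algebraMap :=
    { toFun := fun r => ⟨r • B.e, r • B.e, by
        simp only [mul_smul_comm, smul_mul_assoc, B.idem.eq]⟩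
      map_one' := Subtype.ext (one_smul R B.e)
      map_zero' := Subtype.ext (zero_smul R B.e)
      map_add' := fun r s => Subtype.ext (add_smul r s B.e)
      map_mul' := fun r s => Subtype.ext (by
        change (r * s) • B.e = (r • B.e) * (s • B.e)
        rw [smul_mul_smul_comm, B.idem.eq]) }
  commutes' r x := Subtype.ext (by
    change (r • B.e) * x.1 = x.1 * (r • B.e)
    rw [smul_mul_assoc, mul_smul_comm, B.central])
  smul_def' r x := Subtype.ext (by
    change r • x.1 = (r • B.e) * x.1
    rw [smul_mul_assoc, ((Subsemigroup.mem_corner_iff B.idem).mp x.2).1])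

theorem coe_mul (B : CentralIdempotent R G) (x y : B.Alg) : (x * y).1 = x.1 * y.1 := rfl
theorem coe_add (B : CentralIdempotent R G) (x y : B.Alg) : (x + y).1 = x.1 + y.1 := rfl
theorem coe_one (B : CentralIdempotent R G) : (1 : B.Alg).1 = B.e := rfl
theorem coe_smul (B : CentralIdempotent R G) (r : R) (x : B.Alg) : (r • x).1 = r • x.1 := rfl

/-- The image of a central idempotent under a homomorphism `R → S` of coefficient rings. -/
def map {S : Type w} [CommRing S] (f : R →+* S) (B : CentralIdempotent R G) :
    CentralIdempotent S G where
  e := MonoidAlgebra.mapRingHom G f B.e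
  idem := B.idem.map (MonoidAlgebra.mapRingHom G f)
  central x := by
    have key : ∀ g : G, MonoidAlgebra.mapRingHom G f B.e * MonoidAlgebra.single g 1 =
        MonoidAlgebra.single g 1 * MonoidAlgebra.mapRingHom G f B.e := fun g => by
      have := congrArg (MonoidAlgebra.mapRingHom G f) (B.central (MonoidAlgebra.single g 1))
      simpa using this
    induction x using MonoidAlgebra.induction_on with
    | of g => exact key g
    | add a b ha hb => rw [mul_add, add_mul, ha, hb]
    | smul r a ha => rw [mul_smul_comm, smul_mul_assoc, ha]

/-- For a block `B` of `O G` over a local ring `O` with residue field `k`, the block `k B` of `k G`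
corresponding to `B`. -/
def kRed {O : Type u} [CommRing O] [IsLocalRing O] (B : CentralIdempotent O G) :
    CentralIdempotent (ResidueField O) G :=
  B.map (residue O)

end CentralIdempotent

/-! ### Strong Frobenius numbers over a field of characteristic `p` -/

section Field

variable (p : ℕ) [Fact p.Prime] {k : Type u} [Field k] [CharP k p] {G : Type v} [Group G]

/-- The ring endomorphism `∑ α_g g ↦ ∑ (α_g) ^ q g` of `k G`, with `q = p ^ n`. -/
def frobMap (n : ℕ) : MonoidAlgebra k G →+* MonoidAlgebra k G :=
  MonoidAlgebra.mapRingHom G (iterateFrobenius k p n)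

/-- `B ^ (p ^ n)`: the image of `B` under `∑ α_g g ↦ ∑ (α_g) ^ (p ^ n) g`. -/
def CentralIdempotent.frobTwist (n : ℕ) (B : CentralIdempotent k G) : CentralIdempotent k G :=
  B.map (iterateFrobenius k p n)

/-- `φ : B → B ^ (q)`, `q = p ^ n`, is a strong Frobenius isomorphism of degree `n`.
In `simple`, the `B ^ (q)`-module associated to `S` through `φ` is `S` with `y` acting
as `φ⁻¹ y`, and `S ^ (q)` is `S` with `y = ∑ (α_g) ^ q g` acting as `b = ∑ α_g g`;
`f` is an isomorphism from the former to the latter. -/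
structure IsStrongFrobeniusIso (n : ℕ) (B : CentralIdempotent k G)
    (φ : B.Alg ≃ₐ[k] (B.frobTwist p n).Alg) : Prop where
  center : ∀ z ∈ Subalgebra.center k B.Alg, (φ z).1 = (zeta p)^[n] z.1
  simple : ∀ (S : Type (max u v)) [AddCommGroup S] [Module B.Alg S] [IsSimpleModule B.Alg S],
    ∃ f : S ≃+ S, ∀ (y : (B.frobTwist p n).Alg) (b : B.Alg), y.1 = frobMap p n b.1 →
      ∀ s : S, f (φ.symm y • s) = b • f s

/-- The strong Frobenius number `SF(B)`: the smallest `n ≥ 1` for which there is a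
strong Frobenius isomorphism of degree `n` from `B` to `B ^ (p ^ n)`. -/
def strongFrobeniusNumber (B : CentralIdempotent k G) : ℕ :=
  sInf {n : ℕ | 0 < n ∧ ∃ φ : B.Alg ≃ₐ[k] (B.frobTwist p n).Alg, IsStrongFrobeniusIso p n B φ}

end Field

/-! ### Ordinary characters and twists of blocks over `O` -/

/-- The algebraic closure `K̄` of the field of fractions of `O`. -/
abbrev KBar (O : Type u) [CommRing O] [IsDomain O] : Type u := AlgebraicClosure (FractionRing O)

/-- `τ` restricts on the universal cyclotomic extension of `ℚ` in `F` to the automorphism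
`ω_p ω_{p'} ↦ ω_p (ω_{p'}) ^ (p ^ n)`, for `p`-power roots of unity `ω_p` and `p'`-roots of unity
`ω_{p'}`. -/
def IsCyclotomicFrobenius (p n : ℕ) {F : Type u} [Field F] (τ : F ≃+* F) : Prop :=
  ∀ ω ω' : F, (∃ a : ℕ, ω ^ p ^ a = 1) → (∃ m : ℕ, p.Coprime m ∧ ω' ^ m = 1) →
    τ (ω * ω') = ω * ω' ^ p ^ n

section Blocks

variable {O : Type u} [CommRing O] [IsDomain O] {G : Type v} [Group G]

variable (O G) in
/-- `Irr(G)`: the characters of the irreducible representations of `G` over `K̄`. -/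
def Irr : Set (G → KBar O) :=
  {χ | ∃ (d : ℕ) (ρ : Representation (KBar O) G (Fin d → KBar O)),
    ρ.IsIrreducible ∧ ρ.character = χ}

/-- `Irr(B)`: the `χ ∈ Irr(G)` with `χ(e_B) ≠ 0`, where `χ` is extended linearly. -/
def CentralIdempotent.irr (B : CentralIdempotent O G) : Set (G → KBar O) :=
  {χ ∈ Irr O G | (B.e.coeff.sum fun g a => algebraMap O (KBar O) a * χ g) ≠ 0}

/-- `χ' = χ ^ (q)` with `q = p ^ n`: the values of `χ'` are the images of those of `χ` under the
automorphism `ω_p ω_{p'} ↦ ω_p (ω_{p'}) ^ q` of the universal cyclotomic extension of `ℚ`. -/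
def IsCharTwist (p n : ℕ) (χ χ' : G → KBar O) : Prop :=
  ∃ τ : KBar O ≃+* KBar O, IsCyclotomicFrobenius p n τ ∧ ∀ g, χ' g = τ (χ g)

/-- `B' = B ^ (q)` with `q = p ^ n`: `B'` is the block of `O G` with `χ ^ (q) ∈ Irr(B')` for
`χ ∈ Irr(B)`. -/
def IsBlockTwist (p n : ℕ) (B B' : CentralIdempotent O G) : Prop :=
  B'.IsBlock ∧ ∃ χ ∈ B.irr, ∃ χ' ∈ B'.irr, IsCharTwist p n χ χ'

variable (p : ℕ) [Fact p.Prime] [IsLocalRing O] [CharP (ResidueField O) p]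

/-- `φ : B → B'`, where `B' = B ^ (q)`, `q = p ^ n`, is a strong `O`-Frobenius isomorphism of
degree `n`. Simple `B`-modules `S` are simple `k B`-modules, and in `simple` the module
`S ^ (q)` over `k B' = (k B) ^ (q)` is `S` with `y ∈ B'` acting as any `b ∈ B` such that
`y` reduces to `∑ (α_g) ^ q g` when `b` reduces to `∑ α_g g`; `f` is an isomorphism to it from
the `B'`-module associated to `S` through `φ`. -/
structure IsStrongOFrobeniusIso (n : ℕ) (B B' : CentralIdempotent O G)
    (φ : B.Alg ≃ₐ[O] B'.Alg) : Prop where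
  center : ∀ z ∈ Subalgebra.center O B.Alg, (φ z).1 = (zeta p)^[n] z.1
  simple : ∀ (S : Type (max u v)) [AddCommGroup S] [Module B.Alg S] [IsSimpleModule B.Alg S],
    ∃ f : S ≃+ S, ∀ (y : B'.Alg) (b : B.Alg),
      MonoidAlgebra.mapRingHom G (residue O) y.1 =
        frobMap p n (MonoidAlgebra.mapRingHom G (residue O) b.1) →
      ∀ s : S, f (φ.symm y • s) = b • f s

/-- The strong `O`-Frobenius number `SOF(B)`: the smallest `n ≥ 1` for which there is a
strong `O`-Frobenius isomorphism of degree `n` from `B` to `B ^ (p ^ n)`. -/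
def strongOFrobeniusNumber (B : CentralIdempotent O G) : ℕ :=
  sInf {n : ℕ | 0 < n ∧ ∃ B' : CentralIdempotent O G, IsBlockTwist p n B B' ∧
    ∃ φ : B.Alg ≃ₐ[O] B'.Alg, IsStrongOFrobeniusIso p n B B' φ}

end Blocks

/-- Frobenius twists are available over `O`: there is a ring automorphism `σ` of `O` which induces
`λ ↦ λ ^ p` on the residue field and is compatible, inside `K̄`, with the automorphism
`ω_p ω_{p'} ↦ ω_p (ω_{p'}) ^ p` of the universal cyclotomic extension of `ℚ`. -/
def HasFrobeniusLift (p : ℕ) (O : Type u) [CommRing O] [IsDomain O] [IsLocalRing O] : Prop :=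
  ∃ (σ : O ≃+* O) (τ : KBar O ≃+* KBar O),
    (∀ a : O, residue O (σ a) = residue O a ^ p) ∧
    (∀ a : O, τ (algebraMap O (KBar O) a) = algebraMap O (KBar O) (σ a)) ∧
    IsCyclotomicFrobenius p 1 τ

end

/-!
Let `s` denote the map raising the coefficients of group algebra elements to the `q`-th power
(over `k`), respectively applying the `n`-th power of the Frobenius lift `σ` (over `O`).
A strong Frobenius isomorphism `φ : B → B ^ (q)` is the same thing as the ring automorphism
`α = φ⁻¹ ∘ s` of `B`: the condition on simple modules says that `α` fixes the isomorphism
classes of simple modules (`FixesSimples`), and the condition on the centre says that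
`s ∘ α⁻¹ = ζ ^ n` there. The latter, evaluated at the scalars, also gives the linearity of `φ`
(`CentralIdempotent.HasTwist`, `CentralIdempotent.exists_algEquiv_iff_hasTwist`).

Such automorphisms can be transported along an equivalence `E` from `C`-modules to `B`-modules.
Let `P` be the projective `B`-module that corresponds to the regular `C`-module. As `α`
fixes the simple modules, and a projective module is determined by its semisimple quotient, there is
an `α`-semilinear bijection of `P` (`FixesSimples.exists_addEquiv_of_projective`). Conjugation by it
is a ring automorphism `β` of `C = End(P)ᵒᵖ`, which fixes the simple `C`-modules, and which
corresponds to `α` on the centres (`FixesSimples.exists_transfer`). It remains to prove that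
the isomorphism `f : Z(B) → Z(C)` given by `E` intertwines the semilinear maps `σ⁻¹ ∘ ζ`.

Here is the arithmetic input. Let `Ψ : Z(O G) → Z(O H)` be the composition of multiplication by the
identity of `B` with `f`. There are exponents `r` and `t` inverse to each other such that `ζ` is the
`t`-th power map on elements of `G` and `H`, while `r` induces on roots of unity the automorphism
`ω_p ω_{p'} ↦ ω_p ω_{p'} ^ p`. Over `K̄` the map `f` sends primitive idempotents to primitive
idempotents, whose coefficients are, up to rational factors, values of characters at group elements.
Hence the coefficient of `Ψ` at the class sum of `g` and at `h` is the image of the coefficient at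
`g ^ t` and `h ^ t` under that automorphism (`coeff_classSum_mem_cycloPairs`). If a Frobenius
lift `σ` with its extension to `K̄` is given, this says that `Ψ` commutes with `σ⁻¹ ∘ ζ`
(`zeta_iterate_comm`). Over the residue field no lift is needed, since the reductions of two such
conjugate elements of `O` are related by `a ↦ a ^ p` (`residue_eq_pow_of_mem_cycloPairs`). As `E` is
`O`-linear, it induces an equivalence between the modules over `kB` and `kC`
(`descentEquivalence`), and the isomorphism of the centres of `kB` and `kC` is the reduction of `f`.

Finally, over `O` the block `B ^ (q)` is the image of `B` under the automorphism of the
coefficients: if `χ ∈ Irr(B)`, then `χ ^ (q)` does not vanish on the image of the identity of `B`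
(`CentralIdempotent.isBlockTwist_iff`).
-/

universe u₁ u₂

noncomputable section

open IsLocalRing

/-! ### Semilinear automorphisms of projective modules -/

section FixesSimples

/-- `α` fixes the isomorphism classes of simple modules: every simple module has an `α`-semilinear
bijection. Simple modules are represented by quotients by maximal left ideals. -/
def FixesSimples {A : Type u} [Ring A] (α : A ≃+* A) : Prop :=
  ∀ I : Ideal A, IsCoatom I → ∃ f : (A ⧸ I) ≃+ (A ⧸ I), ∀ a x, f (a • x) = α a • f x

variable {A : Type u} [Ring A] {α : A ≃+* A}

theorem FixesSimples.exists_addEquiv (hα : FixesSimples α) (S : Type v) [AddCommGroup S]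
    [Module A S] [IsSimpleModule A S] : ∃ f : S ≃+ S, ∀ (a : A) x, f (a • x) = α a • f x := by
  obtain ⟨I, hI, ⟨e⟩⟩ := isSimpleModule_iff_quot_maximal.mp ‹IsSimpleModule A S›
  obtain ⟨f, hf⟩ := hα I hI.out
  refine ⟨(e.toAddEquiv.trans f).trans e.symm.toAddEquiv, fun a x => ?_⟩
  simp [hf]

theorem FixesSimples.symm (hα : FixesSimples α) : FixesSimples α.symm := fun I hI => by
  obtain ⟨f, hf⟩ := hα I hI
  refine ⟨f.symm, fun a x => f.injective ?_⟩
  simp [hf]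

theorem FixesSimples.exists_addEquiv_of_isSemisimpleModule (hα : FixesSimples α) (M : Type v)
    [AddCommGroup M] [Module A M] [IsSemisimpleModule A M] :
    ∃ f : M ≃+ M, ∀ (a : A) x, f (a • x) = α a • f x := by
  obtain ⟨s, e, -, hs⟩ := IsSemisimpleModule.exists_linearEquiv_dfinsupp A M
  have := fun m : s => hα.exists_addEquiv m.1
  choose f hf using this
  refine ⟨(e.toAddEquiv.trans (DFinsupp.mapRange.addEquiv f)).trans e.symm.toAddEquiv,
    fun a x => ?_⟩
  have : DFinsupp.mapRange.addEquiv f (a • e x) = α a • DFinsupp.mapRange.addEquiv f (e x) := by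
    ext i
    simp [hf]
  simp [this]

/-- A simple module over a finite algebra over a local ring is killed by the maximal ideal:
otherwise Nakayama's lemma fails. -/
theorem smul_eq_zero_of_isSimpleModule (R : Type w) [CommRing R] [IsLocalRing R]
    [Algebra R A] [Module.Finite R A] {S : Type v} [AddCommGroup S] [Module A S] [Module R S]
    [IsScalarTower R A S] [IsSimpleModule A S] {r : R} (hr : r ∈ maximalIdeal R) (s : S) :
    r • s = 0 := by
  have : Module.Finite R S := Module.Finite.trans A S
  obtain ⟨J, hJ⟩ : ∃ J : Submodule R S, J = maximalIdeal R • (⊤ : Submodule R S) := ⟨_, rfl⟩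
  have hmem : ∀ r ∈ maximalIdeal R, ∀ s : S, r • s ∈ J := fun r hr s =>
    hJ ▸ Submodule.smul_mem_smul hr Submodule.mem_top
  have hsmul : ∀ (a : A), ∀ y ∈ J, a • y ∈ J := by
    intro a y h
    have h' := h
    rw [hJ] at h'
    refine Submodule.smul_induction_on h' (fun r hr n _ => ?_) (fun x y h1 h2 => ?_)
    · have : a • r • n = r • a • n := by
        rw [← algebraMap_smul A r n, ← algebraMap_smul A r (a • n), smul_smul, smul_smul,
          Algebra.commutes]
      rw [this]
      exact hmem r hr _
    · rw [smul_add]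
      exact J.add_mem h1 h2
  let W : Submodule A S :=
    { carrier := J
      add_mem' := J.add_mem
      zero_mem' := J.zero_mem
      smul_mem' := fun a y h => hsmul a y h }
  rcases eq_bot_or_eq_top W with h | h
  · have : r • s ∈ W := hmem r hr s
    rwa [h, Submodule.mem_bot] at this
  · exfalso
    have htop : (⊤ : Submodule R S) ≤ maximalIdeal R • (⊤ : Submodule R S) := fun y _ => by
      have : y ∈ W := h ▸ Submodule.mem_top
      rw [← hJ]
      exact this
    have hfg : (⊤ : Submodule R S).FG := Module.Finite.fg_top
    have hbot := Submodule.eq_bot_of_le_smul_of_le_jacobson_bot (maximalIdeal R) _ hfg htop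
      (by rw [IsLocalRing.jacobson_eq_maximalIdeal _ bot_ne_top])
    have := IsSimpleModule.nontrivial A S
    exact top_ne_bot (α := Submodule R S) hbot

/-- The top of a module over a finite algebra over a local ring is semisimple. -/
theorem isSemisimpleModule_quotient_jacobson (R : Type w) [CommRing R] [IsLocalRing R]
    [Algebra R A] [Module.Finite R A] (P : Type v) [AddCommGroup P] [Module A P]
    [Module.Finite A P] : IsSemisimpleModule A (P ⧸ Module.jacobson A P) := by
  let : Module R P := Module.compHom P (algebraMap R A)
  have : IsScalarTower R A P := ⟨fun r a x => by
    rw [Algebra.smul_def, mul_smul]; rfl⟩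
  have : Module.Finite R P := Module.Finite.trans A P
  set T := P ⧸ Module.jacobson A P with hT
  have hk : ∀ r ∈ maximalIdeal R, ∀ t : T, r • t = 0 := by
    intro r hr t
    obtain ⟨x, rfl⟩ := Submodule.mkQ_surjective _ t
    rw [← LinearMap.map_smul_of_tower, Submodule.mkQ_apply, Submodule.Quotient.mk_eq_zero,
      Module.jacobson, Submodule.mem_sInf]
    intro N hN
    have : IsSimpleModule A (P ⧸ N) := isSimpleModule_iff_isCoatom.2 hN
    rw [← Submodule.Quotient.mk_eq_zero, ← Submodule.mkQ_apply, LinearMap.map_smul_of_tower]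
    exact smul_eq_zero_of_isSimpleModule (A := A) R hr _
  let : Module (R ⧸ maximalIdeal R) T :=
    Module.IsTorsionBySet.module (fun t r => hk r.1 r.2 t)
  have : IsScalarTower R (R ⧸ maximalIdeal R) T := Module.IsTorsionBySet.isScalarTower _
  let : Field (R ⧸ maximalIdeal R) := Ideal.Quotient.field _
  have : Module.Finite (R ⧸ maximalIdeal R) T := Module.Finite.of_restrictScalars_finite R _ _
  have : IsArtinian (R ⧸ maximalIdeal R) T := inferInstance
  have : IsArtinian R T :=
    (LinearMap.isArtinian_iff_of_bijective
      (σ := Ideal.Quotient.mk (maximalIdeal R))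
      (⟨⟨id, fun _ _ => rfl⟩, fun _ _ => rfl⟩ : T →ₛₗ[Ideal.Quotient.mk (maximalIdeal R)] T)
      Function.bijective_id).2 inferInstance
  have : IsArtinian A T := isArtinian_of_tower R inferInstance
  rw [IsArtinian.isSemisimpleModule_iff_jacobson]
  exact Module.jacobson_quotient_jacobson A P

/-- The module `M` with `a` acting as `γ a`. -/
def Twist (_ : A ≃+* A) (M : Type v) : Type v := M

instance (γ : A ≃+* A) (M : Type v) [AddCommGroup M] : AddCommGroup (Twist γ M) :=
  inferInstanceAs (AddCommGroup M)

instance (γ : A ≃+* A) (M : Type v) [AddCommGroup M] [Module A M] : Module A (Twist γ M) :=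
  Module.compHom M γ.toRingHom

/-- Over a finite algebra over a Noetherian local ring, a finitely generated projective module is
determined by its top; hence it is isomorphic to its twist by any ring automorphism which fixes
the simple modules. -/
theorem FixesSimples.exists_addEquiv_of_projective (hα : FixesSimples α)
    (R : Type w) [CommRing R] [IsLocalRing R] [IsNoetherianRing R]
    [Algebra R A] [Module.Finite R A] (P : Type v) [AddCommGroup P] [Module A P]
    [Module.Finite A P] [Module.Projective A P] :
    ∃ f : P ≃+ P, ∀ (a : A) x, f (a • x) = α a • f x := by
  have key : ∀ γ : A ≃+* A, FixesSimples γ →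
      ∃ f : P →+ P, Function.Surjective f ∧ ∀ (a : A) x, f (a • x) = γ a • f x := by
    intro γ hγ
    have := isSemisimpleModule_quotient_jacobson R (A := A) P
    obtain ⟨v, hv⟩ := hγ.exists_addEquiv_of_isSemisimpleModule (P ⧸ Module.jacobson A P)
    let q : Twist γ P →ₗ[A] Twist γ (P ⧸ Module.jacobson A P) :=
      { toFun := Submodule.mkQ (Module.jacobson A P)
        map_add' := map_add (Submodule.mkQ (Module.jacobson A P))
        map_smul' := fun a x => (Submodule.mkQ (Module.jacobson A P)).map_smul (γ a) x }
    let g : P →ₗ[A] Twist γ (P ⧸ Module.jacobson A P) :=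
      { toFun := fun x => v (Submodule.mkQ _ x)
        map_add' := fun x y => by rw [map_add, map_add]; rfl
        map_smul' := fun a x => by rw [map_smul, hv]; rfl }
    have hq : Function.Surjective q := fun y =>
      Submodule.mkQ_surjective (Module.jacobson A P) y
    -- lift the semilinear bijection of the semisimple quotient to `P`
    obtain ⟨h, hh⟩ := Module.projective_lifting_property q g hq
    let h' : P →+ P := ⟨⟨fun x => h x, h.map_zero⟩, h.map_add⟩
    have hs : ∀ (a : A) x, h' (a • x) = γ a • h' x := fun a x => h.map_smul a x
    refine ⟨h', ?_, hs⟩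
    let W : Submodule A P :=
      { carrier := {y | ∃ x, h' x = y}
        add_mem' := by
          rintro _ _ ⟨x, rfl⟩ ⟨y, rfl⟩
          exact ⟨x + y, h'.map_add x y⟩
        zero_mem' := ⟨0, h'.map_zero⟩
        smul_mem' := by
          rintro a _ ⟨x, rfl⟩
          exact ⟨γ.symm a • x, by rw [hs, RingEquiv.apply_symm_apply]⟩ }
    have hW : W ⊔ Module.jacobson A P = ⊤ := by
      refine eq_top_iff.2 fun y _ => ?_
      obtain ⟨x, hx⟩ := Submodule.mkQ_surjective (Module.jacobson A P) (v.symm (Submodule.mkQ _ y))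
      have h1 : Submodule.mkQ (Module.jacobson A P) (h' x) = Submodule.mkQ _ y := by
        have h2 : q (h' x) = g x := LinearMap.congr_fun hh x
        have h3 : g x = Submodule.mkQ (Module.jacobson A P) y := by
          change v _ = _
          rw [hx, AddEquiv.apply_symm_apply]
        exact h2.trans h3
      rw [← sub_eq_zero, ← map_sub, Submodule.mkQ_apply, Submodule.Quotient.mk_eq_zero] at h1
      have h4 : y = h' x - (h' x - y) := by abel
      rw [h4]
      exact sub_mem (Submodule.mem_sup_left ⟨x, rfl⟩) (Submodule.mem_sup_right h1)
    -- the radical of a finitely generated module is superfluous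
    have hW' : W = ⊤ := by
      by_contra hne
      obtain ⟨N, hN, hle⟩ := (eq_top_or_exists_le_coatom W).resolve_left hne
      exact hN.1 (eq_top_iff.2 (hW ▸ sup_le hle (sInf_le hN)))
    intro y
    have : y ∈ W := hW' ▸ Submodule.mem_top
    exact this
  obtain ⟨f, hfs, hf⟩ := key α hα
  obtain ⟨f', hfs', hf'⟩ := key α.symm hα.symm
  have : IsNoetherian R A := inferInstance
  have : IsNoetherian A A := isNoetherian_of_tower R inferInstance
  have : IsNoetherian A P := isNoetherian_of_isNoetherianRing_of_finite A P
  -- `f' ∘ f` is a linear surjection of a Noetherian module, so that `f` is injective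
  let c : P →ₗ[A] P :=
    { toFun := fun x => f' (f x)
      map_add' := fun x y => by simp
      map_smul' := fun a x => by simp [hf, hf'] }
  have hc : Function.Injective c :=
    IsNoetherian.injective_of_surjective_endomorphism c (hfs'.comp hfs)
  exact ⟨AddEquiv.ofBijective f ⟨fun x y hxy => hc (congrArg f' hxy), hfs⟩, hf⟩

end FixesSimples

/-! ### Equivalences of module categories and centres -/

section Equivalence

open CategoryTheory

/-- Multiplication by a central element `z` on the module `M`. -/
def centerSMul {A : Type u} [Ring A] (z : Subring.center A) (M : ModuleCat.{v} A) : M ⟶ M :=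
  ModuleCat.ofHom
    { toFun := fun x => z.1 • x
      map_add' := smul_add z.1
      map_smul' := fun a x => by
        rw [smul_smul, RingHom.id_apply, smul_smul, Subring.mem_center_iff.1 z.2 a] }

section
variable {A : Type u} [Ring A] (z z' : Subring.center A) (M : ModuleCat.{v} A)

theorem centerSMul_one : centerSMul (1 : Subring.center A) M = 𝟙 M := by
  ext x
  exact one_smul A x

theorem centerSMul_mul : centerSMul (z * z') M = centerSMul z' M ≫ centerSMul z M := by
  ext x
  exact mul_smul z.1 z'.1 x

theorem centerSMul_zero : centerSMul (0 : Subring.center A) M = 0 := by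
  ext x
  exact zero_smul A x

theorem centerSMul_add : centerSMul (z + z') M = centerSMul z M + centerSMul z' M := by
  ext x
  exact add_smul z.1 z'.1 x

end

/-- The homomorphism `A → M`, `1 ↦ m`; the regular module is lifted to a larger universe. -/
def homOfElt {A : Type u} [Ring A] {M : ModuleCat.{max u w} A} (m : M) :
    ModuleCat.of A (ULift.{w} A) ⟶ M :=
  ModuleCat.ofHom ((LinearMap.toSpanSingleton A M m).comp ULift.moduleEquiv.toLinearMap)

theorem homOfElt_apply {A : Type u} [Ring A] {M : ModuleCat.{max u w} A} (m : M)
    (a : ULift.{w} A) : homOfElt m a = a.down • m := rfl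

/-- Evaluation at `1` identifies homomorphisms from the regular module with elements. -/
def homOfEltEquiv {A : Type u} [Ring A] (M : ModuleCat.{max u w} A) :
    M ≃ (ModuleCat.of A (ULift.{w} A) ⟶ M) where
  toFun := homOfElt
  invFun f := f (ULift.up 1)
  left_inv m := by
    change (1 : A) • m = m
    exact one_smul A m
  right_inv f := by
    ext a
    rw [homOfElt_apply, ← map_smul]
    congr 1
    ext
    change a.down * 1 = a.down
    exact mul_one _

theorem homOfElt_smul {A : Type u} [Ring A] {M : ModuleCat.{max u w} A} (c : A) (m : M) :
    homOfElt (c • m) = homOfElt (M := ModuleCat.of A (ULift.{w} A)) (ULift.up c) ≫ homOfElt m := by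
  ext a
  change a.down • c • m = (a.down * c) • m
  rw [mul_smul]

theorem homOfElt_add {A : Type u} [Ring A] {M : ModuleCat.{max u w} A} (m m' : M) :
    homOfElt (m + m') = homOfElt m + homOfElt m' := by
  ext a
  exact smul_add _ _ _

variable {B : Type u₁} [Ring B] {C : Type u₂} [Ring C]
variable (E : ModuleCat.{max u₁ u₂} C ≌ ModuleCat.{max u₁ u₂} B)

instance : E.functor.Additive := E.functor.additive_of_preserves_binary_products

/-- The central elements `z` and `b` act as the same endomorphism of the identity functor under the
equivalence `E`. -/
def CenterRel (z : Subring.center C) (b : Subring.center B) : Prop :=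
  ∀ M : ModuleCat.{max u₁ u₂} C, E.functor.map (centerSMul z M) = centerSMul b (E.functor.obj M)

theorem centerSMul_naturality {A : Type u} [Ring A] (z : Subring.center A) {M N : ModuleCat.{v} A}
    (f : M ⟶ N) : centerSMul z M ≫ f = f ≫ centerSMul z N := by
  ext x
  exact f.hom.map_smul _ _

/-- Every endomorphism of the identity functor of a module category is multiplication by a central
element. -/
theorem exists_centerSMul {A : Type u} [Ring A] (η : ∀ N : ModuleCat.{max u w} A, N ⟶ N)
    (hη : ∀ (M N : ModuleCat.{max u w} A) (f : M ⟶ N), η M ≫ f = f ≫ η N) :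
    ∃ b : Subring.center A, ∀ N, η N = centerSMul b N := by
  set b : A := (η (ModuleCat.of A (ULift.{w} A)) (ULift.up 1)).down with hb
  have key : ∀ (N : ModuleCat.{max u w} A) (x : N), η N x = b • x := fun N x => by
    have := congrArg (fun f => f.hom (ULift.up 1)) (hη _ _ (homOfElt x))
    change b • x = η N ((1 : A) • x) at this
    rw [one_smul] at this
    exact this.symm
  refine ⟨⟨b, Subring.mem_center_iff.2 fun a => ?_⟩, fun N => by ext x; exact key N x⟩
  have h1 := key (ModuleCat.of A (ULift.{w} A)) (a • ULift.up 1)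
  rw [map_smul, key] at h1
  have := congrArg ULift.down h1
  change a * (b * 1) = b * (a * 1) at this
  simpa using this

theorem centerSMul_injective {A : Type u} [Ring A] {z z' : Subring.center A}
    (h : centerSMul z (ModuleCat.of A (ULift.{w} A)) = centerSMul z' _) : z = z' := by
  have := congrArg (fun f => (f.hom (ULift.up (1 : A))).down) h
  change z.1 * 1 = z'.1 * 1 at this
  ext
  simpa using this

/-- The endomorphism of the identity functor of `B`-modules obtained by conjugating multiplication
by `z` with the equivalence is multiplication by a central element. -/
theorem exists_centerRel (z : Subring.center C) : ∃ b, CenterRel E z b := by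
  obtain ⟨b, hb⟩ := exists_centerSMul.{u₁, u₂}
    (fun N : ModuleCat.{max u₁ u₂} B => E.counitIso.inv.app N ≫
      E.functor.map (centerSMul z (E.inverse.obj N)) ≫ E.counitIso.hom.app N) (by
      intro M N f
      have h1 := E.counitIso.hom.naturality f
      have h2 := E.counitIso.inv.naturality f
      dsimp at h1 h2
      simp only [Category.assoc]
      rw [← h1, ← E.functor.map_comp_assoc, centerSMul_naturality, E.functor.map_comp_assoc,
        ← reassoc_of% h2])
  refine ⟨b, fun M => ?_⟩
  have h1 : E.counitIso.inv.app (E.functor.obj M) = E.functor.map (E.unitIso.hom.app M) :=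
    E.counitInv_app_functor M
  have h2 : E.counitIso.hom.app (E.functor.obj M) = E.functor.map (E.unitIso.inv.app M) :=
    E.counit_app_functor M
  rw [← hb, h1, h2, ← E.functor.map_comp, ← E.functor.map_comp, centerSMul_naturality]
  simp

theorem exists_centerRel_symm (b : Subring.center B) : ∃ z, CenterRel E z b := by
  obtain ⟨z, hz⟩ := exists_centerRel E.symm b
  refine ⟨z, fun M => E.inverse.map_injective ?_⟩
  have h1 : E.inverse.map (centerSMul b (E.functor.obj M)) = centerSMul z _ :=
    hz (E.functor.obj M)
  have h2 : centerSMul z M ≫ E.unit.app M = E.unit.app M ≫ centerSMul z _ :=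
    centerSMul_naturality z (E.unit.app M)
  rw [h1, Equivalence.inv_fun_map, h2]
  simp

theorem CenterRel.right_unique {E : ModuleCat.{max u₁ u₂} C ≌ ModuleCat.{max u₁ u₂} B}
    {z : Subring.center C} {b b' : Subring.center B} (h : CenterRel E z b)
    (h' : CenterRel E z b') : b = b' := by
  let N := ModuleCat.of B (ULift.{u₂} B)
  refine centerSMul_injective.{u₁, u₂} ?_
  change centerSMul b N = centerSMul b' N
  have h1 := (h (E.inverse.obj N)).symm.trans (h' _)
  have h2 := centerSMul_naturality b (E.counitIso.hom.app N)
  have h3 := centerSMul_naturality b' (E.counitIso.hom.app N)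
  change centerSMul b (E.functor.obj (E.inverse.obj N)) ≫ _ = _ at h2
  change centerSMul b' (E.functor.obj (E.inverse.obj N)) ≫ _ = _ at h3
  rw [h1, h3] at h2
  exact ((cancel_epi _).1 h2).symm

theorem CenterRel.left_unique {E : ModuleCat.{max u₁ u₂} C ≌ ModuleCat.{max u₁ u₂} B}
    {z z' : Subring.center C} {b : Subring.center B} (h : CenterRel E z b)
    (h' : CenterRel E z' b) : z = z' :=
  centerSMul_injective.{u₂, u₁} (E.functor.map_injective ((h _).trans (h' _).symm))

/-- The homomorphism of centres induced by an equivalence of module categories. -/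
def centerHom : Subring.center C →+* Subring.center B where
      toFun z := (exists_centerRel E z).choose
      map_one' := (exists_centerRel E 1).choose_spec.right_unique fun M => by
        rw [centerSMul_one, centerSMul_one, E.functor.map_id]
      map_mul' := fun z z' => (exists_centerRel E (z * z')).choose_spec.right_unique fun M => by
        rw [centerSMul_mul, centerSMul_mul, E.functor.map_comp, (exists_centerRel E z).choose_spec,
          (exists_centerRel E z').choose_spec]
      map_zero' := (exists_centerRel E 0).choose_spec.right_unique fun M => by
        rw [centerSMul_zero, centerSMul_zero, E.functor.map_zero]
      map_add' := fun z z' => (exists_centerRel E (z + z')).choose_spec.right_unique fun M => by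
        rw [centerSMul_add, centerSMul_add, E.functor.map_add, (exists_centerRel E z).choose_spec,
          (exists_centerRel E z').choose_spec]

theorem centerRel_centerHom (z : Subring.center C) : CenterRel E z (centerHom E z) :=
  (exists_centerRel E z).choose_spec

/-- The isomorphism of centres induced by an equivalence of module categories. -/
def centerEquiv : Subring.center C ≃+* Subring.center B :=
  RingEquiv.ofBijective (centerHom E)
    ⟨fun z z' h => (centerRel_centerHom E z).left_unique (h ▸ centerRel_centerHom E z'),
      fun b => by
        obtain ⟨z, hz⟩ := exists_centerRel_symm E b
        exact ⟨z, (centerRel_centerHom E z).right_unique hz⟩⟩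

theorem centerRel_centerEquiv (z : Subring.center C) : CenterRel E z (centerEquiv E z) :=
  centerRel_centerHom E z

theorem CenterRel.eq_centerEquiv {E : ModuleCat.{max u₁ u₂} C ≌ ModuleCat.{max u₁ u₂} B}
    {z : Subring.center C} {b : Subring.center B} (h : CenterRel E z b) : centerEquiv E z = b :=
  (centerRel_centerEquiv E z).right_unique h

/-- The family of homomorphisms `h i` is jointly epimorphic. -/
def JointlyEpi {A : Type u} [Ring A] {ι : Type*} {Q M : ModuleCat.{v} A} (h : ι → (Q ⟶ M)) :
    Prop :=
  ∀ (N : ModuleCat.{v} A) (f : M ⟶ N), (∀ i, h i ≫ f = 0) → f = 0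

/-- Joint epimorphy, which equivalences preserve, expresses that the images generate. -/
theorem jointlyEpi_iff {A : Type u} [Ring A] {ι : Type*} {Q M : ModuleCat.{v} A}
    (h : ι → (Q ⟶ M)) : JointlyEpi h ↔ ⨆ i, LinearMap.range (h i).hom = ⊤ := by
  constructor
  · intro hh
    set W := ⨆ i, LinearMap.range (h i).hom with hW
    have h0 := hh (ModuleCat.of A (M ⧸ W)) (ModuleCat.ofHom W.mkQ) fun i => by
      ext x
      change W.mkQ ((h i).hom x) = 0
      rw [Submodule.mkQ_apply, Submodule.Quotient.mk_eq_zero]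
      exact Submodule.mem_iSup_of_mem i ⟨x, rfl⟩
    refine eq_top_iff.2 fun x _ => ?_
    have h1 : W.mkQ x = 0 := congrArg (fun f => f.hom x) h0
    rwa [Submodule.mkQ_apply, Submodule.Quotient.mk_eq_zero] at h1
  · intro hh N f hf
    have : ⨆ i, LinearMap.range (h i).hom ≤ LinearMap.ker f.hom := iSup_le fun i => by
      rintro _ ⟨x, rfl⟩
      exact congrArg (fun f => f.hom x) (hf i)
    ext x
    exact this (hh ▸ Submodule.mem_top)

theorem JointlyEpi.map (E : ModuleCat.{max u₁ u₂} C ≌ ModuleCat.{max u₁ u₂} B) {ι : Type w}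
    {Q M : ModuleCat.{max u₁ u₂} C} {h : ι → (Q ⟶ M)} (hh : JointlyEpi h) :
    JointlyEpi fun i => E.functor.map (h i) := by
  intro N f hf
  have h1 := hh _ (E.functor.preimage (f ≫ E.counitIso.inv.app N)) fun i =>
    E.functor.map_injective (by
      rw [E.functor.map_comp, E.functor.map_preimage, reassoc_of% (hf i), E.functor.map_zero,
        Limits.zero_comp])
  have h2 := congrArg E.functor.map h1
  rw [E.functor.map_preimage, E.functor.map_zero] at h2
  have h3 := h2 =≫ E.counitIso.hom.app N
  simpa using h3

theorem JointlyEpi.of_map (E : ModuleCat.{max u₁ u₂} C ≌ ModuleCat.{max u₁ u₂} B) {ι : Type w}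
    {Q M : ModuleCat.{max u₁ u₂} C} {h : ι → (Q ⟶ M)}
    (hh : JointlyEpi fun i => E.functor.map (h i)) : JointlyEpi h := by
  intro N f hf
  refine E.functor.map_injective ?_
  rw [E.functor.map_zero]
  exact hh _ _ fun i => by rw [← E.functor.map_comp, hf, E.functor.map_zero]

/-- An equivalence of module categories sends the regular module to a finitely generated one:
finite generation can be expressed by finite jointly epimorphic families of homomorphisms from a
module, the one corresponding to the regular `B`-module. -/
theorem finite_obj_regular :
    Module.Finite B (E.functor.obj (ModuleCat.of C (ULift.{u₁} C))) := by
  set P := E.functor.obj (ModuleCat.of C (ULift.{u₁} C)) with hP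
  let h : P → (ModuleCat.of B (ULift.{u₂} B) ⟶ P) := homOfElt.{u₁, u₂}
  have hh : JointlyEpi h := by
    intro N f hf
    ext m
    have := congrArg (fun f => f.hom (ULift.up 1)) (hf m)
    change f ((1 : B) • m) = 0 at this
    rwa [one_smul] at this
  have h1 := (jointlyEpi_iff _).1 (hh.map E.symm)
  have hfin : Module.Finite C (E.symm.functor.obj P) :=
    Module.Finite.equiv (ULift.moduleEquiv.symm.trans
      (E.unitIso.app (ModuleCat.of C (ULift.{u₁} C))).toLinearEquiv)
  obtain ⟨s, hs⟩ := (CompleteLattice.isCompactElement_iff_exists_le_iSup_of_le_iSup _).1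
    ((Submodule.fg_iff_compact _).1 hfin.fg_top) _ _ h1.ge
  have h2 : JointlyEpi fun i : s => h i.1 := by
    refine JointlyEpi.of_map E.symm ((jointlyEpi_iff _).2 ?_)
    rw [← top_le_iff, iSup_subtype]
    rwa [Finset.sup_eq_iSup] at hs
  have h3 := (jointlyEpi_iff _).1 h2
  refine ⟨⟨s, ?_⟩⟩
  rw [← top_le_iff, ← h3]
  refine iSup_le fun i => ?_
  rintro _ ⟨x, rfl⟩
  change x.down • i.1 ∈ _
  exact Submodule.smul_mem _ _ (Submodule.subset_span i.2)

end Equivalence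

/-! ### Transport of ring automorphisms along equivalences -/

section Transfer

open CategoryTheory

variable {B : Type u₁} [Ring B] {C : Type u₂} [Ring C]

/-- The conjugate `w f v⁻¹` of a homomorphism `f` by bijections which are semilinear with respect
to the same ring automorphism. -/
def conjHom (α : B ≃+* B) {X Y : ModuleCat.{v} B} (v : X ≃+ X) (w : Y ≃+ Y)
    (hv : ∀ (b : B) (x : X), v (b • x) = α b • v x)
    (hw : ∀ (b : B) (y : Y), w (b • y) = α b • w y) (f : X ⟶ Y) : X ⟶ Y :=
  ModuleCat.ofHom
    { toFun := fun x => w (f (v.symm x))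
      map_add' := fun x y => by simp
      map_smul' := fun b x => by
        have : v.symm (b • x) = α.symm b • v.symm x := v.injective (by simp [hv])
        simp [this, hw] }

theorem conjHom_apply (α : B ≃+* B) {X Y : ModuleCat.{v} B} (v : X ≃+ X) (w : Y ≃+ Y)
    (hv : ∀ (b : B) (x : X), v (b • x) = α b • v x)
    (hw : ∀ (b : B) (y : Y), w (b • y) = α b • w y) (f : X ⟶ Y) (x : X) :
    conjHom α v w hv hw f x = w (f (v.symm x)) := rfl

variable (E : ModuleCat.{max u₁ u₂} C ≌ ModuleCat.{max u₁ u₂} B)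

/-- The module corresponding to the regular `C`-module under the equivalence `E`. -/
abbrev objRegular : ModuleCat.{max u₁ u₂} B := E.functor.obj (ModuleCat.of C (ULift.{u₁} C))

instance : Module.Projective B (objRegular E) := by
  have : Module.Projective C (ULift.{u₁} C) := Module.Projective.of_equiv ULift.moduleEquiv.symm
  have : CategoryTheory.Projective (ModuleCat.of C (ULift.{u₁} C)) := inferInstance
  have : CategoryTheory.Projective (objRegular E) :=
    (E.map_projective_iff _).2 this
  infer_instance

instance : Module.Finite B (objRegular E) := finite_obj_regular E

section

variable {α : B ≃+* B} (v : objRegular E ≃+ objRegular E)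
    (hv : ∀ (b : B) (x : objRegular E), v (b • x) = α b • v x)
    {M : ModuleCat.{max u₁ u₂} C} (w : E.functor.obj M ≃+ E.functor.obj M)
    (hw : ∀ (b : B) (x : E.functor.obj M), w (b • x) = α b • w x)

/-- Given semilinear bijections of the `B`-modules which correspond to the regular `C`-module and
to `M`, the map on `M ≅ Hom(C, M)` given by conjugation. -/
def transferFun (m : M) : M :=
  (homOfEltEquiv.{u₂, u₁} M).symm (E.functor.preimage
    (conjHom α v w hv hw (E.functor.map (homOfElt.{u₂, u₁} m))))

theorem map_homOfElt_transferFun (m : M) :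
    E.functor.map (homOfElt.{u₂, u₁} (transferFun E v hv w hw m)) =
      conjHom α v w hv hw (E.functor.map (homOfElt.{u₂, u₁} m)) := by
  have : homOfElt.{u₂, u₁} (transferFun E v hv w hw m) = E.functor.preimage
    (conjHom α v w hv hw (E.functor.map (homOfElt.{u₂, u₁} m))) :=
    (homOfEltEquiv.{u₂, u₁} M).apply_symm_apply _
  rw [this, E.functor.map_preimage]

theorem map_homOfElt_injective {m m' : M}
    (h : E.functor.map (homOfElt.{u₂, u₁} m) = E.functor.map (homOfElt.{u₂, u₁} m')) : m = m' :=
  (homOfEltEquiv.{u₂, u₁} M).injective (E.functor.map_injective h)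

theorem map_homOfElt_smul (c : C) (m : M) (x : objRegular E) :
    E.functor.map (homOfElt.{u₂, u₁} (c • m)) x =
      E.functor.map (homOfElt.{u₂, u₁} m) (E.functor.map (homOfElt.{u₂, u₁}
        (M := ModuleCat.of C (ULift.{u₁} C)) (ULift.up c)) x) := by
  rw [homOfElt_smul, E.functor.map_comp]
  rfl

/-- Conjugation as an additive bijection. -/
def transferEquiv : M ≃+ M where
  toFun := transferFun E v hv w hw
  invFun := transferFun (α := α.symm) E v.symm (fun b x => v.injective (by simp [hv])) w.symm
    (fun b x => w.injective (by simp [hw]))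
  left_inv m := map_homOfElt_injective E (by
    rw [map_homOfElt_transferFun]
    ext x
    rw [conjHom_apply, map_homOfElt_transferFun, conjHom_apply]
    simp)
  right_inv m := map_homOfElt_injective E (by
    rw [map_homOfElt_transferFun]
    ext x
    rw [conjHom_apply, map_homOfElt_transferFun, conjHom_apply]
    simp)
  map_add' m m' := map_homOfElt_injective E (by
    rw [homOfElt_add, E.functor.map_add]
    ext x
    change _ = E.functor.map _ x + E.functor.map _ x
    rw [map_homOfElt_transferFun, map_homOfElt_transferFun, map_homOfElt_transferFun,
      homOfElt_add, E.functor.map_add]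
    exact map_add w _ _)

theorem map_homOfElt_transferEquiv (m : M) (x : objRegular E) :
    E.functor.map (homOfElt.{u₂, u₁} (transferEquiv E v hv w hw m)) x =
      w (E.functor.map (homOfElt.{u₂, u₁} m) (v.symm x)) := by
  have := map_homOfElt_transferFun E v hv w hw m
  exact congrArg (fun f => f.hom x) this

/-- The automorphism of `C = End(C)ᵒᵖ` induced by conjugation on the endomorphisms of the
corresponding `B`-module. -/
def transferRingEquiv : C ≃+* C :=
  let f := transferEquiv E (M := ModuleCat.of C (ULift.{u₁} C)) v hv v hv
  { toFun := fun c => (f (ULift.up c)).down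
    invFun := fun c => (f.symm (ULift.up c)).down
    left_inv := fun c => congrArg ULift.down (f.symm_apply_apply (ULift.up c))
    right_inv := fun c => congrArg ULift.down (f.apply_symm_apply (ULift.up c))
    map_add' := fun c d => congrArg ULift.down (f.map_add (ULift.up c) (ULift.up d))
    map_mul' := fun c d => by
      have : f (ULift.up (c * d)) = (f (ULift.up c)).down • f (ULift.up d) := by
        refine map_homOfElt_injective E ?_
        ext x
        have h0 : (ULift.up (c * d) : ModuleCat.of C (ULift.{u₁} C)) =
          c • (ULift.up d : ModuleCat.of C (ULift.{u₁} C)) := rfl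
        rw [map_homOfElt_transferEquiv, map_homOfElt_smul, map_homOfElt_transferEquiv, h0,
          map_homOfElt_smul]
        change _ = v (E.functor.map _ (v.symm (E.functor.map (homOfElt (f (ULift.up c))) x)))
        rw [map_homOfElt_transferEquiv, v.symm_apply_apply]
      exact congrArg ULift.down this }

theorem transferEquiv_smul (c : C) (m : M) :
    transferEquiv E v hv w hw (c • m) =
      transferRingEquiv E v hv c • transferEquiv E v hv w hw m := by
  refine map_homOfElt_injective E ?_
  ext x
  rw [map_homOfElt_transferEquiv, map_homOfElt_smul, map_homOfElt_smul,
    map_homOfElt_transferEquiv]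
  change _ = w (E.functor.map _ (v.symm (E.functor.map (homOfElt
    (transferEquiv E (M := ModuleCat.of C (ULift.{u₁} C)) v hv v hv (ULift.up c))) x)))
  rw [map_homOfElt_transferEquiv, v.symm_apply_apply]

theorem transferRingEquiv_center {z z' : Subring.center C} {b b' : Subring.center B}
    (hz : CenterRel E z b) (hz' : CenterRel E z' b') (hb : b'.1 = α b.1) :
    transferRingEquiv E v hv z.1 = z'.1 := by
  have key : ∀ z : Subring.center C, homOfElt.{u₂, u₁} (M := ModuleCat.of C (ULift.{u₁} C))
      (ULift.up z.1) = centerSMul z _ := fun z => by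
    ext c
    change c.down * z.1 = z.1 * c.down
    exact Subring.mem_center_iff.1 z.2 _
  have : transferEquiv E (M := ModuleCat.of C (ULift.{u₁} C)) v hv v hv (ULift.up z.1) =
      ULift.up z'.1 := by
    refine map_homOfElt_injective E ?_
    ext x
    rw [map_homOfElt_transferEquiv, key, key, hz, hz']
    change v (b.1 • v.symm x) = b'.1 • x
    rw [hv, v.apply_symm_apply, hb]
  exact congrArg ULift.down this

end

/-- A ring automorphism of `B` which fixes the simple modules is transported along an equivalence
of module categories to such an automorphism of `C`, compatibly with the isomorphism of centres. -/
theorem FixesSimples.exists_transfer {α : B ≃+* B} (hα : FixesSimples α)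
    (R : Type w) [CommRing R] [IsLocalRing R] [IsNoetherianRing R]
    [Algebra R B] [Module.Finite R B] :
    ∃ β : C ≃+* C, FixesSimples β ∧ ∀ z z' : Subring.center C,
      (centerEquiv E z').1 = α (centerEquiv E z).1 → β z.1 = z'.1 := by
  obtain ⟨v, hv⟩ := hα.exists_addEquiv_of_projective R (objRegular E)
  refine ⟨transferRingEquiv E v hv, fun I hI => ?_, fun z z' h =>
    transferRingEquiv_center E v hv (centerRel_centerEquiv E z) (centerRel_centerEquiv E z') h⟩
  let S := ModuleCat.of C (ULift.{u₁} (C ⧸ I))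
  have h1 : IsSimpleModule C (C ⧸ I) := isSimpleModule_iff_isCoatom.2 hI
  have h2 : IsSimpleModule C (ULift.{u₁} (C ⧸ I)) := IsSimpleModule.congr ULift.moduleEquiv
  have h3 : Simple S := simple_iff_isSimpleModule.2 h2
  have h4 : Simple (E.functor.obj S) := simple_obj E.functor S
  have h5 : IsSimpleModule B (E.functor.obj S) := (simple_iff_isSimpleModule' _).1 h4
  obtain ⟨w, hw⟩ := hα.exists_addEquiv (E.functor.obj S)
  let f := transferEquiv E v hv w hw
  refine ⟨AddEquiv.ulift.symm.trans (f.trans AddEquiv.ulift), fun c x => ?_⟩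
  exact congrArg ULift.down (transferEquiv_smul E v hv w hw c (ULift.up x))

end Transfer

/-! ### Equivalences between modules over quotient rings -/

section Descent

open CategoryTheory

section

variable {A : Type u} [Ring A] {A' : Type u} [Ring A'] (π : A →+* A')

/-- The kernel of `π` acts as zero on the module `X`. -/
def IsKilledByKer (X : ModuleCat.{v} A) : Prop := ∀ a : A, π a = 0 → ∀ x : X, a • x = 0

variable {π} (hπ : Function.Surjective π) {X : ModuleCat.{v} A} (hX : IsKilledByKer π X)

/-- The action of `A'` on an `A`-module which is killed by the kernel of `π : A → A'`. -/
def liftAction : A' →+* AddMonoid.End X :=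
  π.liftOfSurjective hπ ⟨Module.toAddMonoidEnd A X, fun a ha => by
    ext x
    exact hX a ha x⟩

/-- The carrier of an `A`-module which is killed by the kernel of the surjection `π : A → A'`,
considered as an `A'`-module. -/
def LiftCarrier (_ : Function.Surjective π) (_ : IsKilledByKer π X) : Type v := X

instance : AddCommGroup (LiftCarrier hπ hX) := inferInstanceAs (AddCommGroup X)

instance : Module A' (LiftCarrier hπ hX) :=
  let _ : Module A' X := Module.compHom X (liftAction hπ hX)
  inferInstanceAs (Module A' X)

/-- An `A`-module which is killed by the kernel of the surjection `π : A → A'`,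
as an `A'`-module. -/
abbrev liftModule : ModuleCat.{v} A' := ModuleCat.of A' (LiftCarrier hπ hX)

/-- The identity map from a module which is killed by the kernel to the associated module over the
quotient. -/
def toLiftModule : X ≃+ liftModule hπ hX := AddEquiv.refl X

theorem toLiftModule_smul (a : A) (x : X) :
    toLiftModule hπ hX (a • x) = π a • toLiftModule hπ hX x := by
  have h : liftAction hπ hX (π a) = Module.toAddMonoidEnd A X a :=
    RingHom.liftOfRightInverse_comp_apply _ _ _ _ _
  exact (DFunLike.congr_fun h x).symm

theorem isKilledByKer_restrictScalars (Y : ModuleCat.{v} A') :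
    IsKilledByKer π ((ModuleCat.restrictScalars π).obj Y) := fun a ha x => by
  rw [ModuleCat.restrictScalars.smul_def, ha, zero_smul]
  rfl

theorem IsKilledByKer.of_iso {X Y : ModuleCat.{v} A} (e : X ≅ Y) (h : IsKilledByKer π X) :
    IsKilledByKer π Y := fun a ha y => by
  have := h a ha (e.toLinearEquiv.symm y)
  rw [← map_smul] at this
  exact e.toLinearEquiv.symm.map_eq_zero_iff.1 this

/-- The homomorphism of modules over the quotient given by `f`. -/
def liftHom {X' : ModuleCat.{v} A} (hX' : IsKilledByKer π X') (f : X ⟶ X') :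
    liftModule hπ hX ⟶ liftModule hπ hX' :=
  let g : liftModule hπ hX →ₗ[A'] liftModule hπ hX' :=
    { toFun := fun x => toLiftModule hπ hX' (f ((toLiftModule hπ hX).symm x))
      map_add' := fun x y => by simp only [map_add]
      map_smul' := fun a x => by
        obtain ⟨a, rfl⟩ := hπ a
        obtain ⟨x, rfl⟩ := (toLiftModule hπ hX).surjective x
        rw [← toLiftModule_smul, AddEquiv.symm_apply_apply, map_smul, toLiftModule_smul,
          AddEquiv.symm_apply_apply]
        rfl }
  ModuleCat.ofHom g

/-- The homomorphism over `A` underlying a homomorphism over the quotient. -/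
def unliftHom {X' : ModuleCat.{v} A} (hX' : IsKilledByKer π X')
    (f : liftModule hπ hX ⟶ liftModule hπ hX') : X ⟶ X' :=
  ModuleCat.ofHom
    { toFun := fun x => (toLiftModule hπ hX').symm (f (toLiftModule hπ hX x))
      map_add' := fun x y => by simp only [map_add]
      map_smul' := fun a x => by
        rw [toLiftModule_smul, AddEquiv.symm_apply_eq, RingHom.id_apply, toLiftModule_smul,
          AddEquiv.apply_symm_apply]
        exact f.hom.map_smul _ _ }

/-- Restriction along a surjection is full. -/
def ofRestrictScalarsHom {Y Y' : ModuleCat.{v} A'}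
    (f : (ModuleCat.restrictScalars π).obj Y ⟶ (ModuleCat.restrictScalars π).obj Y') : Y ⟶ Y' :=
  ModuleCat.ofHom
    { toFun := fun y => f.hom y
      map_add' := fun x y => f.hom.map_add x y
      map_smul' := fun c y => by
        obtain ⟨c, rfl⟩ := hπ c
        exact f.hom.map_smul c y }

/-- The module `liftModule hπ hX` restricts to `X`. -/
def restrictScalarsLiftModuleIso :
    (ModuleCat.restrictScalars π).obj (liftModule hπ hX) ≅ X :=
  let e : X ≃ₗ[A] (ModuleCat.restrictScalars π).obj (liftModule hπ hX) :=
    { toLiftModule hπ hX with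
      map_smul' := fun a x => toLiftModule_smul hπ hX a x }
  e.symm.toModuleIso

/-- If `X` is isomorphic to the restriction of `Y`, then `liftModule hπ hX` is isomorphic
to `Y`. -/
def liftModuleIso {Y : ModuleCat.{v} A'} (e : X ≅ (ModuleCat.restrictScalars π).obj Y) :
    liftModule hπ hX ≅ Y :=
  let f : liftModule hπ hX ≃ₗ[A'] Y :=
    { (toLiftModule hπ hX).symm.trans e.toLinearEquiv.toAddEquiv with
      map_smul' := fun a x => by
        obtain ⟨a, rfl⟩ := hπ a
        obtain ⟨x, rfl⟩ := (toLiftModule hπ hX).surjective x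
        change e.toLinearEquiv ((toLiftModule hπ hX).symm (π a • toLiftModule hπ hX x)) =
          π a • (show Y from e.toLinearEquiv ((toLiftModule hπ hX).symm (toLiftModule hπ hX x)))
        rw [← toLiftModule_smul, AddEquiv.symm_apply_apply, AddEquiv.symm_apply_apply]
        exact map_smul e.toLinearEquiv a x }
  f.toModuleIso

end

variable {B : Type u₁} [Ring B] {C : Type u₂} [Ring C] {B' : Type u₁} [Ring B'] {C' : Type u₂}
  [Ring C'] (E : ModuleCat.{max u₁ u₂} C ≌ ModuleCat.{max u₁ u₂} B)
  {πB : B →+* B'} {πC : C →+* C'} (hB : Function.Surjective πB)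
  (hE : ∀ X, IsKilledByKer πC X ↔ IsKilledByKer πB (E.functor.obj X))

/-- The functor between the module categories of quotient rings which is induced by an equivalence
matching up the modules over these. -/
def descentFunctor : ModuleCat.{max u₁ u₂} C' ⥤ ModuleCat.{max u₁ u₂} B' where
  obj Y := liftModule hB ((hE ((ModuleCat.restrictScalars πC).obj Y)).1
    (isKilledByKer_restrictScalars Y))
  map f := liftHom hB _ _ (E.functor.map ((ModuleCat.restrictScalars πC).map f))
  map_id Y := by
    ext x
    change toLiftModule hB _ (E.functor.map ((ModuleCat.restrictScalars πC).map (𝟙 Y)) _) = x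
    rw [CategoryTheory.Functor.map_id, CategoryTheory.Functor.map_id]
    rfl
  map_comp f g := by
    ext x
    change toLiftModule hB _ (E.functor.map ((ModuleCat.restrictScalars πC).map (f ≫ g)) _) = _
    rw [CategoryTheory.Functor.map_comp, CategoryTheory.Functor.map_comp]
    rfl

instance : (descentFunctor E hB hE).Faithful where
  map_injective {Y Y'} f g h := by
    have h1 : E.functor.map ((ModuleCat.restrictScalars πC).map f) =
        E.functor.map ((ModuleCat.restrictScalars πC).map g) := by
      ext x
      exact congrArg (fun f => f.hom (toLiftModule hB
        ((hE _).1 (isKilledByKer_restrictScalars Y)) x)) h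
    exact (ModuleCat.restrictScalars πC).map_injective (E.functor.map_injective h1)

theorem descentFunctor_full (hC : Function.Surjective πC) : (descentFunctor E hB hE).Full where
  map_surjective {Y Y'} f := by
    let g := unliftHom hB ((hE _).1 (isKilledByKer_restrictScalars Y))
      ((hE _).1 (isKilledByKer_restrictScalars Y')) f
    refine ⟨ofRestrictScalarsHom hC (E.functor.preimage g), ?_⟩
    ext x
    change toLiftModule hB _ (E.functor.map (E.functor.preimage g) ((toLiftModule hB _).symm x)) = _
    rw [E.functor.map_preimage]
    rfl

theorem descentFunctor_essSurj (hC : Function.Surjective πC) :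
    (descentFunctor E hB hE).EssSurj where
  mem_essImage Y := by
    let Z := (ModuleCat.restrictScalars πB).obj Y
    have hZ : IsKilledByKer πC (E.inverse.obj Z) := (hE _).2
      ((isKilledByKer_restrictScalars Y).of_iso (E.counitIso.app Z).symm)
    exact ⟨liftModule hC hZ, ⟨liftModuleIso hB _
      (E.functor.mapIso (restrictScalarsLiftModuleIso hC hZ) ≪≫ E.counitIso.app Z)⟩⟩

/-- The equivalence between the module categories of quotient rings which is induced by an
equivalence matching up the modules over these. -/
def descentEquivalence (hC : Function.Surjective πC) :
    ModuleCat.{max u₁ u₂} C' ≌ ModuleCat.{max u₁ u₂} B' :=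
  have := descentFunctor_full E hB hE hC
  have := descentFunctor_essSurj E hB hE hC
  have : (descentFunctor E hB hE).IsEquivalence := { }
  (descentFunctor E hB hE).asEquivalence

theorem CenterRel.descentEquivalence (hC : Function.Surjective πC) {z : Subring.center C}
    {b : Subring.center B} (h : CenterRel E z b) {z' : Subring.center C'} {b' : Subring.center B'}
    (hz : z'.1 = πC z.1) (hb : b'.1 = πB b.1) :
    CenterRel (descentEquivalence E hB hE hC) z' b' := by
  intro M
  ext x
  obtain ⟨x, rfl⟩ := (toLiftModule hB
    ((hE _).1 (isKilledByKer_restrictScalars (π := πC) M))).surjective x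
  have h1 : (ModuleCat.restrictScalars πC).map (centerSMul z' M) = centerSMul z _ := by
    ext y
    change z'.1 • (show M from y) = πC z.1 • (show M from y)
    rw [hz]
  change toLiftModule hB _ (E.functor.map ((ModuleCat.restrictScalars πC).map (centerSMul z' M)) x)
    = b'.1 • (toLiftModule hB _ x)
  rw [h1, h, hb]
  exact toLiftModule_smul _ _ _ _

end Descent

/-! ### Coefficients of idempotents in group algebras -/

section Characters

variable {F : Type u} [Field F]

/-- The spectral decomposition of an element `x` with `x ^ N = 1`. -/
theorem exists_spectral_idempotents [CharZero F] {A : Type v} [Ring A] [Algebra F A] {N : ℕ}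
    (hN : N ≠ 0) {ζ : F} (hζ : IsPrimitiveRoot ζ N) {x : A} (hx : x ^ N = 1) :
    ∃ E : ℕ → A, (∀ i, IsIdempotentElem (E i)) ∧
      ∀ s : ℕ, x ^ s = ∑ i ∈ Finset.range N, ζ ^ (i * s) • E i := by
  have hζ0 : ζ ≠ 0 := hζ.ne_zero hN
  have hN0 : (N : F) ≠ 0 := Nat.cast_ne_zero.2 hN
  -- the projections to the eigenspaces, given by finite Fourier inversion
  let E : ℕ → A := fun i => (N : F)⁻¹ • ∑ j ∈ Finset.range N, (ζ⁻¹) ^ (i * j) • x ^ j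
  have hE : ∀ i, x * E i = ζ ^ i • E i := by
    intro i
    have h1 : ∀ j, x * ((ζ⁻¹) ^ (i * j) • x ^ j) =
        ζ ^ i • ((ζ⁻¹) ^ (i * (j + 1)) • x ^ (j + 1)) := fun j => by
      rw [mul_smul_comm, smul_smul, pow_succ' x, mul_add, mul_one, pow_add, mul_left_comm,
        ← mul_pow, mul_inv_cancel₀ hζ0, one_pow, mul_one]
    have h2 : ∑ j ∈ Finset.range N, (ζ⁻¹) ^ (i * (j + 1)) • x ^ (j + 1) =
        ∑ j ∈ Finset.range N, (ζ⁻¹) ^ (i * j) • x ^ j := by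
      have h3 := Finset.sum_range_succ' (fun j => (ζ⁻¹) ^ (i * j) • x ^ j) N
      have h4 := Finset.sum_range_succ (fun j => (ζ⁻¹) ^ (i * j) • x ^ j) N
      have h5 : (ζ⁻¹) ^ (i * N) • x ^ N = (ζ⁻¹) ^ (i * 0) • x ^ 0 := by
        rw [hx, mul_comm, pow_mul, inv_pow, hζ.pow_eq_one]
        simp
      rw [h4, h5] at h3
      exact (add_right_cancel h3).symm
    simp only [E]
    rw [mul_smul_comm, Finset.mul_sum, Finset.sum_congr rfl fun j _ => h1 j, ← Finset.smul_sum, h2,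
      smul_comm]
  have hE' : ∀ i s, x ^ s * E i = ζ ^ (i * s) • E i := by
    intro i s
    induction s with
    | zero => simp
    | succ s ih =>
      rw [pow_succ', mul_assoc, ih, mul_smul_comm, hE, smul_smul, ← pow_add]
      rfl
  have hsum : ∑ i ∈ Finset.range N, E i = 1 := by
    simp only [E]
    rw [← Finset.smul_sum, Finset.sum_comm]
    have h1 : ∀ j ∈ Finset.range N, ∑ i ∈ Finset.range N, (ζ⁻¹) ^ (i * j) • x ^ j =
        if j = 0 then (N : F) • (1 : A) else 0 := by
      intro j hj
      rw [← Finset.sum_smul]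
      split_ifs with h
      · simp [h]
      · have h2 : (ζ⁻¹) ^ j ≠ 1 := by
          intro h3
          rw [inv_pow, inv_eq_one] at h3
          exact h (Nat.eq_zero_of_dvd_of_lt (hζ.dvd_of_pow_eq_one j h3) (Finset.mem_range.1 hj))
        have h3 : ∑ i ∈ Finset.range N, (ζ⁻¹) ^ (i * j) = 0 := by
          have h4 := mul_neg_geom_sum ((ζ⁻¹) ^ j) N
          rw [← pow_mul, mul_comm j N, pow_mul, inv_pow ζ N, hζ.pow_eq_one, inv_one, one_pow,
            sub_self] at h4
          have h5 := (mul_eq_zero.1 h4).resolve_left (sub_ne_zero.2 (Ne.symm h2))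
          rw [← h5]
          exact Finset.sum_congr rfl fun i _ => by rw [← pow_mul, mul_comm]
        rw [h3, zero_smul]
    rw [Finset.sum_congr rfl h1, Finset.sum_ite_eq' (Finset.range N) 0,
      if_pos (Finset.mem_range.2 (Nat.pos_of_ne_zero hN)), smul_smul, inv_mul_cancel₀ hN0, one_smul]
  refine ⟨E, fun i => ?_, fun s => ?_⟩
  · change E i * E i = E i
    conv_lhs => enter [1]; simp only [E]
    rw [smul_mul_assoc, Finset.sum_mul]
    have h1 : ∀ j ∈ Finset.range N, (ζ⁻¹) ^ (i * j) • x ^ j * E i = E i := fun j _ => by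
      rw [smul_mul_assoc, hE', smul_smul, ← mul_pow, inv_mul_cancel₀ hζ0, one_pow, one_smul]
    rw [Finset.sum_congr rfl h1, Finset.sum_const, Finset.card_range, ← Nat.cast_smul_eq_nsmul F,
      smul_smul, inv_mul_cancel₀ hN0, one_smul]
  · calc x ^ s = x ^ s * ∑ i ∈ Finset.range N, E i := by rw [hsum, mul_one]
      _ = _ := by rw [Finset.mul_sum]; exact Finset.sum_congr rfl fun i _ => hE' i s

variable {G : Type v} [Group G] [Finite G]

/-- The trace form of the group algebra in terms of coefficients: left multiplication by a group
element other than `1` permutes the basis without fixed points. -/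
theorem trace_mulLeft (u : MonoidAlgebra F G) :
    LinearMap.trace F _ (LinearMap.mulLeft F u) = Nat.card G * u.coeff 1 := by
  classical
  have := Fintype.ofFinite G
  rw [LinearMap.trace_eq_matrix_trace F (MonoidAlgebra.basis G F), Matrix.trace,
    Nat.card_eq_fintype_card, ← nsmul_eq_mul, ← Finset.card_univ, ← Finset.sum_const]
  refine Finset.sum_congr rfl fun g _ => ?_
  rw [Matrix.diag_apply, LinearMap.toMatrix_apply, MonoidAlgebra.basis_apply,
    LinearMap.mulLeft_apply]
  change (u * MonoidAlgebra.single g 1).coeff g = _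
  simp

instance : Module.Finite F (MonoidAlgebra F G) :=
  Module.Finite.of_basis (MonoidAlgebra.basis G F)

/-- The coefficient at `1` of an idempotent of the group algebra is rational: up to the factor
`|G|` it is the rank of a projection. -/
theorem exists_rat_coeff_one [CharZero F] {u : MonoidAlgebra F G} (hu : IsIdempotentElem u) :
    ∃ d : ℚ, u.coeff 1 = d ∧ (u ≠ 0 → d ≠ 0) := by
  have h1 : IsIdempotentElem (LinearMap.mulLeft F u) := by
    change LinearMap.mulLeft F u * LinearMap.mulLeft F u = _
    ext x
    simp only [Module.End.mul_apply, LinearMap.mulLeft_apply, LinearMap.coe_comp,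
      Function.comp_apply, ← mul_assoc, hu.eq]
  have hG : (Nat.card G : F) ≠ 0 := Nat.cast_ne_zero.2 Nat.card_pos.ne'
  have h2 := (LinearMap.IsIdempotentElem.isProj_range _ h1).trace
  rw [trace_mulLeft] at h2
  refine ⟨(Module.finrank F (LinearMap.range (LinearMap.mulLeft F u)) : ℚ) / Nat.card G, ?_,
    fun h0 hd => h0 ?_⟩
  · push_cast
    rw [← h2, mul_div_cancel_left₀ _ hG]
  · rw [div_eq_zero_iff, or_iff_left (Nat.cast_ne_zero.2 Nat.card_pos.ne'), Nat.cast_eq_zero,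
      Submodule.finrank_eq_zero, LinearMap.range_eq_bot] at hd
    simpa using LinearMap.congr_fun hd 1

/-- A central nilpotent element of the group algebra in characteristic zero vanishes. -/
theorem eq_zero_of_isNilpotent_of_central [CharZero F] {u : MonoidAlgebra F G}
    (hu : IsNilpotent u) (hc : ∀ x, u * x = x * u) : u = 0 := by
  have hG : (Nat.card G : F) ≠ 0 := Nat.cast_ne_zero.2 Nat.card_pos.ne'
  ext g
  have h1 : IsNilpotent (u * MonoidAlgebra.single g⁻¹ (1 : F)) :=
    Commute.isNilpotent_mul_right (hc _) hu
  have h2 : IsNilpotent (LinearMap.mulLeft F (u * MonoidAlgebra.single g⁻¹ (1 : F))) :=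
    h1.map (Algebra.lmul F (MonoidAlgebra F G))
  have h3 := (LinearMap.isNilpotent_trace_of_isNilpotent h2).eq_zero
  rw [trace_mulLeft] at h3
  have h4 := (mul_eq_zero.1 h3).resolve_left hG
  simpa using h4

/-- The pairs `(q(ζ), q(ζ ^ r))` for rational polynomials `q`: the graph of the
automorphism `ζ ↦ ζ ^ r` of the cyclotomic field `ℚ(ζ)`, if `r` is prime to the order of `ζ`. -/
def cycloPairs [CharZero F] (ζ : F) (r : ℕ) : Subalgebra ℚ (F × F) :=
  (Polynomial.aeval (R := ℚ) ((ζ, ζ ^ r) : F × F)).range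

theorem pow_mem_cycloPairs [CharZero F] (ζ : F) (r i : ℕ) :
    ((ζ ^ i, ζ ^ (i * r)) : F × F) ∈ cycloPairs ζ r :=
  ⟨Polynomial.X ^ i, by simp [pow_mul, mul_comm i r]⟩

theorem rat_mem_cycloPairs [CharZero F] (ζ : F) (r : ℕ) (d : ℚ) :
    ((d, d) : F × F) ∈ cycloPairs ζ r := by
  have h := (cycloPairs ζ r).algebraMap_mem d
  rwa [Prod.algebraMap_apply, eq_ratCast] at h

/-- The coefficients of a central idempotent are essentially character values; they lie in
cyclotomic fields, whose automorphisms act on them by powers of group elements. -/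
theorem coeff_mem_cycloPairs [CharZero F] {N : ℕ} (hN : N ≠ 0) {ζ : F}
    (hζ : IsPrimitiveRoot ζ N) (r : ℕ) {e : MonoidAlgebra F G} (he : IsIdempotentElem e)
    (hc : ∀ x, e * x = x * e) (y : G) (hy : y ^ N = 1) :
    ((e.coeff y, e.coeff (y ^ r)) : F × F) ∈ cycloPairs ζ r := by
  obtain ⟨E, hE, hx⟩ := exists_spectral_idempotents (A := MonoidAlgebra F G) hN hζ
    (x := MonoidAlgebra.of F G y⁻¹) (by rw [← map_pow, inv_pow, hy, inv_one, map_one])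
  have hEe : ∀ i, IsIdempotentElem (E i * e) := fun i => by
    change E i * e * (E i * e) = E i * e
    rw [mul_assoc, ← mul_assoc e, hc (E i), mul_assoc, he.eq, ← mul_assoc, (hE i).eq]
  choose d hd _ using fun i => exists_rat_coeff_one (hEe i)
  -- the coefficient of `e` at `y ^ s` is the coefficient of `y ^ (-s) * e` at `1`
  have key : ∀ s : ℕ, e.coeff (y ^ s) = ∑ i ∈ Finset.range N, ζ ^ (i * s) * d i := by
    intro s
    have h1 := hx s
    rw [← map_pow] at h1
    have h2 : e.coeff (y ^ s) = (MonoidAlgebra.of F G (y⁻¹ ^ s) * e).coeff 1 := by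
      rw [MonoidAlgebra.of_apply]
      simp
    rw [h2, h1, Finset.sum_mul, MonoidAlgebra.coeff_sum, Finset.sum_apply']
    refine Finset.sum_congr rfl fun i _ => ?_
    rw [smul_mul_assoc, MonoidAlgebra.coeff_smul_apply, hd, smul_eq_mul]
  have h1 := key 1
  rw [pow_one] at h1
  rw [h1, key r]
  have : ((∑ i ∈ Finset.range N, ζ ^ (i * 1) * d i, ∑ i ∈ Finset.range N, ζ ^ (i * r) * d i) :
      F × F) = ∑ i ∈ Finset.range N, ((ζ ^ i, ζ ^ (i * r)) : F × F) * ((d i, d i) : F × F) := by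
    ext <;> simp [Prod.fst_sum, Prod.snd_sum]
  rw [this]
  exact Subalgebra.sum_mem _ fun i _ =>
    mul_mem (pow_mem_cycloPairs ζ r i) (rat_mem_cycloPairs ζ r (d i))

end Characters

/-! ### Class sums and homomorphisms between centres -/

section Central

variable {R : Type u} [CommRing R] {G : Type v} [Group G]

theorem MonoidAlgebra.central_iff (u : MonoidAlgebra R G) :
    (∀ x, u * x = x * u) ↔ ∀ g y : G, u.coeff (y * g * y⁻¹) = u.coeff g := by
  constructor
  · intro h g y
    have h1 := congrArg (fun z => z.coeff (y * g)) (h (MonoidAlgebra.single y 1))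
    simpa using h1
  · intro h x
    induction x using MonoidAlgebra.induction_on with
    | of g =>
      ext y
      rw [MonoidAlgebra.of_apply]
      have h1 := h (g⁻¹ * y) g
      rw [mul_inv_cancel_left] at h1
      simpa using h1
    | add a b ha hb => rw [mul_add, add_mul, ha, hb]
    | smul r a ha => rw [mul_smul_comm, smul_mul_assoc, ha]

/-- Central elements of the group algebra are class functions. -/
theorem coeff_eq_of_isConj {u : MonoidAlgebra R G} (hu : ∀ x, u * x = x * u) {g h : G}
    (hgh : IsConj g h) : u.coeff h = u.coeff g := by
  obtain ⟨c, rfl⟩ := isConj_iff.1 hgh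
  exact (MonoidAlgebra.central_iff u).1 hu g c

end Central

section ClassSums

variable (R : Type u) [CommRing R] {G : Type v} [Group G] [Finite G]

/-- The sum of the conjugates of `g` in the group algebra. -/
def classSum (g : G) : MonoidAlgebra R G :=
  ∑ x ∈ (Set.toFinite {x : G | IsConj g x}).toFinset, MonoidAlgebra.single x 1

open scoped Classical in
theorem coeff_classSum (g x : G) : (classSum R g).coeff x = if IsConj g x then 1 else 0 := by
  rw [classSum, MonoidAlgebra.coeff_sum, Finset.sum_apply']
  simp [Finsupp.single_apply]

variable {R}

theorem classSum_central (g : G) (x : MonoidAlgebra R G) :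
    classSum R g * x = x * classSum R g := by
  classical
  refine (MonoidAlgebra.central_iff _).2 (fun a y => ?_) x
  rw [coeff_classSum, coeff_classSum]
  have h : IsConj a (y * a * y⁻¹) := isConj_iff.2 ⟨y, rfl⟩
  simp only [show IsConj g (y * a * y⁻¹) ↔ IsConj g a from
    ⟨fun h' => h'.trans h.symm, fun h' => h'.trans h⟩]

/-- The class sums span the centre of the group algebra. -/
theorem eq_sum_classSum {u : MonoidAlgebra R G} (hu : ∀ x, u * x = x * u) :
    ∃ (s : Finset G) (c : G → R), u = ∑ g ∈ s, c g • classSum R g := by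
  classical
  have : Fintype (Quotient (IsConj.setoid G)) := Fintype.ofFinite _
  refine ⟨Finset.univ.image (Quotient.out : Quotient (IsConj.setoid G) → G), u.coeff, ?_⟩
  rw [Finset.sum_image (fun a _ b _ h => Quotient.out_injective h)]
  ext x
  rw [MonoidAlgebra.coeff_sum, Finset.sum_apply',
    Fintype.sum_eq_single (Quotient.mk (IsConj.setoid G) x)]
  · have h : IsConj (Quotient.out (Quotient.mk (IsConj.setoid G) x)) x :=
      ConjClasses.mk_eq_mk_iff_isConj.1 (Quotient.out_eq _)
    rw [MonoidAlgebra.coeff_smul_apply, coeff_classSum, if_pos h, coeff_eq_of_isConj hu h]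
    simp
  · intro c hc
    rw [MonoidAlgebra.coeff_smul_apply, coeff_classSum, if_neg, smul_zero]
    intro h
    refine hc ?_
    exact (Quotient.out_eq c).symm.trans (ConjClasses.mk_eq_mk_iff_isConj.2 h)

theorem coeff_classSum_mul (g : G) (e : MonoidAlgebra R G) :
    (classSum R g * e).coeff 1 =
      ∑ x ∈ (Set.toFinite {x : G | IsConj g x}).toFinset, e.coeff x⁻¹ := by
  rw [classSum, Finset.sum_mul, MonoidAlgebra.coeff_sum, Finset.sum_apply']
  simp

end ClassSums

section Kernel

/-- A finite-dimensional reduced commutative algebra over an algebraically closed field is spanned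
by its primitive idempotents. -/
theorem exists_idempotents_of_isReduced {F : Type u} [Field F] [IsAlgClosed F]
    (A : Type v) [CommRing A] [Algebra F A] [Module.Finite F A]
    [IsReduced A] : ∃ (ι : Type v) (_ : Fintype ι) (ε : ι → A), (∀ i, IsIdempotentElem (ε i)) ∧
      (∀ i, ε i ≠ 0) ∧ ∀ x, ∃ c : ι → F, x = ∑ i, c i • ε i ∧ ∀ i, x * ε i = c i • ε i := by
  classical
  have : IsArtinianRing A := isArtinian_of_tower F inferInstance
  have := Fintype.ofFinite (MaximalSpectrum A)
  let φ := IsArtinianRing.equivPi A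
  let ε : MaximalSpectrum A → A := fun I => φ.symm (Pi.single I 1)
  have hc : ∀ (x : A) (I : MaximalSpectrum A), ∃ c : F,
      algebraMap F (A ⧸ I.asIdeal) c = Ideal.Quotient.mk I.asIdeal x := fun x I => by
    have := I.isMaximal
    let _ : Field (A ⧸ I.asIdeal) := Ideal.Quotient.field _
    exact (IsAlgClosed.algebraMap_bijective_of_isIntegral (k := F)
      (K := A ⧸ I.asIdeal)).2 _
  have hφ : ∀ (c : F) (x : A), φ (c • x) = c • φ x := fun c x => by
    rw [← algebraMap_smul A c x, map_smul, algebraMap_smul]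
  refine ⟨MaximalSpectrum A, inferInstance, ε, fun I => ?_, fun I h => ?_, fun x => ?_⟩
  · change φ.symm _ * φ.symm _ = φ.symm _
    rw [← map_mul, ← Pi.single_mul, one_mul]
  · have h1 : (Pi.single I 1 : ∀ I : MaximalSpectrum A, A ⧸ I.asIdeal) = 0 :=
      φ.symm.injective (h.trans (map_zero φ.symm).symm)
    have h2 := congrFun h1 I
    rw [Pi.single_eq_same] at h2
    have := I.isMaximal
    exact one_ne_zero h2
  · choose c hc using hc x
    have h2 : ∀ I, x * ε I = c I • ε I := fun I => by
      refine φ.injective ?_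
      rw [map_mul, hφ, AlgEquiv.apply_symm_apply]
      funext J
      rw [Pi.mul_apply, Pi.smul_apply]
      by_cases h : J = I
      · subst h
        rw [Pi.single_eq_same, mul_one, Algebra.smul_def, mul_one, hc]
        rfl
      · rw [Pi.single_eq_of_ne h, mul_zero, smul_zero]
    refine ⟨c, ?_, h2⟩
    rw [Finset.sum_congr rfl fun I _ => (h2 I).symm, ← Finset.mul_sum]
    have h3 : ∑ I, ε I = 1 := by
      refine φ.injective ?_
      rw [map_sum, map_one, Finset.sum_congr rfl fun I _ => AlgEquiv.apply_symm_apply φ _]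
      funext J
      rw [Finset.sum_apply]
      simp
    rw [h3, mul_one]

/-- A commutative algebra of central elements of a group algebra in characteristic zero is
reduced. -/
theorem isReduced_of_injective_central {F : Type u} [Field F] [CharZero F]
    {G : Type v} [Group G] [Finite G] {A : Type u₁} [CommRing A] [Algebra F A]
    (j : A →ₙₐ[F] MonoidAlgebra F G) (hj : Function.Injective j)
    (hjc : ∀ a x, j a * x = x * j a) : IsReduced A := by
  refine ⟨fun a ⟨n, hn⟩ => hj ?_⟩
  rw [map_zero]
  refine eq_zero_of_isNilpotent_of_central ⟨n + 1, ?_⟩ (hjc a)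
  have h : ∀ m : ℕ, j a ^ (m + 1) = j (a ^ (m + 1)) := fun m => by
    induction m with
    | zero => simp
    | succ m ih => rw [pow_succ, ih, pow_succ a (m + 1), map_mul]
  rw [h, pow_succ, hn, zero_mul, map_zero]

variable {F : Type u} [Field F] [IsAlgClosed F] [CharZero F]

variable {G : Type v} [Group G] [Finite G] {H : Type w} [Group H] [Finite H]

/-- Let `A` be a commutative algebra of central elements of `F G` (with its own identity) and
`Φ` a homomorphism from `A` to the centre of `F H`. The matrix coefficients of `Φ` with respect to
class sums lie in cyclotomic fields, and cyclotomic automorphisms act on them by powers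
of group elements: this holds for the coefficients of idempotents, and these span `A`. -/
theorem coeff_classSum_mem_cycloPairs {A : Type u₁} [CommRing A] [Algebra F A] [Module.Finite F A]
    (j : A →ₙₐ[F] MonoidAlgebra F G) (hj : Function.Injective j)
    (hjc : ∀ a x, j a * x = x * j a)
    (Φ : A →ₙₐ[F] MonoidAlgebra F H) (hΦc : ∀ a x, Φ a * x = x * Φ a)
    {N : ℕ} (hN : N ≠ 0) {ζ : F} (hζ : IsPrimitiveRoot ζ N) {r t : ℕ}
    (hGN : ∀ g : G, g ^ N = 1) (hHN : ∀ h : H, h ^ N = 1)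
    (hGt : ∀ g : G, (g ^ t) ^ r = g) (hHt : ∀ h : H, (h ^ t) ^ r = h)
    (g : G) (h : H) {x x' : A} (hx : j x = classSum F g * j 1)
    (hx' : j x' = classSum F (g ^ t) * j 1) :
    ((((Φ x').coeff (h ^ t)), (Φ x).coeff h) : F × F) ∈ cycloPairs ζ r := by
  have := isReduced_of_injective_central j hj hjc
  obtain ⟨ι, _, ε, hε, hε0, hsp⟩ := exists_idempotents_of_isReduced (F := F) A
  have hje : ∀ i, IsIdempotentElem (j (ε i)) := fun i => by
    change j _ * j _ = j _
    rw [← map_mul, (hε i).eq]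
  have hΦe : ∀ i, IsIdempotentElem (Φ (ε i)) := fun i => by
    change Φ _ * Φ _ = Φ _
    rw [← map_mul, (hε i).eq]
  choose d hd hd0 using fun i => exists_rat_coeff_one (hje i)
  have hd0' : ∀ i, (d i : F) ≠ 0 := fun i => Rat.cast_ne_zero.2 (hd0 i fun h0 =>
    hε0 i (hj (h0.trans (map_zero j).symm)))
  -- the coefficients of `y` with respect to the idempotents are read off from the form
  -- `(u, v) ↦ (u * v).coeff 1`
  have key : ∀ (y : A) (a : G), j y = classSum F a * j 1 → ∀ b : H,
      (Φ y).coeff b = ∑ i, ((d i : F)⁻¹ *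
        ∑ x ∈ (Set.toFinite {x : G | IsConj a x}).toFinset, (j (ε i)).coeff x⁻¹) *
          (Φ (ε i)).coeff b := by
    intro y a hy b
    obtain ⟨c, hc, hc'⟩ := hsp y
    have h1 : ∀ i, c i = (d i : F)⁻¹ *
        ∑ x ∈ (Set.toFinite {x : G | IsConj a x}).toFinset, (j (ε i)).coeff x⁻¹ := fun i => by
      rw [← coeff_classSum_mul, eq_inv_mul_iff_mul_eq₀ (hd0' i), ← hd i, mul_comm, ← smul_eq_mul,
        ← MonoidAlgebra.coeff_smul_apply, ← map_smul, ← hc', map_mul, hy, mul_assoc, ← map_mul,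
        one_mul]
    rw [hc, map_sum, MonoidAlgebra.coeff_sum, Finset.sum_apply']
    refine Finset.sum_congr rfl fun i _ => ?_
    rw [map_smul, MonoidAlgebra.coeff_smul_apply, smul_eq_mul, h1]
  have hsum : ∀ i, ∑ x ∈ (Set.toFinite {x : G | IsConj g x}).toFinset, (j (ε i)).coeff x⁻¹ =
      ∑ x ∈ (Set.toFinite {x : G | IsConj (g ^ t) x}).toFinset, (j (ε i)).coeff (x⁻¹ ^ r) := by
    intro i
    have hGr : ∀ a : G, (a ^ r) ^ t = a := fun a => by
      rw [← pow_mul, mul_comm, pow_mul, hGt]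
    refine Finset.sum_bij' (fun x _ => x ^ t) (fun x _ => x ^ r) ?_ ?_ ?_ ?_ ?_
    · intro a ha
      simp only [Set.Finite.mem_toFinset, Set.mem_ofPred_eq] at ha ⊢
      exact ha.pow t
    · intro a ha
      simp only [Set.Finite.mem_toFinset, Set.mem_ofPred_eq] at ha ⊢
      simpa only [hGt] using ha.pow r
    · exact fun a _ => hGt a
    · exact fun a _ => hGr a
    · intro a _
      simp only [inv_pow, hGt]
  rw [key x' _ hx' (h ^ t), key x _ hx h]
  have : ((∑ i, ((d i : F)⁻¹ * ∑ x ∈ (Set.toFinite {x : G | IsConj (g ^ t) x}).toFinset,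
        (j (ε i)).coeff x⁻¹) * (Φ (ε i)).coeff (h ^ t),
      ∑ i, ((d i : F)⁻¹ * ∑ x ∈ (Set.toFinite {x : G | IsConj g x}).toFinset,
        (j (ε i)).coeff x⁻¹) * (Φ (ε i)).coeff h) : F × F) =
      ∑ i, ((((d i)⁻¹ : ℚ), ((d i)⁻¹ : ℚ)) : F × F) *
        (∑ x ∈ (Set.toFinite {x : G | IsConj (g ^ t) x}).toFinset,
          (((j (ε i)).coeff x⁻¹, (j (ε i)).coeff (x⁻¹ ^ r)) : F × F)) *
        (((Φ (ε i)).coeff (h ^ t), (Φ (ε i)).coeff ((h ^ t) ^ r)) : F × F) := by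
    ext
    · simp [Prod.fst_sum]
    · simp only [Prod.snd_sum, Prod.snd_mul, hHt, hsum, Rat.cast_inv]
  rw [this]
  refine Subalgebra.sum_mem _ fun i _ => mul_mem (mul_mem (rat_mem_cycloPairs ζ r _)
    (Subalgebra.sum_mem _ fun x _ => ?_)) ?_
  · exact coeff_mem_cycloPairs hN hζ r (hje i) (hjc _) _ (hGN _)
  · exact coeff_mem_cycloPairs hN hζ r (hΦe i) (hΦc _) _ (hHN _)

end Kernel

/-! ### Reduction of cyclotomic conjugates -/

section Residue

open scoped NumberField

/-- With respect to the valuation at a nonzero prime ideal `P` of a Dedekind domain, either `u / v`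
is integral, and thus equal to `w / s` with `s ∉ P`, or `v / u` has positive valuation, and is thus
equal to `w / s` with `w ∈ P` and `s ∉ P`. -/
theorem exists_mul_eq_of_isPrime {A : Type u} [CommRing A] [IsDedekindDomain A] (P : Ideal A)
    [hP : P.IsPrime] (hP0 : P ≠ ⊥) (u v : A) :
    ∃ s w : A, (s ∉ P ∧ s * u = w * v) ∨ (s ∉ P ∧ w ∈ P ∧ s * v = w * u) := by
  have : IsDiscreteValuationRing (Localization.AtPrime P) :=
    IsLocalization.AtPrime.isDiscreteValuationRing_of_dedekind_domain A hP0 _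
  have hinj : Function.Injective (algebraMap A (Localization.AtPrime P)) :=
    IsLocalization.injective _ P.primeCompl_le_nonZeroDivisors
  have key : ∀ u v : A, algebraMap A (Localization.AtPrime P) v ∣ algebraMap A _ u →
      ∃ s w : A, s ∉ P ∧ s * u = w * v := by
    rintro u v ⟨c, hc⟩
    obtain ⟨⟨w, s⟩, hw⟩ := IsLocalization.surj P.primeCompl c
    refine ⟨s, w, s.2, hinj ?_⟩
    rw [map_mul, map_mul, hc, ← hw]
    ring
  rcases ValuationRing.dvd_total (algebraMap A (Localization.AtPrime P) v) (algebraMap A _ u) with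
    h | h
  · obtain ⟨s, w, hs, h⟩ := key u v h
    exact ⟨s, w, Or.inl ⟨hs, h⟩⟩
  · obtain ⟨s, w, hs, h⟩ := key v u h
    by_cases hw : w ∈ P
    · exact ⟨s, w, Or.inr ⟨hs, hw, h⟩⟩
    · exact ⟨w, s, Or.inl ⟨hw, h.symm⟩⟩

/-- Let `κ` be a field of characteristic `p`, the target of homomorphisms `g, g'` from the ring of
integers of the `N`-th cyclotomic field, such that `g'` sends a primitive root of unity to the
`r`-th power of its image under `g`. Then `g'` is the composition of `g` with the Frobenius, as the
ring of integers is generated by the root of unity. -/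
theorem ringOfIntegers_hom_eq_pow (p : ℕ) [Fact p.Prime] {N : ℕ} [NeZero N] {K : Type w} [Field K]
    [CharZero K] [IsCyclotomicExtension {N} ℚ K] {η : K} (hη : IsPrimitiveRoot η N) {κ : Type u}
    [Field κ] [CharP κ p] (g g' : 𝓞 K →+* κ) {r : ℕ} (hrp : r ≡ p [MOD ordCompl[p] N])
    (h : g' hη.toInteger = g hη.toInteger ^ r) (y : 𝓞 K) : g' y = g y ^ p := by
  have h1 : g hη.toInteger ^ ordCompl[p] N = 1 := by
    have h2 : (g hη.toInteger ^ ordCompl[p] N) ^ p ^ N.factorization p = 1 := by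
      rw [← pow_mul, mul_comm, Nat.ordProj_mul_ordCompl_eq_self, ← map_pow,
        hη.toInteger_isPrimitiveRoot.pow_eq_one, map_one]
    have h3 : iterateFrobenius κ p (N.factorization p) (g hη.toInteger ^ ordCompl[p] N) =
        iterateFrobenius κ p (N.factorization p) 1 := by
      rw [iterateFrobenius_def, h2, map_one]
    exact (iterateFrobenius κ p _).injective h3
  have h2 : g hη.toInteger ^ r = g hη.toInteger ^ p := by
    have h3 : r % orderOf (g hη.toInteger) = p % orderOf (g hη.toInteger) :=
      hrp.of_dvd (orderOf_dvd_of_pow_eq_one h1)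
    rw [← pow_mod_orderOf, h3, pow_mod_orderOf]
  have h3 : g'.toIntAlgHom = ((frobenius κ p).comp g).toIntAlgHom := by
    refine AlgHom.ext_of_adjoin_eq_top
      (IsCyclotomicExtension.Rat.adjoin_singleton_eq_top hη) fun z hz => ?_
    rw [Set.mem_singleton_iff.1 hz]
    change g' _ = g _ ^ p
    rw [h, h2]
  exact congrArg (fun f => f y) h3

variable {O : Type u} [CommRing O] [IsLocalRing O] (p : ℕ) [Fact p.Prime]
  [CharP (ResidueField O) p] {F : Type v} [Field F] [Algebra O F] [FaithfulSMul O F]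

/-- If two elements of `O` are the images of the same element of a cyclotomic field under
embeddings `f, f'` such that `f' η = f η ^ r`, where `r` is congruent to `p` modulo the `p'`-part
of the order of `η`, then their residues are related by the Frobenius. -/
theorem residue_eq_pow_of_embeddings {N : ℕ} [NeZero N] {K : Type w} [Field K] [CharZero K]
    [IsCyclotomicExtension {N} ℚ K] {η : K} (hη : IsPrimitiveRoot η N)
    {r : ℕ} (hrp : r ≡ p [MOD ordCompl[p] N]) (f f' : K →+* F) (hf : f' η = f η ^ r) (x : K)
    {a b : O} (hxa : f x = algebraMap O F a) (hxb : f' x = algebraMap O F b) :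
    residue O b = residue O a ^ p := by
  have : NumberField K := IsCyclotomicExtension.numberField {N} ℚ K
  -- The residue field of `O` is embedded in the residue field of its integral closure in `F`, at a
  -- maximal ideal `Q`; the embeddings `f` and `f'` send algebraic integers to the integral closure.
  obtain ⟨Q, hQ, hQO⟩ := Ideal.exists_ideal_over_maximal_of_isIntegral (S := integralClosure O F)
    (maximalIdeal O) (by
      intro y hy
      have h1 : algebraMap O F y = 0 := congrArg Subtype.val (RingHom.mem_ker.1 hy)
      rw [(map_eq_zero_iff _ (FaithfulSMul.algebraMap_injective O F)).1 h1]
      exact Ideal.zero_mem _)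
  let _ : Field (integralClosure O F ⧸ Q) := Ideal.Quotient.field Q
  let π : integralClosure O F →+* integralClosure O F ⧸ Q := Ideal.Quotient.mk Q
  have hmem : ∀ y : O, π (algebraMap O _ y) = 0 ↔ residue O y = 0 := fun y => by
    rw [residue_eq_zero_iff, ← hQO, Ideal.mem_comap]
    exact Ideal.Quotient.eq_zero_iff_mem
  have hp0 : ((p : ℕ) : integralClosure O F ⧸ Q) = 0 := by
    have := (hmem (p : O)).2 (by rw [map_natCast, CharP.cast_eq_zero])
    rwa [map_natCast, map_natCast] at this
  have : CharP (integralClosure O F ⧸ Q) p :=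
    ringChar.of_eq (CharP.ringChar_of_prime_eq_zero Fact.out hp0)
  have hint : ∀ (f : K →+* F) (y : 𝓞 K), f y ∈ integralClosure O F := fun f y => by
    have h1 : IsIntegral ℤ (f y) := y.2.map f.toIntAlgHom
    exact h1.tower_top
  let lift : (K →+* F) → 𝓞 K →+* integralClosure O F := fun f =>
    (f.comp (algebraMap (𝓞 K) K)).codRestrict _ (hint f)
  let g := π.comp (lift f)
  let g' := π.comp (lift f')
  have hg : g' hη.toInteger = g hη.toInteger ^ r := by
    change π (lift f' hη.toInteger) = π (lift f hη.toInteger) ^ r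
    rw [← map_pow]
    exact congrArg π (Subtype.ext hf)
  have hgg := ringOfIntegers_hom_eq_pow p hη g g' hrp hg
  have hP0 : RingHom.ker g ≠ ⊥ := by
    intro h
    have h1 : ((p : ℕ) : 𝓞 K) ∈ RingHom.ker g := by
      rw [RingHom.mem_ker, map_natCast, hp0]
    rw [h, Ideal.mem_bot, Nat.cast_eq_zero] at h1
    exact (Fact.out : p.Prime).ne_zero h1
  have := RingHom.ker_isPrime g
  obtain ⟨u, v, hv, hx⟩ := IsFractionRing.div_surjective (A := 𝓞 K) x
  have hv0 : algebraMap (𝓞 K) K v ≠ 0 := by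
    simpa using nonZeroDivisors.ne_zero hv
  -- `x` is a quotient of algebraic integers with denominator prime to the kernel of `g`; otherwise
  -- `x⁻¹` would have positive valuation there, contradicting that `f x` lies in `O`
  have key : ∃ s w : 𝓞 K, g s ≠ 0 ∧ (s : K) * x = w := by
    obtain ⟨s, w, ⟨hs, h⟩ | ⟨hs, hw, h⟩⟩ := exists_mul_eq_of_isPrime (RingHom.ker g) hP0 u v
    · refine ⟨s, w, hs, ?_⟩
      rw [← hx, mul_div_assoc', div_eq_iff hv0]
      exact_mod_cast congrArg (algebraMap (𝓞 K) K) h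
    · exfalso
      have h1 : (s : K) = w * x := by
        rw [← hx, mul_div_assoc', eq_div_iff hv0]
        exact_mod_cast congrArg (algebraMap (𝓞 K) K) h
      have h2 : lift f s = lift f w * algebraMap O _ a := by
        refine Subtype.ext ?_
        change f s = f w * algebraMap O F a
        rw [h1, map_mul, hxa]
      refine hs ?_
      rw [RingHom.mem_ker] at hw ⊢
      change π (lift f s) = 0
      rw [h2, map_mul, show π (lift f w) = 0 from hw, zero_mul]
  obtain ⟨s, w, hs, h⟩ := key
  have h1 : g s * π (algebraMap O _ a) = g w := by
    change π (lift f s) * _ = π (lift f w)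
    rw [← map_mul]
    refine congrArg π (Subtype.ext ?_)
    change f s * algebraMap O F a = f w
    rw [← hxa, ← map_mul, h]
  have h2 : g' s * π (algebraMap O _ b) = g' w := by
    change π (lift f' s) * _ = π (lift f' w)
    rw [← map_mul]
    refine congrArg π (Subtype.ext ?_)
    change f' s * algebraMap O F b = f' w
    rw [← hxb, ← map_mul, h]
  rw [hgg, hgg, ← h1, mul_pow] at h2
  have h3 := mul_left_cancel₀ (pow_ne_zero p hs) h2
  rw [← map_pow, ← map_pow, ← sub_eq_zero, ← map_sub, ← map_sub, hmem, map_sub, map_pow,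
    sub_eq_zero] at h3
  exact h3

/-- If two elements of `O` are conjugate by an automorphism of a cyclotomic field which acts as
`ω ↦ ω ^ p` on the roots of unity of order prime to `p`, then their residues are related by the
Frobenius. -/
theorem residue_eq_pow_of_mem_cycloPairs [CharZero F] {N : ℕ} [NeZero N] {ζ : F}
    (hζ : IsPrimitiveRoot ζ N) {r : ℕ} (hr : r.Coprime N) (hrp : r ≡ p [MOD ordCompl[p] N]) {a b : O}
    (hab : ((algebraMap O F a, algebraMap O F b) : F × F) ∈ cycloPairs ζ r) :
    residue O b = residue O a ^ p := by
  obtain ⟨K, _, _, _, _⟩ : ∃ (K : Type) (_ : Field K) (_ : CharZero K),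
      ∃ _ : IsCyclotomicExtension {N} ℚ K, True := by
    refine ⟨CyclotomicField N ℚ, inferInstance, inferInstance, ?_, trivial⟩
    have h : (DivisionRing.toRatAlgebra : Algebra ℚ (CyclotomicField N ℚ)) =
      CyclotomicField.algebra N ℚ := Subsingleton.elim _ _
    rw [h]
    exact CyclotomicField.isCyclotomicExtension N ℚ
  have hζK := IsCyclotomicExtension.zeta_spec N ℚ K
  have hirr := Polynomial.cyclotomic.irreducible_rat (NeZero.pos N)
  have hemb : ∀ η : F, IsPrimitiveRoot η N →
      ∃ f : K →ₐ[ℚ] F, f (IsCyclotomicExtension.zeta N ℚ K) = η := fun η hη => by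
    let e := hζK.embeddingsEquivPrimitiveRoots F hirr
    refine ⟨e.symm ⟨η, (mem_primitiveRoots (NeZero.pos N)).2 hη⟩, ?_⟩
    rw [← hζK.embeddingsEquivPrimitiveRoots_apply_coe F hirr]
    exact congrArg Subtype.val (e.apply_symm_apply _)
  obtain ⟨f, hf⟩ := hemb ζ hζ
  obtain ⟨f', hf'⟩ := hemb (ζ ^ r) (hζ.pow_of_coprime r hr)
  obtain ⟨q, hq⟩ := hab
  refine residue_eq_pow_of_embeddings p hζK hrp f.toRingHom f'.toRingHom ?_
    (Polynomial.aeval (IsCyclotomicExtension.zeta N ℚ K) q) ?_ ?_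
  · exact hf'.trans (hf ▸ rfl)
  · change f _ = _
    rw [← Polynomial.aeval_algHom_apply, hf]
    have := congrArg (AlgHom.fst ℚ F F) hq
    simpa [← Polynomial.aeval_algHom_apply] using this
  · change f' _ = _
    rw [← Polynomial.aeval_algHom_apply, hf']
    have := congrArg (AlgHom.snd ℚ F F) hq
    simpa [← Polynomial.aeval_algHom_apply] using this

end Residue

/-! ### Exponents describing `ζ` and cyclotomic Frobenius automorphisms -/

section Exponents

theorem IsCyclotomicFrobenius.pow {p : ℕ} {F : Type u} [Field F] {τ : F ≃+* F}
    (hτ : IsCyclotomicFrobenius p 1 τ) (n : ℕ) :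
    IsCyclotomicFrobenius p n (τ ^ n) := by
  intro ω ω' hω hω'
  induction n with
  | zero => simp
  | succ n ih =>
    rw [pow_succ', RingAut.mul_apply, ih, hτ _ _ hω, pow_one, ← pow_mul, ← pow_succ]
    obtain ⟨m, hm, h⟩ := hω'
    exact ⟨m, hm, by rw [← pow_mul, mul_comm, pow_mul, h, one_pow]⟩

theorem Nat.ModEq.pow_eq_pow {M : Type*} [Monoid M] {x : M} {N a b : ℕ} (h : a ≡ b [MOD N])
    (hx : x ^ N = 1) : x ^ a = x ^ b :=
  by rw [pow_eq_pow_mod a hx, pow_eq_pow_mod b hx, h]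

variable (p : ℕ) [hp : Fact p.Prime]

/-- There is an exponent whose powers are the identity on elements of `p`-power order, and the
`p ^ n`-th power map on elements of order prime to `p`. -/
theorem exists_exponent (n : ℕ) {N : ℕ} (hN : N ≠ 0) :
    ∃ r, r ≡ 1 [MOD ordProj[p] N] ∧ r ≡ p ^ n [MOD ordCompl[p] N] ∧ r.Coprime N := by
  have hc : Nat.Coprime (ordProj[p] N) (ordCompl[p] N) :=
    (Nat.coprime_ordCompl hp.out hN).pow_left _
  obtain ⟨r, h1, h2⟩ := Nat.chineseRemainder hc 1 (p ^ n)
  refine ⟨r, h1, h2, ?_⟩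
  rw [← Nat.ordProj_mul_ordCompl_eq_self N p]
  refine Nat.Coprime.mul_right ?_ ?_
  · exact h1.gcd_eq.trans (Nat.gcd_one_left _)
  · exact h2.gcd_eq.trans ((Nat.coprime_ordCompl hp.out hN).pow_left _)

theorem exists_inverse_exponent {r N : ℕ} (hN : N ≠ 0) (hr : r.Coprime N) :
    ∃ t, t * r ≡ 1 [MOD N] := by
  refine ⟨r ^ (N.totient - 1), ?_⟩
  rw [← pow_succ, Nat.sub_add_cancel (Nat.totient_pos.2 (Nat.pos_of_ne_zero hN))]
  exact Nat.ModEq.pow_totient hr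

/-- The map `g ↦ g_p g_{p'} ^ (1 / p)` is a power map, with exponent inverse to one which is `1` on
`p`-parts and `p` on `p'`-parts. -/
theorem zetaElt_eq_pow {G : Type v} [Group G] [Finite G] {r t N : ℕ} (hN : N ≠ 0)
    (h1 : r ≡ 1 [MOD ordProj[p] N]) (h2 : r ≡ p [MOD ordCompl[p] N]) (ht : t * r ≡ 1 [MOD N])
    {g : G} (hg : g ^ N = 1) : zetaElt p g = g ^ t := by
  have hdvd : orderOf g ∣ N := orderOf_dvd_of_pow_eq_one hg
  have hP : pPart p g ^ (ordProj[p] N) = 1 := by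
    obtain ⟨c, hc⟩ := Nat.ordProj_dvd_ordProj_of_dvd hN hdvd p
    rw [hc, pow_mul, pPart_pow_eq_one, one_pow]
  have hM : pPrimePart p g ^ (ordCompl[p] N) = 1 := by
    obtain ⟨c, hc⟩ := Nat.ordCompl_dvd_ordCompl_of_dvd hdvd p
    rw [hc, pow_mul, pPrimePart_pow_eq_one, one_pow]
  have hz : pRoot p (pPrimePart p g) ^ (ordCompl[p] N) = 1 := by
    rw [pRoot, ← pow_mul, mul_comm, pow_mul, hM, one_pow]
  have htP : t ≡ 1 [MOD ordProj[p] N] := by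
    simpa using (h1.mul_left t).symm.trans (ht.of_dvd (Nat.ordProj_dvd N p))
  have htM : p * t ≡ 1 [MOD ordCompl[p] N] := by
    rw [mul_comm]
    exact (h2.mul_left t).symm.trans (ht.of_dvd (Nat.ordCompl_dvd N p))
  have hgt : g ^ t = pPart p g ^ t * pPrimePart p g ^ t := by
    rw [← (commute_pPart_pPrimePart p g).mul_pow, pPart_mul_pPrimePart]
  rw [hgt, htP.pow_eq_pow hP, pow_one, zetaElt]
  congr 1
  conv_rhs => rw [← pRoot_pow p (pPrimePart p g) (coprime_orderOf_pPrimePart p g)]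
  rw [← pow_mul, htM.pow_eq_pow hz, pow_one]

variable {p}
variable {F : Type u} [Field F]

/-- A cyclotomic Frobenius automorphism acts on `N`-th roots of unity as a power map. -/
theorem IsCyclotomicFrobenius.apply_eq_pow {n : ℕ} {τ : F ≃+* F} (hτ : IsCyclotomicFrobenius p n τ)
    {N s : ℕ} (hN : N ≠ 0) (h1 : s ≡ 1 [MOD ordProj[p] N]) (h2 : s ≡ p ^ n [MOD ordCompl[p] N])
    {ω : F} (hω : ω ^ N = 1) : τ ω = ω ^ s := by
  have hc : Nat.Coprime (ordProj[p] N) (ordCompl[p] N) :=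
    (Nat.coprime_ordCompl hp.out hN).pow_left _
  have hmul := Nat.ordProj_mul_ordCompl_eq_self N p
  -- `ω ^ u` is the `p`-part of `ω`, and `ω ^ v` is the `p'`-part
  obtain ⟨u, hu1, hu2⟩ := Nat.chineseRemainder hc 1 0
  obtain ⟨v, hv1, hv2⟩ := Nat.chineseRemainder hc 0 1
  have huv : u + v ≡ 1 [MOD N] := by
    rw [← hmul]
    exact (Nat.modEq_and_modEq_iff_modEq_mul hc).1 ⟨hu1.add hv1, hu2.add hv2⟩
  have hs : u + v * p ^ n ≡ s [MOD N] := by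
    rw [← hmul]
    refine (Nat.modEq_and_modEq_iff_modEq_mul hc).1 ⟨?_, ?_⟩
    · simpa using (hu1.add (hv1.mul_right (p ^ n))).trans (by simpa using h1.symm)
    · simpa using (hu2.add (hv2.mul_right (p ^ n))).trans (by simpa using h2.symm)
  have hω' : ω = ω ^ u * ω ^ v := by
    rw [← pow_add, huv.pow_eq_pow hω, pow_one]
  have h3 := hτ (ω ^ u) (ω ^ v) ⟨N.factorization p, ?_⟩ ⟨ordCompl[p] N,
    Nat.coprime_ordCompl hp.out hN, ?_⟩
  · rw [← hω', ← pow_mul, ← pow_add, hs.pow_eq_pow hω] at h3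
    exact h3
  · obtain ⟨c, rfl⟩ := (Nat.modEq_zero_iff_dvd).1 hu2
    rw [← pow_mul, mul_comm, ← mul_assoc, hmul, pow_mul, hω, one_pow]
  · obtain ⟨c, rfl⟩ := (Nat.modEq_zero_iff_dvd).1 hv1
    rw [← pow_mul, mul_right_comm, hmul, pow_mul, hω, one_pow]

theorem IsCyclotomicFrobenius.apply_eq_of_mem_cycloPairs [CharZero F] {τ : F ≃+* F}
    (hτ : IsCyclotomicFrobenius p 1 τ) {N r : ℕ} (hN : N ≠ 0) (h1 : r ≡ 1 [MOD ordProj[p] N])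
    (h2 : r ≡ p [MOD ordCompl[p] N]) {ζ : F} (hζ : ζ ^ N = 1) {a b : F}
    (hab : (a, b) ∈ cycloPairs ζ r) : τ a = b := by
  obtain ⟨q, hq⟩ := hab
  let f₁ : Polynomial ℚ →ₐ[ℚ] F := ((τ : F →+* F).toRatAlgHom).comp
    ((AlgHom.fst ℚ F F).comp (Polynomial.aeval ((ζ, ζ ^ r) : F × F)))
  let f₂ : Polynomial ℚ →ₐ[ℚ] F :=
    (AlgHom.snd ℚ F F).comp (Polynomial.aeval ((ζ, ζ ^ r) : F × F))
  have hf : f₁ = f₂ := by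
    refine Polynomial.algHom_ext ?_
    simpa [f₁, f₂] using hτ.apply_eq_pow hN h1 (by simpa using h2) hζ
  have h3 := congrArg (fun f => f q) hf
  have h4 : Polynomial.aeval ((ζ, ζ ^ r) : F × F) q = (a, b) := hq
  simpa [f₁, f₂, h4] using h3

theorem IsCyclotomicFrobenius.apply_eq_apply {n : ℕ} {τ τ' : F ≃+* F}
    (hτ : IsCyclotomicFrobenius p n τ) (hτ' : IsCyclotomicFrobenius p n τ') {N : ℕ} (hN : N ≠ 0)
    {ω : F} (hω : ω ^ N = 1) : τ ω = τ' ω := by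
  obtain ⟨s, h1, h2, -⟩ := exists_exponent p n hN
  rw [hτ.apply_eq_pow hN h1 h2 hω, hτ'.apply_eq_pow hN h1 h2 hω]

end Exponents

/-! ### The map `ζ` on centres of group algebras -/

section ZetaMap

theorem MonoidAlgebra.mapRingHom_smul {R : Type u} [CommRing R] {S : Type w} [CommRing S]
    {G : Type v} [Group G] (f : R →+* S) (c : R) (x : MonoidAlgebra R G) :
    MonoidAlgebra.mapRingHom G f (c • x) = f c • MonoidAlgebra.mapRingHom G f x := by
  ext g
  simp

variable (p : ℕ) {R : Type u} [CommRing R] {G : Type v} [Group G]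

theorem zeta_add (x y : MonoidAlgebra R G) : zeta p (x + y) = zeta p x + zeta p y :=
  MonoidAlgebra.mapDomain_add _ _ _

theorem zeta_smul (c : R) (x : MonoidAlgebra R G) : zeta p (c • x) = c • zeta p x :=
  MonoidAlgebra.mapDomain_smul _ _ _

theorem zeta_sum {ι : Type*} (s : Finset ι) (x : ι → MonoidAlgebra R G) :
    zeta p (∑ i ∈ s, x i) = ∑ i ∈ s, zeta p (x i) :=
  map_sum (MonoidAlgebra.mapDomainLinearMap R R (zetaElt p) : MonoidAlgebra R G →ₗ[R] _) _ _

theorem zeta_iterate_smul (n : ℕ) (c : R) (x : MonoidAlgebra R G) :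
    (zeta p)^[n] (c • x) = c • (zeta p)^[n] x := by
  induction n generalizing x with
  | zero => rfl
  | succ n ih => rw [Function.iterate_succ_apply, zeta_smul, ih, Function.iterate_succ_apply]

theorem zeta_mapRingHom {S : Type w} [CommRing S] (f : R →+* S) (x : MonoidAlgebra R G) :
    zeta p (MonoidAlgebra.mapRingHom G f x) = MonoidAlgebra.mapRingHom G f (zeta p x) := by
  induction x using MonoidAlgebra.induction_on with
  | of g => simp [zeta]
  | add a b ha hb => rw [map_add, zeta_add, ha, hb, zeta_add, map_add]
  | smul r a ha =>
    rw [MonoidAlgebra.mapRingHom_smul, zeta_smul, ha, zeta_smul, MonoidAlgebra.mapRingHom_smul]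

theorem zeta_iterate_mapRingHom {S : Type w} [CommRing S] (f : R →+* S) (n : ℕ)
    (x : MonoidAlgebra R G) : (zeta p)^[n] (MonoidAlgebra.mapRingHom G f x) =
      MonoidAlgebra.mapRingHom G f ((zeta p)^[n] x) := by
  induction n generalizing x with
  | zero => rfl
  | succ n ih => rw [Function.iterate_succ_apply, zeta_mapRingHom, ih, Function.iterate_succ_apply]

variable {p} {r t : ℕ}

theorem coeff_zeta (hG : ∀ g : G, zetaElt p g = g ^ t) (hGt : ∀ g : G, (g ^ t) ^ r = g)
    (x : MonoidAlgebra R G) (g : G) : (zeta p x).coeff (g ^ t) = x.coeff g := by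
  have hinj : Function.Injective (zetaElt p : G → G) := fun a b h => by
    rw [← hGt a, ← hGt b, ← hG, ← hG, h]
  rw [zeta, MonoidAlgebra.coeff_mapDomain, ← hG, Finsupp.mapDomain_apply hinj]

variable [Finite G]

/-- The class sum of `g`, as an element of the centre of the group algebra. -/
def centralClassSum (R : Type u) [CommRing R] {G : Type v} [Group G] [Finite G] (g : G) :
    Subalgebra.center R (MonoidAlgebra R G) :=
  ⟨classSum R g, Subalgebra.mem_center_iff.2 fun x => (classSum_central g x).symm⟩

theorem mapRingHom_classSum {S : Type w} [CommRing S] (f : R →+* S) (g : G) :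
    MonoidAlgebra.mapRingHom G f (classSum R g) = classSum S g := by
  rw [classSum, classSum, map_sum]
  simp

theorem zeta_classSum (hG : ∀ g : G, zetaElt p g = g ^ t) (hGt : ∀ g : G, (g ^ t) ^ r = g)
    (g : G) : zeta p (classSum R g) = classSum R (g ^ t) := by
  classical
  ext x
  have hx : x = (x ^ r) ^ t := by rw [← pow_mul, mul_comm, pow_mul, hGt]
  rw [hx, coeff_zeta hG hGt, coeff_classSum, coeff_classSum]
  refine if_congr ⟨fun h => h.pow t, fun h => ?_⟩ rfl rfl
  simpa only [hGt] using h.pow r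

variable {H : Type w} [Group H]

/-- The image `y` of a central element `x` under `σ⁻¹ ∘ ζ` is again central, and `T` sends it to
the image of `T x` under `σ⁻¹ ∘ ζ`. -/
theorem exists_zeta_eq (hG : ∀ g : G, zetaElt p g = g ^ t) (hGt : ∀ g : G, (g ^ t) ^ r = g)
    (hH : ∀ h : H, zetaElt p h = h ^ t) (hHt : ∀ h : H, (h ^ t) ^ r = h) (σ : R ≃+* R)
    (T : Subalgebra.center R (MonoidAlgebra R G) →ₗ[R] MonoidAlgebra R H)
    (hT : ∀ (g : G) (h : H), (T (centralClassSum R g)).coeff h =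
      σ ((T (centralClassSum R (g ^ t))).coeff (h ^ t)))
    (x : Subalgebra.center R (MonoidAlgebra R G)) :
    ∃ y : Subalgebra.center R (MonoidAlgebra R G),
      MonoidAlgebra.mapRingHom G (σ : R →+* R) y.1 = zeta p x.1 ∧
      MonoidAlgebra.mapRingHom H (σ : R →+* R) (T y) = zeta p (T x) := by
  obtain ⟨s, c, hsc⟩ := eq_sum_classSum (u := x.1) fun z => (Subalgebra.mem_center_iff.1 x.2 z).symm
  have hx : x = ∑ g ∈ s, c g • centralClassSum R g := by
    ext1
    rw [hsc, AddSubmonoidClass.coe_finsetSum]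
    rfl
  refine ⟨∑ g ∈ s, σ.symm (c g) • centralClassSum R (g ^ t), ?_, ?_⟩
  · rw [hsc, AddSubmonoidClass.coe_finsetSum, map_sum, zeta_sum]
    refine Finset.sum_congr rfl fun g _ => ?_
    change MonoidAlgebra.mapRingHom G (σ : R →+* R) (σ.symm (c g) • classSum R (g ^ t)) = _
    rw [MonoidAlgebra.mapRingHom_smul, zeta_smul, zeta_classSum hG hGt, mapRingHom_classSum]
    simp
  · rw [hx, map_sum, map_sum, map_sum, zeta_sum]
    refine Finset.sum_congr rfl fun g _ => ?_
    rw [T.map_smul, T.map_smul, MonoidAlgebra.mapRingHom_smul, zeta_smul]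
    ext x
    have hx : x = (x ^ r) ^ t := by rw [← pow_mul, mul_comm, pow_mul, hHt]
    rw [hx, MonoidAlgebra.coeff_smul_apply, MonoidAlgebra.coeff_smul_apply, coeff_zeta hH hHt, hT]
    simp

/-- A linear map between the centres of group algebras whose matrix coefficients with respect to
class sums are compatible with `σ` intertwines the semilinear maps `σ⁻¹ ∘ ζ` and their iterates. -/
theorem zeta_iterate_comm (hG : ∀ g : G, zetaElt p g = g ^ t) (hGt : ∀ g : G, (g ^ t) ^ r = g)
    (hH : ∀ h : H, zetaElt p h = h ^ t) (hHt : ∀ h : H, (h ^ t) ^ r = h) (σ : R ≃+* R)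
    (T : Subalgebra.center R (MonoidAlgebra R G) →ₗ[R] MonoidAlgebra R H)
    (hT : ∀ (g : G) (h : H), (T (centralClassSum R g)).coeff h =
      σ ((T (centralClassSum R (g ^ t))).coeff (h ^ t))) (n : ℕ)
    (x x' : Subalgebra.center R (MonoidAlgebra R G))
    (hxx' : MonoidAlgebra.mapRingHom G ((σ ^ n : R ≃+* R) : R →+* R) x'.1 = (zeta p)^[n] x.1) :
    MonoidAlgebra.mapRingHom H ((σ ^ n : R ≃+* R) : R →+* R) (T x') = (zeta p)^[n] (T x) := by
  induction n generalizing x with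
  | zero =>
    have h1 : x' = x := by
      ext g
      simpa using congrArg (fun z => z.coeff g) hxx'
    rw [h1]
    ext h
    simp
  | succ n ih =>
    obtain ⟨y, hy, hTy⟩ := exists_zeta_eq hG hGt hH hHt σ T hT x
    have hσ : ∀ (K : Type _) [Group K] (z : MonoidAlgebra R K),
        MonoidAlgebra.mapRingHom K ((σ ^ (n + 1) : R ≃+* R) : R →+* R) z =
          MonoidAlgebra.mapRingHom K (σ : R →+* R)
            (MonoidAlgebra.mapRingHom K ((σ ^ n : R ≃+* R) : R →+* R) z) := fun K _ z => by
      ext a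
      simp [pow_succ']
    rw [hσ, Function.iterate_succ_apply, ← hy, zeta_iterate_mapRingHom] at hxx'
    have h1 : MonoidAlgebra.mapRingHom G ((σ ^ n : R ≃+* R) : R →+* R) x'.1 =
        (zeta p)^[n] y.1 := by
      ext a
      exact σ.injective (by simpa using congrArg (fun z => z.coeff a) hxx')
    have h2 := congrArg (MonoidAlgebra.mapRingHom H (σ : R →+* R)) (ih y h1)
    rw [← zeta_iterate_mapRingHom, hTy, ← Function.iterate_succ_apply] at h2
    rw [← h2]
    ext a
    simp [pow_succ']

end ZetaMap

section ExtendScalars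

open TensorProduct

variable {O : Type u} [CommRing O] (F : Type w) [Field F] [Algebra O F]
variable {G : Type v} [Group G] {Z : Type u₁} [CommRing Z] [Algebra O Z]

/-- The extension of scalars of a homomorphism to a group algebra. -/
def extendScalars (ℓ : Z →ₙₐ[O] MonoidAlgebra O G) : F ⊗[O] Z →ₙₐ[F] MonoidAlgebra F G :=
  let L : F ⊗[O] Z →ₗ[F] MonoidAlgebra F G :=
    LinearMap.liftBaseChange F ((MonoidAlgebra.mapAlgHom G (Algebra.ofId O F)).toLinearMap.comp
      (ℓ : Z →ₗ[O] MonoidAlgebra O G))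
  { L with
    map_zero' := L.map_zero
    map_mul' := fun x y => by
      change L (x * y) = L x * L y
      induction x with
      | zero => simp
      | add x x' hx hx' => rw [add_mul, map_add, hx, hx', map_add, add_mul]
      | tmul a z =>
        induction y with
        | zero => simp
        | add y y' hy hy' => rw [mul_add, map_add, hy, hy', map_add, mul_add]
        | tmul b w =>
          simp only [L, Algebra.TensorProduct.tmul_mul_tmul, LinearMap.liftBaseChange_tmul,
            LinearMap.comp_apply, AlgHom.toLinearMap_apply]
          rw [smul_mul_smul_comm, ← map_mul]
          congr 2
          exact map_mul ℓ z w }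

theorem extendScalars_tmul (ℓ : Z →ₙₐ[O] MonoidAlgebra O G) (a : F) (z : Z) :
    extendScalars F ℓ (a ⊗ₜ z) = a • MonoidAlgebra.mapRingHom G (algebraMap O F) (ℓ z) :=
  LinearMap.liftBaseChange_tmul _ _ _ _

theorem extendScalars_injective [Module.Flat O F] {ℓ : Z →ₙₐ[O] MonoidAlgebra O G}
    (hℓ : Function.Injective ℓ) : Function.Injective (extendScalars F ℓ) := by
  classical
  -- on coefficients, the extension of scalars is the tensor product of `ℓ` with the flat module `F`
  let L : Z →ₗ[O] (G →₀ O) :=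
    (MonoidAlgebra.coeffLinearEquiv O).toLinearMap.comp (ℓ : Z →ₗ[O] MonoidAlgebra O G)
  have hL : Function.Injective L := (MonoidAlgebra.coeffLinearEquiv O).injective.comp hℓ
  have h1 := Module.Flat.lTensor_preserves_injective_linearMap (M := F) L hL
  have key : ∀ x, (extendScalars F ℓ x).coeff =
      TensorProduct.finsuppScalarRight O F F G (L.lTensor F x) := fun x => by
    induction x with
    | zero => simp
    | add x x' hx hx' => rw [map_add, map_add, map_add, ← hx, ← hx', MonoidAlgebra.coeff_add]
    | tmul a z =>
      ext g
      rw [extendScalars_tmul, LinearMap.lTensor_tmul,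
        TensorProduct.finsuppScalarRight_apply_tmul_apply, MonoidAlgebra.coeff_smul_apply,
        MonoidAlgebra.coeff_mapRingHom, smul_eq_mul, Algebra.smul_def, mul_comm]
      rfl
  intro x y hxy
  refine h1 ((TensorProduct.finsuppScalarRight O F F G).injective ?_)
  rw [← key, ← key, hxy]

theorem extendScalars_central {ℓ : Z →ₙₐ[O] MonoidAlgebra O G} (hℓ : ∀ z x, ℓ z * x = x * ℓ z)
    (a : F ⊗[O] Z) (x : MonoidAlgebra F G) : extendScalars F ℓ a * x = x * extendScalars F ℓ a := by
  induction a with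
  | zero => simp
  | add a b ha hb => rw [map_add, add_mul, ha, hb, mul_add]
  | tmul a z =>
    rw [extendScalars_tmul, smul_mul_assoc, mul_smul_comm]
    congr 1
    refine (MonoidAlgebra.central_iff _).2 (fun g y => ?_) x
    rw [MonoidAlgebra.coeff_mapRingHom, MonoidAlgebra.coeff_mapRingHom,
      (MonoidAlgebra.central_iff _).1 (hℓ z)]

end ExtendScalars

/-! ### Centres of block algebras and transport of twists -/

section CenterAlgebra

open CategoryTheory

variable {R : Type w} [CommRing R] {B : Type u₁} [Ring B] [Algebra R B] {C : Type u₂} [Ring C]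
  [Algebra R C]

/-- The identity between the centre as a subalgebra, which carries the linear structure, and
the centre as a subring, in which equivalences of module categories are expressed. -/
def toSubringCenter {A : Type u} [Ring A] [Algebra R A] :
    Subalgebra.center R A ≃+* Subring.center A :=
  RingEquiv.refl _

/-- An `R`-linear equivalence of module categories induces an isomorphism between the centres, as
`R`-algebras. -/
def centerAlgEquiv (E : ModuleCat.{max u₁ u₂} C ≌ ModuleCat.{max u₁ u₂} B)
    (hE : ∀ r : R, CenterRel E (toSubringCenter (algebraMap R (Subalgebra.center R C) r))
      (toSubringCenter (algebraMap R (Subalgebra.center R B) r))) :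
    Subalgebra.center R B ≃ₐ[R] Subalgebra.center R C :=
  (AlgEquiv.ofRingEquiv (f := (toSubringCenter.trans (centerEquiv E)).trans toSubringCenter.symm)
    fun r => by
      have := (hE r).eq_centerEquiv
      rw [RingEquiv.trans_apply, RingEquiv.trans_apply, this, RingEquiv.symm_apply_apply]).symm

theorem centerEquiv_centerAlgEquiv (E : ModuleCat.{max u₁ u₂} C ≌ ModuleCat.{max u₁ u₂} B)
    (hE : ∀ r : R, CenterRel E (toSubringCenter (algebraMap R (Subalgebra.center R C) r))
      (toSubringCenter (algebraMap R (Subalgebra.center R B) r))) (z : Subalgebra.center R B) :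
    centerEquiv E (toSubringCenter (centerAlgEquiv E hE z)) = toSubringCenter z := by
  have h := (centerAlgEquiv E hE).symm_apply_apply z
  have h' := congrArg toSubringCenter h
  rw [← h']
  rfl

theorem RingEquiv.map_mem_center {A : Type u} [Ring A] [Algebra R A] (α : A ≃+* A)
    {z : A} (hz : z ∈ Subalgebra.center R A) : α z ∈ Subalgebra.center R A :=
  Subalgebra.mem_center_iff.2 fun x => by
    rw [← α.apply_symm_apply x, ← map_mul, Subalgebra.mem_center_iff.1 hz, map_mul]

end CenterAlgebra

section Blocks

variable {R : Type u} [CommRing R] {G : Type v} [Group G] (B : CentralIdempotent R G)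

namespace CentralIdempotent

theorem mem_corner (x : MonoidAlgebra R G) : x ∈ Subsemigroup.corner B.e ↔ B.e * x = x := by
  rw [Subsemigroup.mem_corner_iff B.idem]
  exact ⟨fun h => h.1, fun h => ⟨h, by rw [← B.central, h]⟩⟩

theorem e_mul_coe (x : B.Alg) : B.e * x.1 = x.1 := (B.mem_corner _).1 x.2

/-- Multiplication by the identity of the block algebra. -/
def proj (x : MonoidAlgebra R G) : B.Alg :=
  ⟨B.e * x, (B.mem_corner _).2 (by rw [← mul_assoc, B.idem.eq])⟩

theorem coe_proj (x : MonoidAlgebra R G) : (B.proj x).1 = B.e * x := rfl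

theorem proj_coe (x : B.Alg) : B.proj x.1 = x := Subtype.ext (B.e_mul_coe x)

instance [Finite G] : Module.Finite R B.Alg :=
  have : Module.Finite R (MonoidAlgebra R G) :=
    Module.Finite.equiv (MonoidAlgebra.coeffLinearEquiv R (S := R) (M := G)).symm
  Module.Finite.of_surjective
    ({ toFun := B.proj
       map_add' := fun _ _ => Subtype.ext (mul_add _ _ _)
       map_smul' := fun c _ => Subtype.ext (mul_smul_comm c _ _) } : MonoidAlgebra R G →ₗ[R] B.Alg)
    fun x => ⟨x.1, B.proj_coe x⟩

theorem coe_mul_comm {z : B.Alg} (hz : z ∈ Subalgebra.center R B.Alg) (x : MonoidAlgebra R G) :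
    z.1 * x = x * z.1 := by
  have h := congrArg Subtype.val (Subalgebra.mem_center_iff.1 hz (B.proj x))
  rw [B.coe_mul, B.coe_mul, B.coe_proj, mul_assoc, ← mul_assoc z.1, ← B.central z.1,
    B.e_mul_coe] at h
  rw [← h, ← mul_assoc, B.central, mul_assoc, B.e_mul_coe]

/-- The inclusion of the centre of a block algebra into the group algebra. -/
def centerCoe : Subalgebra.center R B.Alg →ₙₐ[R] MonoidAlgebra R G where
  toFun z := z.1.1
  map_smul' _ _ := rfl
  map_zero' := rfl
  map_add' _ _ := rfl
  map_mul' _ _ := rfl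

theorem centerCoe_injective : Function.Injective B.centerCoe := fun _ _ h =>
  Subtype.ext (Subtype.ext h)

theorem centerCoe_mul_comm (z : Subalgebra.center R B.Alg) (x : MonoidAlgebra R G) :
    B.centerCoe z * x = x * B.centerCoe z := B.coe_mul_comm z.2 x

/-- Multiplication by the identity of the block algebra, on the centre of the group algebra. -/
def centerProj : Subalgebra.center R (MonoidAlgebra R G) →ₗ[R] Subalgebra.center R B.Alg where
  toFun x := ⟨B.proj x.1, Subalgebra.mem_center_iff.2 fun y => Subtype.ext (by
    rw [B.coe_mul, B.coe_mul, B.coe_proj, ← mul_assoc, ← B.central y.1, mul_assoc,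
      Subalgebra.mem_center_iff.1 x.2, mul_assoc])⟩
  map_add' x y := Subtype.ext (Subtype.ext (mul_add _ _ _))
  map_smul' c x := Subtype.ext (Subtype.ext (mul_smul_comm c _ _))

theorem coe_centerProj (x : Subalgebra.center R (MonoidAlgebra R G)) :
    (B.centerProj x).1.1 = B.e * x.1 := rfl

/-- A central element of the block algebra, as a central element of the group algebra. -/
def centerIncl (z : Subalgebra.center R B.Alg) : Subalgebra.center R (MonoidAlgebra R G) :=
  ⟨z.1.1, Subalgebra.mem_center_iff.2 fun x => (B.coe_mul_comm z.2 x).symm⟩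

theorem centerProj_centerIncl (z : Subalgebra.center R B.Alg) :
    B.centerProj (B.centerIncl z) = z := Subtype.ext (B.proj_coe z.1)

variable {B} {H : Type w} [Group H] {C : CentralIdempotent R H}

/-- The linear map between centres of group algebras induced by a homomorphism between the centres
of block algebras. -/
def centerMap (f : Subalgebra.center R B.Alg ≃ₐ[R] Subalgebra.center R C.Alg) :
    Subalgebra.center R (MonoidAlgebra R G) →ₗ[R] MonoidAlgebra R H :=
  ((C.centerCoe : Subalgebra.center R C.Alg →ₗ[R] MonoidAlgebra R H).comp
    f.toLinearMap).comp B.centerProj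

theorem centerMap_apply (f : Subalgebra.center R B.Alg ≃ₐ[R] Subalgebra.center R C.Alg)
    (x : Subalgebra.center R (MonoidAlgebra R G)) :
    centerMap f x = (f (B.centerProj x)).1.1 := rfl

open TensorProduct in
/-- The matrix coefficients of `centerMap f` with respect to class sums are conjugate
under cyclotomic automorphisms: after extension of scalars to an algebraically closed field this is
`coeff_classSum_mem_cycloPairs`. -/
theorem coeff_centerMap_mem_cycloPairs [IsNoetherianRing R] [Finite G] [Finite H] {F : Type u₁}
    [Field F] [IsAlgClosed F] [CharZero F] [Algebra R F] [Module.Flat R F]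
    (f : Subalgebra.center R B.Alg ≃ₐ[R] Subalgebra.center R C.Alg)
    {N : ℕ} (hN : N ≠ 0) {ζ : F} (hζ : IsPrimitiveRoot ζ N) {r t : ℕ}
    (hGN : ∀ g : G, g ^ N = 1) (hHN : ∀ h : H, h ^ N = 1)
    (hGt : ∀ g : G, (g ^ t) ^ r = g) (hHt : ∀ h : H, (h ^ t) ^ r = h) (g : G) (h : H) :
    ((algebraMap R F ((centerMap f (centralClassSum R (g ^ t))).coeff (h ^ t)),
      algebraMap R F ((centerMap f (centralClassSum R g)).coeff h)) : F × F) ∈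
      cycloPairs ζ r := by
  have : Module.Finite R (Subalgebra.center R B.Alg) :=
    Module.Finite.of_injective (Subalgebra.center R B.Alg).val.toLinearMap Subtype.val_injective
  let ℓ : Subalgebra.center R B.Alg →ₙₐ[R] MonoidAlgebra R H :=
    C.centerCoe.comp (f : Subalgebra.center R B.Alg →ₙₐ[R] Subalgebra.center R C.Alg)
  have hx : ∀ a : G, extendScalars F B.centerCoe (1 ⊗ₜ B.centerProj (centralClassSum R a)) =
      classSum F a * extendScalars F B.centerCoe 1 := fun a => by
    rw [Algebra.TensorProduct.one_def, extendScalars_tmul, extendScalars_tmul, one_smul, one_smul,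
      ← mapRingHom_classSum (algebraMap R F), ← map_mul]
    congr 1
    exact B.central _
  have hΦ : ∀ a : G, extendScalars F ℓ (1 ⊗ₜ B.centerProj (centralClassSum R a)) =
      MonoidAlgebra.mapRingHom H (algebraMap R F) (centerMap f (centralClassSum R a)) := fun a => by
    rw [extendScalars_tmul, one_smul]
    rfl
  have key := coeff_classSum_mem_cycloPairs (extendScalars F B.centerCoe)
    (extendScalars_injective F B.centerCoe_injective)
    (extendScalars_central F B.centerCoe_mul_comm) (extendScalars F ℓ)
    (extendScalars_central F fun z => C.centerCoe_mul_comm _) hN hζ hGN hHN hGt hHt g h (hx g)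
    (hx (g ^ t))
  rwa [hΦ, hΦ, MonoidAlgebra.coeff_mapRingHom, MonoidAlgebra.coeff_mapRingHom] at key

variable (B)

/-- There is a ring automorphism of the block algebra which preserves the isomorphism type
of every simple module and whose inverse agrees on the centre with `ζ ^ n`, up to the automorphism
`s` of the coefficients. -/
def HasTwist (p n : ℕ) (s : R ≃+* R) : Prop :=
  ∃ α : B.Alg ≃+* B.Alg, FixesSimples α ∧ ∀ z ∈ Subalgebra.center R B.Alg,
    MonoidAlgebra.mapRingHom G (s : R →+* R) (α.symm z).1 = (zeta p)^[n] z.1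

variable {B}

open CategoryTheory in
/-- Twists are transported along an equivalence of module categories if the induced isomorphism of
centres is compatible, on the coefficients with respect to class sums, with `σ` and `ζ`. -/
theorem HasTwist.transfer [IsLocalRing R] [IsNoetherianRing R] [Finite G]
    {p n : ℕ} {σ : R ≃+* R} (hB : B.HasTwist p n (σ ^ n))
    (E : ModuleCat.{max (max u w) (max u v)} C.Alg ≌ ModuleCat.{max (max u w) (max u v)} B.Alg)
    (f : Subalgebra.center R B.Alg ≃ₐ[R] Subalgebra.center R C.Alg)
    (hf : ∀ z, centerEquiv E (toSubringCenter (f z)) = toSubringCenter z)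
    {r t : ℕ} (hG : ∀ g : G, zetaElt p g = g ^ t) (hGt : ∀ g : G, (g ^ t) ^ r = g)
    (hH : ∀ h : H, zetaElt p h = h ^ t) (hHt : ∀ h : H, (h ^ t) ^ r = h)
    (hT : ∀ (g : G) (h : H), (centerMap f (centralClassSum R g)).coeff h =
      σ ((centerMap f (centralClassSum R (g ^ t))).coeff (h ^ t))) :
    C.HasTwist p n (σ ^ n) := by
  obtain ⟨α, hα, hαζ⟩ := hB
  obtain ⟨β, hβ, hβα⟩ := FixesSimples.exists_transfer E hα R
  refine ⟨β, hβ, fun c hc => ?_⟩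
  set b := f.symm ⟨c, hc⟩ with hb
  have hfb : f b = ⟨c, hc⟩ := f.apply_symm_apply _
  let b' : Subalgebra.center R B.Alg := ⟨α.symm b.1, α.symm.map_mem_center b.2⟩
  have h1 : β (f b').1 = (f b).1 := by
    refine hβα (toSubringCenter (f b')) (toSubringCenter (f b)) ?_
    rw [hf, hf]
    exact (α.apply_symm_apply b.1).symm
  have h2 : β.symm c = (f b').1 := by
    rw [RingEquiv.symm_apply_eq, h1, hfb]
  have h3 := zeta_iterate_comm hG hGt hH hHt σ (centerMap f) hT n (B.centerIncl b)
    (B.centerIncl b') (hαζ b.1 b.2)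
  rw [centerMap_apply, centerMap_apply, centerProj_centerIncl, centerProj_centerIncl, hfb] at h3
  rw [h2]
  exact h3

end CentralIdempotent

end Blocks

/-! ### Strong Frobenius isomorphisms as twisted automorphisms -/

section Exponents

variable (p : ℕ) [Fact p.Prime] (G : Type v) [Group G] [Finite G] (H : Type w) [Group H] [Finite H]

/-- Exponents `r` and `t`, inverse to each other modulo a common multiple `N` of the orders of
elements of two groups, such that `ζ` is the `t`-th power map. -/
theorem exists_zeta_exponents : ∃ N r t : ℕ, N ≠ 0 ∧ r ≡ 1 [MOD ordProj[p] N] ∧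
    r ≡ p [MOD ordCompl[p] N] ∧ r.Coprime N ∧ (∀ g : G, g ^ N = 1) ∧ (∀ h : H, h ^ N = 1) ∧
    (∀ g : G, zetaElt p g = g ^ t) ∧ (∀ g : G, (g ^ t) ^ r = g) ∧
    (∀ h : H, zetaElt p h = h ^ t) ∧ (∀ h : H, (h ^ t) ^ r = h) := by
  have hN : Nat.card G * Nat.card H ≠ 0 := mul_ne_zero Nat.card_pos.ne' Nat.card_pos.ne'
  obtain ⟨r, h1, h2, hr⟩ := exists_exponent p 1 hN
  rw [pow_one] at h2
  obtain ⟨t, ht⟩ := exists_inverse_exponent hN hr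
  have hG : ∀ g : G, g ^ (Nat.card G * Nat.card H) = 1 := fun g => by
    rw [pow_mul, pow_card_eq_one', one_pow]
  have hH : ∀ h : H, h ^ (Nat.card G * Nat.card H) = 1 := fun g => by
    rw [mul_comm, pow_mul, pow_card_eq_one', one_pow]
  refine ⟨_, r, t, hN, h1, h2, hr, hG, hH, fun g => zetaElt_eq_pow p hN h1 h2 ht (hG g),
    fun g => ?_, fun h => zetaElt_eq_pow p hN h1 h2 ht (hH h), fun h => ?_⟩
  · rw [← pow_mul, ht.pow_eq_pow (hG g), pow_one]
  · rw [← pow_mul, ht.pow_eq_pow (hH h), pow_one]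

end Exponents

namespace CentralIdempotent

section Twist

variable {R : Type u} [CommRing R] {G : Type v} [Group G] {B B' : CentralIdempotent R G}

/-- The ring isomorphism between a block algebra and its image under an automorphism of the
coefficients. -/
def mapAlg (s : R ≃+* R) (h : B'.e = MonoidAlgebra.mapRingHom G (s : R →+* R) B.e) :
    B.Alg ≃+* B'.Alg where
  toFun x := ⟨MonoidAlgebra.mapRingHom G (s : R →+* R) x.1, (B'.mem_corner _).2 (by
    rw [h, ← map_mul, B.e_mul_coe])⟩
  invFun y := ⟨MonoidAlgebra.mapRingHom G (s.symm : R →+* R) y.1, (B.mem_corner _).2 (by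
    have h1 : B.e = MonoidAlgebra.mapRingHom G (s.symm : R →+* R) B'.e := by
      rw [h]
      ext
      simp
    rw [h1, ← map_mul, B'.e_mul_coe])⟩
  left_inv x := Subtype.ext (by ext; simp)
  right_inv y := Subtype.ext (by ext; simp)
  map_mul' x y := Subtype.ext (map_mul _ x.1 y.1)
  map_add' x y := Subtype.ext (map_add _ x.1 y.1)

theorem coe_mapAlg (s : R ≃+* R) (h : B'.e = MonoidAlgebra.mapRingHom G (s : R →+* R) B.e)
    (x : B.Alg) : (mapAlg s h x).1 = MonoidAlgebra.mapRingHom G (s : R →+* R) x.1 := rfl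

/-- A strong Frobenius isomorphism `φ : B → B'` is the same thing as the ring automorphism
`φ⁻¹ ∘ s` of `B`. Here `Q y b` is the relation that the action of `y` on the module `S ^ (q)` is
given by the action of `b` on `S`. -/
theorem exists_algEquiv_iff_hasTwist (p n : ℕ) (s : R ≃+* R)
    (h : B'.e = MonoidAlgebra.mapRingHom G (s : R →+* R) B.e) (Q : B'.Alg → B.Alg → Prop)
    (hQ : ∀ b, Q (mapAlg s h b) b)
    (hQ' : ∀ (S : Type (max u v)) [AddCommGroup S] [Module B.Alg S] [IsSimpleModule B.Alg S]
      (y : B'.Alg) (b : B.Alg), Q y b → ∀ x : S, (mapAlg s h).symm y • x = b • x) :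
    (∃ φ : B.Alg ≃ₐ[R] B'.Alg, (∀ z ∈ Subalgebra.center R B.Alg, (φ z).1 = (zeta p)^[n] z.1) ∧
      ∀ (S : Type (max u v)) [AddCommGroup S] [Module B.Alg S] [IsSimpleModule B.Alg S],
        ∃ f : S ≃+ S, ∀ (y : B'.Alg) (b : B.Alg), Q y b → ∀ x : S, f (φ.symm y • x) = b • f x) ↔
    B.HasTwist p n s := by
  constructor
  · rintro ⟨φ, hφ, hS⟩
    refine ⟨(mapAlg s h).trans φ.symm.toRingEquiv, fun I hI => ?_, fun z hz => ?_⟩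
    · have : IsSimpleModule B.Alg (B.Alg ⧸ I) := isSimpleModule_iff_isCoatom.2 hI
      obtain ⟨f, hf⟩ := hS (B.Alg ⧸ I)
      refine ⟨f.symm, fun a x => f.injective ?_⟩
      refine (f.apply_symm_apply _).trans ?_
      refine Eq.trans ?_ (hf _ a (hQ a) (f.symm x)).symm
      rw [f.apply_symm_apply]
    · rw [← coe_mapAlg s h, ← hφ z hz]
      exact congrArg Subtype.val ((mapAlg s h).apply_symm_apply (φ z))
  · rintro ⟨α, hα, hζ⟩
    have h1 := hζ 1 (one_mem _)
    rw [map_one, B.coe_one] at h1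
    refine ⟨AlgEquiv.ofRingEquiv (f := α.symm.trans (mapAlg s h)) fun r => Subtype.ext ?_,
      fun z hz => hζ z hz, fun S _ _ _ => ?_⟩
    · refine (hζ _ (Subalgebra.algebraMap_mem _ r)).trans ?_
      change (zeta p)^[n] (r • B.e) = r • B'.e
      rw [zeta_iterate_smul, h, h1]
    · obtain ⟨f, hf⟩ := hα.exists_addEquiv S
      refine ⟨f.symm, fun y b hyb x => f.injective ?_⟩
      rw [← hQ' S y b hyb, f.apply_symm_apply, hf, f.apply_symm_apply]
      rfl

end Twist

section Residue

variable {O : Type u} [CommRing O] [IsLocalRing O] {G : Type v} [Group G]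
  {H : Type w} [Group H] (B : CentralIdempotent O G) {C : CentralIdempotent O H}

/-- The reduction of a block algebra to the residue field. -/
def red : B.Alg →+* B.kRed.Alg where
  toFun x := ⟨MonoidAlgebra.mapRingHom G (residue O) x.1, (B.kRed.mem_corner _).2 (by
    change MonoidAlgebra.mapRingHom G (residue O) B.e * _ = _
    rw [← map_mul, B.e_mul_coe])⟩
  map_one' := rfl
  map_zero' := Subtype.ext (map_zero _)
  map_add' x y := Subtype.ext (map_add _ x.1 y.1)
  map_mul' x y := Subtype.ext (map_mul _ x.1 y.1)

theorem coe_red (x : B.Alg) : (B.red x).1 = MonoidAlgebra.mapRingHom G (residue O) x.1 := rfl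

theorem red_smul (r : O) (x : B.Alg) : B.red (r • x) = residue O r • B.red x :=
  Subtype.ext (MonoidAlgebra.mapRingHom_smul _ _ _)

theorem red_surjective : Function.Surjective B.red := fun y => by
  have h : ∀ x : MonoidAlgebra (ResidueField O) G,
      ∃ x', MonoidAlgebra.mapRingHom G (residue O) x' = x := fun x => by
    induction x using MonoidAlgebra.induction_on with
    | of g => exact ⟨MonoidAlgebra.single g 1, by simp⟩
    | add a b ha hb =>
      obtain ⟨a, rfl⟩ := ha
      obtain ⟨b, rfl⟩ := hb
      exact ⟨a + b, map_add _ _ _⟩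
    | smul r a ha =>
      obtain ⟨a, rfl⟩ := ha
      obtain ⟨r, rfl⟩ := residue_surjective r
      exact ⟨r • a, MonoidAlgebra.mapRingHom_smul _ _ _⟩
  obtain ⟨x, hx⟩ := h y.1
  refine ⟨B.proj x, Subtype.ext ?_⟩
  rw [coe_red, coe_proj, map_mul, hx]
  exact B.kRed.e_mul_coe y

/-- The kernel of the reduction is generated by a uniformizer. -/
theorem exists_smul_eq_of_mapRingHom_residue_eq_zero [Finite G] {ϖ : O}
    (hϖ : maximalIdeal O = Ideal.span {ϖ}) {x : B.Alg}
    (hx : MonoidAlgebra.mapRingHom G (residue O) x.1 = 0) : ∃ y : B.Alg, x = ϖ • y := by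
  have h : ∀ g, ∃ c, x.1.coeff g = ϖ * c := fun g => by
    have h1 : residue O (x.1.coeff g) = 0 := by
      simpa using congrArg (fun z => z.coeff g) hx
    rw [residue_eq_zero_iff, hϖ, Ideal.mem_span_singleton] at h1
    exact h1
  choose c hc using h
  let y : MonoidAlgebra O G := .ofCoeff (Finsupp.equivFunOnFinite.symm c)
  have hy : x.1 = ϖ • y := by
    ext g
    rw [hc, MonoidAlgebra.coeff_smul_apply]
    rfl
  refine ⟨B.proj y, ?_⟩
  rw [← B.proj_coe x]
  refine Subtype.ext ?_
  rw [coe_smul, coe_proj, coe_proj, hy, mul_smul_comm]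

theorem isKilledByKer_red_iff [Finite G] {ϖ : O} (hϖ : maximalIdeal O = Ideal.span {ϖ})
    (X : ModuleCat.{u₁} B.Alg) : IsKilledByKer B.red X ↔
      centerSMul (toSubringCenter (algebraMap O (Subalgebra.center O B.Alg) ϖ)) X = 0 := by
  constructor
  · intro h
    ext x
    refine h (algebraMap O B.Alg ϖ) ?_ x
    rw [Algebra.algebraMap_eq_smul_one, red_smul]
    have : residue O ϖ = 0 := by
      rw [residue_eq_zero_iff, hϖ]
      exact Ideal.mem_span_singleton_self ϖ
    rw [this]
    exact zero_smul (ResidueField O) (B.red 1)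
  · intro h a ha x
    obtain ⟨b, rfl⟩ := B.exists_smul_eq_of_mapRingHom_residue_eq_zero hϖ
      (congrArg Subtype.val ha)
    rw [Algebra.smul_def, mul_smul]
    exact congrArg (fun f => f.hom (b • x)) h

theorem red_mem_center {z : B.Alg} (hz : z ∈ Subalgebra.center O B.Alg) :
    B.red z ∈ Subalgebra.center (ResidueField O) B.kRed.Alg :=
  Subalgebra.mem_center_iff.2 fun y => by
    obtain ⟨y, rfl⟩ := B.red_surjective y
    rw [← map_mul, Subalgebra.mem_center_iff.1 hz, map_mul]

end Residue

end CentralIdempotent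

/-! ### Twists and Morita equivalence -/

namespace CentralIdempotent

open CategoryTheory

section Transfer

variable {p : ℕ} [Fact p.Prime] {O : Type u} [CommRing O] [IsDomain O] [IsDiscreteValuationRing O]
  [CharZero O] {G : Type v} [Group G] [Finite G] {H : Type w} [Group H] [Finite H]
  {B : CentralIdempotent O G} {C : CentralIdempotent O H}

instance : FaithfulSMul O (KBar O) := FaithfulSMul.trans O (FractionRing O) (KBar O)

open scoped ModuleCat.Algebra in
theorem centerRel_algebraMap {R : Type w} [CommRing R] {B : Type u₁} [Ring B] [Algebra R B]
    {C : Type u₂} [Ring C] [Algebra R C] (e : MoritaEquivalence R C B) (r : R) :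
    CenterRel e.eqv (toSubringCenter (algebraMap R (Subalgebra.center R C) r))
      (toSubringCenter (algebraMap R (Subalgebra.center R B) r)) := by
  intro M
  have h1 : centerSMul (toSubringCenter (algebraMap R (Subalgebra.center R C) r)) M = r • 𝟙 M := by
    ext x
    rfl
  rw [h1, e.eqv.functor.map_smul, e.eqv.functor.map_id]
  ext x
  rfl

/-- The twisted automorphisms over `O` are transported by Morita equivalences. -/
theorem HasTwist.of_moritaEquivalence
    (e : MoritaEquivalence O C.Alg B.Alg) {σ : O ≃+* O} {τ : KBar O ≃+* KBar O}
    (hτσ : ∀ a : O, τ (algebraMap O (KBar O) a) = algebraMap O (KBar O) (σ a))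
    (hτ : IsCyclotomicFrobenius p 1 τ) {n : ℕ} (h : B.HasTwist p n (σ ^ n)) :
    C.HasTwist p n (σ ^ n) := by
  obtain ⟨N, r, t, hN, h1, h2, hr, hGN, hHN, hG, hGt, hH, hHt⟩ := exists_zeta_exponents p G H
  have : NeZero N := ⟨hN⟩
  obtain ⟨ζ, hζ⟩ := HasEnoughRootsOfUnity.exists_primitiveRoot (KBar O) N
  have hE := centerRel_algebraMap e
  let f := centerAlgEquiv e.eqv hE
  refine h.transfer e.eqv f (centerEquiv_centerAlgEquiv e.eqv hE) hG hGt hH hHt fun g h => ?_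
  have h3 := coeff_centerMap_mem_cycloPairs (F := KBar O) f hN hζ hGN hHN hGt hHt g h
  have h4 := hτ.apply_eq_of_mem_cycloPairs hN h1 h2 hζ.pow_eq_one h3
  rw [hτσ] at h4
  exact (FaithfulSMul.algebraMap_injective O (KBar O) h4).symm

/-- The twisted automorphisms over the residue field are transported by Morita equivalences
over `O`. -/
theorem HasTwist.kRed_of_moritaEquivalence [CharP (ResidueField O) p]
    [PerfectRing (ResidueField O) p]
    (e : MoritaEquivalence O C.Alg B.Alg) {n : ℕ}
    (h : B.kRed.HasTwist p n (frobeniusEquiv (ResidueField O) p ^ n)) :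
    C.kRed.HasTwist p n (frobeniusEquiv (ResidueField O) p ^ n) := by
  obtain ⟨N, r, t, hN, h1, h2, hr, hGN, hHN, hG, hGt, hH, hHt⟩ := exists_zeta_exponents p G H
  have : NeZero N := ⟨hN⟩
  obtain ⟨ζ, hζ⟩ := HasEnoughRootsOfUnity.exists_primitiveRoot (KBar O) N
  have hE := centerRel_algebraMap e
  obtain ⟨ϖ, hϖ⟩ := IsDiscreteValuationRing.exists_irreducible O
  -- the modules over the residue field are those on which the uniformizer acts as zero
  have hkill : ∀ X, IsKilledByKer C.red X ↔ IsKilledByKer B.red (e.eqv.functor.obj X) := fun X => by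
    rw [isKilledByKer_red_iff _ hϖ.maximalIdeal_eq, isKilledByKer_red_iff _ hϖ.maximalIdeal_eq,
      ← hE ϖ X]
    exact (e.eqv.functor.map_eq_zero_iff).symm
  let E := descentEquivalence e.eqv B.red_surjective hkill C.red_surjective
  have hEE : ∀ (z : Subalgebra.center O C.Alg) (b : Subalgebra.center O B.Alg),
      CenterRel e.eqv (toSubringCenter z) (toSubringCenter b) →
      CenterRel E (toSubringCenter ⟨_, C.red_mem_center z.2⟩)
        (toSubringCenter ⟨_, B.red_mem_center b.2⟩) := fun z b hzb =>
    hzb.descentEquivalence e.eqv B.red_surjective hkill C.red_surjective rfl rfl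
  have hEk : ∀ a : ResidueField O, CenterRel E
      (toSubringCenter (algebraMap _ (Subalgebra.center (ResidueField O) C.kRed.Alg) a))
      (toSubringCenter (algebraMap _ (Subalgebra.center (ResidueField O) B.kRed.Alg) a)) := by
    intro a
    obtain ⟨a, rfl⟩ := residue_surjective a
    have h5 := hEE _ _ (hE a)
    convert h5 using 2
    · refine Subtype.ext ?_
      change residue O a • (1 : C.kRed.Alg) = C.red (a • 1)
      rw [C.red_smul, map_one]
    · refine Subtype.ext ?_
      change residue O a • (1 : B.kRed.Alg) = B.red (a • 1)
      rw [B.red_smul, map_one]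
  let f := centerAlgEquiv e.eqv hE
  let fk := centerAlgEquiv E hEk
  -- the isomorphism of the centres over the residue field is the reduction of the one over `O`
  have hfk : ∀ z, (fk ⟨_, B.red_mem_center z.2⟩).1 = C.red (f z).1 := fun z => by
    have h5 := (hEE (f z) z (by
      rw [← centerEquiv_centerAlgEquiv e.eqv hE z]
      exact centerRel_centerEquiv _ _)).eq_centerEquiv
    have h6 := centerEquiv_centerAlgEquiv E hEk ⟨_, B.red_mem_center z.2⟩
    exact congrArg Subtype.val ((centerEquiv E).injective (h6.trans h5.symm))
  have hmap : ∀ g, centerMap fk (centralClassSum (ResidueField O) g) =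
      MonoidAlgebra.mapRingHom H (residue O) (centerMap f (centralClassSum O g)) := fun g => by
    rw [centerMap_apply, centerMap_apply, ← coe_red, ← hfk]
    congr 3
    refine Subtype.ext (Subtype.ext ?_)
    rw [coe_centerProj, coe_red, coe_centerProj, map_mul]
    change _ * classSum _ g = _ * MonoidAlgebra.mapRingHom G (residue O) (classSum O g)
    rw [mapRingHom_classSum]
    rfl
  refine h.transfer E fk (centerEquiv_centerAlgEquiv E hEk) hG hGt hH hHt fun g h => ?_
  have h3 := coeff_centerMap_mem_cycloPairs (F := KBar O) f hN hζ hGN hHN hGt hHt g h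
  rw [hmap, hmap, MonoidAlgebra.coeff_mapRingHom, MonoidAlgebra.coeff_mapRingHom,
    residue_eq_pow_of_mem_cycloPairs p hζ hr h2 h3]
  rfl

end Transfer

end CentralIdempotent

/-! ### Strong Frobenius isomorphisms over the residue field and over `O` -/

namespace CentralIdempotent

section Field

variable (p : ℕ) [Fact p.Prime] {k : Type u} [Field k] [CharP k p] [PerfectRing k p]
  {G : Type v} [Group G] (B : CentralIdempotent k G)

theorem frobeniusEquiv_pow_apply (n : ℕ) (a : k) : (frobeniusEquiv k p ^ n) a = a ^ p ^ n := by
  induction n with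
  | zero => simp
  | succ n ih =>
    rw [pow_succ', RingAut.mul_apply, ih, frobeniusEquiv_apply, frobenius_def, ← pow_mul,
      ← pow_succ]

theorem coe_frobeniusEquiv_pow (n : ℕ) :
    ((frobeniusEquiv k p ^ n : k ≃+* k) : k →+* k) = iterateFrobenius k p n :=
  RingHom.ext fun a => frobeniusEquiv_pow_apply p n a

theorem exists_isStrongFrobeniusIso_iff (n : ℕ) :
    (∃ φ : B.Alg ≃ₐ[k] (B.frobTwist p n).Alg, IsStrongFrobeniusIso p n B φ) ↔
      B.HasTwist p n (frobeniusEquiv k p ^ n) := by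
  have h : (B.frobTwist p n).e =
      MonoidAlgebra.mapRingHom G ((frobeniusEquiv k p ^ n : k ≃+* k) : k →+* k) B.e := by
    rw [coe_frobeniusEquiv_pow]
    rfl
  rw [← exists_algEquiv_iff_hasTwist p n _ h fun y b => y.1 = frobMap p n b.1]
  · exact ⟨fun ⟨φ, h1, h2⟩ => ⟨φ, h1, h2⟩, fun ⟨φ, h1, h2⟩ => ⟨φ, h1, h2⟩⟩
  · intro b
    rw [coe_mapAlg, coe_frobeniusEquiv_pow]
    rfl
  · intro S _ _ _ y b hyb x
    congr 1
    rw [RingEquiv.symm_apply_eq]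
    refine Subtype.ext ?_
    rw [hyb, coe_mapAlg, coe_frobeniusEquiv_pow]
    rfl

end Field

section Local

variable (p : ℕ) [Fact p.Prime] {O : Type u} [CommRing O] [IsDomain O] [IsDiscreteValuationRing O]
  [CharP (ResidueField O) p] {G : Type v} [Group G] [Finite G] {B B' : CentralIdempotent O G}

theorem exists_isStrongOFrobeniusIso_iff {n : ℕ} {s : O ≃+* O}
    (hs : ∀ a, residue O (s a) = residue O a ^ p ^ n)
    (h : B'.e = MonoidAlgebra.mapRingHom G (s : O →+* O) B.e) :
    (∃ φ : B.Alg ≃ₐ[O] B'.Alg, IsStrongOFrobeniusIso p n B B' φ) ↔ B.HasTwist p n s := by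
  have hred : ∀ x : MonoidAlgebra O G,
      MonoidAlgebra.mapRingHom G (residue O) (MonoidAlgebra.mapRingHom G (s : O →+* O) x) =
        frobMap p n (MonoidAlgebra.mapRingHom G (residue O) x) := fun x => by
    ext g
    rw [frobMap, MonoidAlgebra.coeff_mapRingHom, MonoidAlgebra.coeff_mapRingHom,
      MonoidAlgebra.coeff_mapRingHom, MonoidAlgebra.coeff_mapRingHom, iterateFrobenius_def]
    exact hs _
  rw [← exists_algEquiv_iff_hasTwist p n _ h fun y b => MonoidAlgebra.mapRingHom G (residue O) y.1 =
        frobMap p n (MonoidAlgebra.mapRingHom G (residue O) b.1)]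
  · exact ⟨fun ⟨φ, h1, h2⟩ => ⟨φ, h1, h2⟩, fun ⟨φ, h1, h2⟩ => ⟨φ, h1, h2⟩⟩
  · exact fun b => hred b.1
  · intro S _ _ _ y b hyb x
    -- `b' - b` reduces to zero, hence is a multiple of the uniformizer, which kills `S`
    obtain ⟨b', rfl⟩ := (mapAlg s h).surjective y
    rw [RingEquiv.symm_apply_apply, ← sub_eq_zero, ← sub_smul]
    rw [coe_mapAlg, hred] at hyb
    have h1 : MonoidAlgebra.mapRingHom G (residue O) (b' - b).1 = 0 := by
      refine (map_sub _ b'.1 b.1).trans (sub_eq_zero.2 ?_)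
      ext g
      have h2 := congrArg (fun z => z.coeff g) hyb
      rw [frobMap] at h2
      simp only [MonoidAlgebra.coeff_mapRingHom] at h2 ⊢
      exact (iterateFrobenius (ResidueField O) p n).injective h2
    obtain ⟨ϖ, hϖ⟩ := IsDiscreteValuationRing.exists_irreducible O
    obtain ⟨c, hc⟩ := B.exists_smul_eq_of_mapRingHom_residue_eq_zero hϖ.maximalIdeal_eq h1
    let : Module O S := Module.compHom S (algebraMap O B.Alg)
    have : IsScalarTower O B.Alg S := ⟨fun r a x => by
      rw [Algebra.smul_def, mul_smul]
      rfl⟩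
    rw [hc, smul_assoc]
    refine smul_eq_zero_of_isSimpleModule (A := B.Alg) O ?_ _
    rw [hϖ.maximalIdeal_eq]
    exact Ideal.mem_span_singleton_self ϖ

theorem strongFrobeniusNumber_kRed_eq [CharZero O] [PerfectRing (ResidueField O) p]
    {H : Type w} [Group H] [Finite H] {C : CentralIdempotent O H}
    (h : IsMoritaEquivalent O B.Alg C.Alg) :
    strongFrobeniusNumber p B.kRed = strongFrobeniusNumber p C.kRed := by
  rw [strongFrobeniusNumber, strongFrobeniusNumber]
  congr 1
  ext n
  refine and_congr_right fun _ => ?_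
  rw [exists_isStrongFrobeniusIso_iff, exists_isStrongFrobeniusIso_iff]
  obtain ⟨e⟩ := h.cond
  exact ⟨HasTwist.kRed_of_moritaEquivalence e.symm, HasTwist.kRed_of_moritaEquivalence e⟩

end Local

end CentralIdempotent

/-! ### Irreducible representations in characteristic zero -/

section Representations

variable {F : Type u} [Field F] {G : Type v} [Group G] {V : Type w} [AddCommGroup V] [Module F V]

theorem Representation.isIrreducible_iff (ρ : Representation F G V) :
    ρ.IsIrreducible ↔ Nontrivial V ∧
      ∀ W : Submodule F V, (∀ g, ∀ v ∈ W, ρ g v ∈ W) → W = ⊥ ∨ W = ⊤ := by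
  constructor
  · intro h
    refine ⟨?_, fun W hW => ?_⟩
    · by_contra hV
      rw [not_nontrivial_iff_subsingleton] at hV
      exact bot_ne_top (α := Subrepresentation ρ)
        (Subrepresentation.toSubmodule_injective (Subsingleton.elim _ _))
    · exact (h.eq_bot_or_eq_top ⟨W, hW⟩).imp (congrArg Subrepresentation.toSubmodule)
        (congrArg Subrepresentation.toSubmodule)
  · rintro ⟨hV, h⟩
    exact
      { exists_pair_ne := ⟨⊥, ⊤, fun h' => bot_ne_top (α := Submodule F V)
          (congrArg Subrepresentation.toSubmodule h')⟩
        eq_bot_or_eq_top := fun W => (h W.toSubmodule fun g v hv =>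
          W.apply_mem_toSubmodule g hv).imp (fun h' => Subrepresentation.toSubmodule_injective h')
            (fun h' => Subrepresentation.toSubmodule_injective h') }

/-- A central idempotent acts on an irreducible representation as zero or as the identity, since
its image is a subrepresentation. -/
theorem Representation.IsIrreducible.asAlgebraHom_eq_zero_or_one {ρ : Representation F G V}
    (hρ : ρ.IsIrreducible) {e : MonoidAlgebra F G} (he : IsIdempotentElem e)
    (hc : ∀ x, e * x = x * e) : ρ.asAlgebraHom e = 0 ∨ ρ.asAlgebraHom e = 1 := by
  have hidem : ∀ v, ρ.asAlgebraHom e (ρ.asAlgebraHom e v) = ρ.asAlgebraHom e v := fun v => by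
    rw [← Module.End.mul_apply, ← map_mul, he.eq]
  refine (((ρ.isIrreducible_iff).1 hρ).2 (LinearMap.range (ρ.asAlgebraHom e)) ?_).imp ?_ ?_
  · rintro g _ ⟨v, rfl⟩
    refine ⟨ρ g v, ?_⟩
    rw [← ρ.asAlgebraHom_single_one, ← Module.End.mul_apply, ← Module.End.mul_apply, ← map_mul,
      ← map_mul, hc]
  · exact LinearMap.range_eq_bot.1
  · intro h
    ext v
    obtain ⟨w, rfl⟩ := LinearMap.range_eq_top.1 h v
    exact hidem w

/-- The values of characters are sums of roots of unity. -/
theorem Representation.exists_character_eq_sum [IsAlgClosed F] [FiniteDimensional F V] [Finite G]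
    (ρ : Representation F G V) (g : G) :
    ∃ s : Multiset F, ρ.character g = s.sum ∧ ∀ ω ∈ s, ω ^ Nat.card G = 1 := by
  refine ⟨(ρ g).charpoly.roots, Module.End.trace_eq_sum_roots_charpoly_of_splits
    (IsAlgClosed.splits _), fun ω hω => ?_⟩
  have h1 := (Module.End.hasEigenvalue_iff_isRoot_charpoly (ρ g) ω).2
    (Polynomial.isRoot_of_mem_roots hω)
  obtain ⟨v, hv⟩ := h1.exists_hasEigenvector
  have h2 := hv.pow_apply (Nat.card G)
  rw [← map_pow, pow_card_eq_one', map_one, Module.End.one_apply] at h2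
  by_contra h3
  refine (smul_ne_zero (sub_ne_zero.2 h3) hv.2) ?_
  rw [sub_smul, ← h2, one_smul, sub_self]

/-- The twist of a matrix representation by an automorphism of the field. -/
def Representation.twist {d : ℕ} (τ : F ≃+* F) (ρ : Representation F G (Fin d → F)) :
    Representation F G (Fin d → F) where
  toFun g :=
    { toFun := fun v => τ ∘ ρ g (τ.symm ∘ v)
      map_add' := fun v w => by
        have h : ∀ v w : Fin d → F, τ.symm ∘ (v + w) = τ.symm ∘ v + τ.symm ∘ w := fun v w => by
          ext; simp
        rw [h, map_add]
        ext; simp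
      map_smul' := fun c v => by
        have h : τ.symm ∘ (c • v) = τ.symm c • (τ.symm ∘ v) := by ext; simp
        rw [h, map_smul]
        ext; simp }
  map_one' := by
    ext
    simp
  map_mul' g h := by
    refine LinearMap.ext fun v => ?_
    change τ ∘ ρ (g * h) (τ.symm ∘ v) = τ ∘ ρ g (τ.symm ∘ τ ∘ ρ h (τ.symm ∘ v))
    have h1 : τ.symm ∘ τ ∘ ρ h (τ.symm ∘ v) = ρ h (τ.symm ∘ v) := by ext; simp
    rw [map_mul, h1]
    rfl

theorem Representation.twist_apply {d : ℕ} (τ : F ≃+* F) (ρ : Representation F G (Fin d → F))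
    (g : G) (v : Fin d → F) : ρ.twist τ g v = τ ∘ ρ g (τ.symm ∘ v) := rfl

theorem LinearMap.trace_pi {d : ℕ} (f : (Fin d → F) →ₗ[F] (Fin d → F)) :
    LinearMap.trace F _ f = ∑ i, f (Pi.single i 1) i := by
  rw [LinearMap.trace_eq_matrix_trace F (Pi.basisFun F (Fin d)), Matrix.trace]
  simp

theorem Representation.character_twist {d : ℕ} (τ : F ≃+* F)
    (ρ : Representation F G (Fin d → F)) (g : G) :
    (ρ.twist τ).character g = τ (ρ.character g) := by
  rw [Representation.character, Representation.character, LinearMap.trace_pi, LinearMap.trace_pi,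
    map_sum]
  refine Finset.sum_congr rfl fun i _ => ?_
  have h : τ.symm ∘ (Pi.single i 1 : Fin d → F) = Pi.single i 1 := by
    ext j
    by_cases hj : j = i
    · subst hj; simp
    · simp [hj]
  rw [Representation.twist_apply, h]
  rfl

theorem Representation.IsIrreducible.twist {d : ℕ} (τ : F ≃+* F)
    {ρ : Representation F G (Fin d → F)} (hρ : ρ.IsIrreducible) :
    (ρ.twist τ).IsIrreducible := by
  rw [Representation.isIrreducible_iff] at hρ ⊢
  refine ⟨hρ.1, fun W hW => ?_⟩
  have hinv : ∀ v : Fin d → F, τ.symm ∘ τ ∘ v = v := fun v => by ext; simp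
  have hinv' : ∀ v : Fin d → F, τ ∘ τ.symm ∘ v = v := fun v => by ext; simp
  let U : Submodule F (Fin d → F) :=
    { carrier := {v | τ ∘ v ∈ W}
      add_mem' := fun {v w} hv hw => by
        have h : τ ∘ (v + w) = τ ∘ v + τ ∘ w := by ext; simp
        change τ ∘ (v + w) ∈ W
        rw [h]
        exact W.add_mem hv hw
      zero_mem' := by
        have h : τ ∘ (0 : Fin d → F) = 0 := by ext; simp
        change τ ∘ (0 : Fin d → F) ∈ W
        rw [h]
        exact W.zero_mem
      smul_mem' := fun c v hv => by
        have h : τ ∘ (c • v) = τ c • (τ ∘ v) := by ext; simp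
        change τ ∘ (c • v) ∈ W
        rw [h]
        exact W.smul_mem _ hv }
  have hU : ∀ v, v ∈ U ↔ τ ∘ v ∈ W := fun v => Iff.rfl
  refine (hρ.2 U fun g v hv => ?_).imp (fun h => ?_) fun h => ?_
  · have h1 := hW g _ hv
    rwa [Representation.twist_apply, hinv] at h1
  · refine (Submodule.eq_bot_iff _).2 fun w hw => ?_
    have h1 : τ.symm ∘ w ∈ U := by rwa [hU, hinv']
    rw [h, Submodule.mem_bot] at h1
    rw [← hinv' w, h1]
    ext
    simp
  · refine Submodule.eq_top_iff'.2 fun w => ?_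
    have h1 : τ.symm ∘ w ∈ U := h ▸ Submodule.mem_top
    rwa [hU, hinv'] at h1

/-- A simple module over the group algebra, as a matrix representation. -/
theorem exists_isIrreducible_of_isSimpleModule {M : Type w} [AddCommGroup M] [Module F M]
    [Module (MonoidAlgebra F G) M] [IsScalarTower F (MonoidAlgebra F G) M] [FiniteDimensional F M]
    [IsSimpleModule (MonoidAlgebra F G) M] :
    ∃ (d : ℕ) (ρ : Representation F G (Fin d → F)) (b : M ≃ₗ[F] (Fin d → F)), ρ.IsIrreducible ∧
      ∀ x m, ρ.asAlgebraHom x (b m) = b (x • m) := by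
  let b := (Module.finBasis F M).equivFun
  let φ : MonoidAlgebra F G →ₐ[F] Module.End F (Fin (Module.finrank F M) → F) :=
    (b.conjAlgEquiv F).toAlgHom.comp (Algebra.lsmul F F M)
  let ρ := (MonoidAlgebra.lift F _ G).symm φ
  have hρ : Representation.asAlgebraHom ρ = φ := (MonoidAlgebra.lift F _ G).apply_symm_apply φ
  have key : ∀ x m, Representation.asAlgebraHom ρ x (b m) = b (x • m) := fun x m => by
    rw [hρ]
    change b (x • b.symm (b m)) = _
    rw [b.symm_apply_apply]
  refine ⟨_, ρ, b, (Representation.isIrreducible_iff ρ).2 ⟨?_, fun W hW => ?_⟩, key⟩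
  · have := IsSimpleModule.nontrivial (MonoidAlgebra F G) M
    exact b.symm.toEquiv.nontrivial
  · let U : Submodule (MonoidAlgebra F G) M :=
      { W.comap b.toLinearMap with
        smul_mem' := fun x m hm => by
          change b m ∈ W at hm
          change b (x • m) ∈ W
          rw [← key]
          induction x using MonoidAlgebra.induction_on with
          | of g =>
            rw [Representation.asAlgebraHom_of]
            exact hW g _ hm
          | add x y hx hy =>
            rw [map_add]
            exact W.add_mem hx hy
          | smul c x hx =>
            rw [map_smul]
            exact W.smul_mem c hx }
    have hU : ∀ v, b.symm v ∈ U ↔ v ∈ W := fun v => by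
      change b (b.symm v) ∈ W ↔ _
      rw [b.apply_symm_apply]
    refine (eq_bot_or_eq_top U).imp (fun h => ?_) fun h => ?_
    · refine (Submodule.eq_bot_iff _).2 fun v hv => ?_
      rwa [← hU, h, Submodule.mem_bot, LinearEquiv.map_eq_zero_iff] at hv
    · refine Submodule.eq_top_iff'.2 fun v => ?_
      rw [← hU, h]
      exact Submodule.mem_top

/-- Every nonzero central idempotent of the group algebra acts as a nonzero operator on some
irreducible representation, afforded by a simple submodule of the ideal which it generates. -/
theorem exists_isIrreducible_asAlgebraHom_ne_zero [CharZero F] [Finite G] {e : MonoidAlgebra F G}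
    (he : IsIdempotentElem e) (hc : ∀ x, e * x = x * e) (he0 : e ≠ 0) :
    ∃ (d : ℕ) (ρ : Representation F G (Fin d → F)), ρ.IsIrreducible ∧ ρ.asAlgebraHom e ≠ 0 := by
  let L : Submodule (MonoidAlgebra F G) (MonoidAlgebra F G) := Submodule.span _ {e}
  have hL : ∀ x : L, e • x = x := fun x => by
    obtain ⟨a, ha⟩ := Submodule.mem_span_singleton.1 x.2
    refine Subtype.ext ?_
    change e * x.1 = x.1
    rw [hc, ← ha, smul_eq_mul, mul_assoc, he.eq]
  have : NeZero (Nat.card G : F) := ⟨Nat.cast_ne_zero.2 Nat.card_pos.ne'⟩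
  have : Nontrivial L :=
    ⟨⟨⟨e, Submodule.mem_span_singleton_self e⟩, 0, fun h => he0 (congrArg Subtype.val h)⟩⟩
  obtain ⟨S, hS⟩ := IsSemisimpleModule.exists_simple_submodule (MonoidAlgebra F G) L
  have : FiniteDimensional F S := Module.Finite.trans (MonoidAlgebra F G) S
  obtain ⟨d, ρ, b, hρ, hb⟩ := exists_isIrreducible_of_isSimpleModule (F := F) (G := G) (M := S)
  refine ⟨d, ρ, hρ, fun h => ?_⟩
  have := IsSimpleModule.nontrivial (MonoidAlgebra F G) S
  obtain ⟨m, hm⟩ := exists_ne (0 : S)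
  have h1 := hb e m
  rw [h, show e • m = m from Subtype.ext (hL m.1)] at h1
  exact hm (b.map_eq_zero_iff.1 h1.symm)

end Representations

/-! ### Twists of blocks -/

namespace CentralIdempotent

section Ext

variable {R : Type u} [CommRing R] {G : Type v} [Group G]

theorem eq_of_e_eq {B C : CentralIdempotent R G} (h : B.e = C.e) : B = C := by
  cases B
  cases C
  cases h
  rfl

/-- Two blocks whose idempotents have a nonzero product are equal. -/
theorem IsBlock.eq_of_mul_ne_zero {B C : CentralIdempotent R G} (hB : B.IsBlock) (hC : C.IsBlock)
    (h : B.e * C.e ≠ 0) : B = C := by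
  let D : CentralIdempotent R G :=
    { e := B.e * C.e
      idem := by
        change B.e * C.e * (B.e * C.e) = _
        rw [mul_assoc, ← mul_assoc C.e, C.central, mul_assoc B.e C.e, C.idem.eq, ← mul_assoc,
          B.idem.eq]
      central := fun x => by rw [mul_assoc, C.central, ← mul_assoc, B.central, mul_assoc] }
  have h1 := (hB.primitive D (by
    change B.e * (B.e * C.e) = B.e * C.e
    rw [← mul_assoc, B.idem.eq])).resolve_left h
  have h2 := (hC.primitive D (by
    change C.e * (B.e * C.e) = B.e * C.e
    rw [C.central, mul_assoc, C.idem.eq])).resolve_left h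
  exact eq_of_e_eq (h1.symm.trans h2)

theorem IsBlock.map {B : CentralIdempotent R G} (hB : B.IsBlock) (s : R ≃+* R) :
    (B.map (s : R →+* R)).IsBlock := by
  have hs : ∀ x : MonoidAlgebra R G, MonoidAlgebra.mapRingHom G (s : R →+* R)
      (MonoidAlgebra.mapRingHom G (s.symm : R →+* R) x) = x := fun x => by ext; simp
  have hs' : ∀ x : MonoidAlgebra R G, MonoidAlgebra.mapRingHom G (s.symm : R →+* R)
      (MonoidAlgebra.mapRingHom G (s : R →+* R) x) = x := fun x => by ext; simp
  constructor
  · intro h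
    refine hB.ne_zero ?_
    rw [← hs' B.e]
    exact (congrArg _ h).trans (map_zero _)
  · intro f hf
    have h1 : B.e * (f.map (s.symm : R →+* R)).e = (f.map (s.symm : R →+* R)).e := by
      have := congrArg (MonoidAlgebra.mapRingHom G (s.symm : R →+* R)) hf
      rw [map_mul] at this
      change MonoidAlgebra.mapRingHom G _ (MonoidAlgebra.mapRingHom G (s : R →+* R) B.e) * _ = _
        at this
      rw [hs'] at this
      exact this
    refine (hB.primitive _ h1).imp (fun h => ?_) fun h => ?_
    · rw [← hs f.e]
      exact (congrArg _ h).trans (map_zero _)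
    · rw [← hs f.e]
      exact congrArg _ h

end Ext

section Characters

variable {O : Type u} [CommRing O] [IsDomain O] {G : Type v} [Group G]

/-- The linear extension of a function on the group to the group algebra. -/
def evalChar (χ : G → KBar O) (x : MonoidAlgebra O G) : KBar O :=
  x.coeff.sum fun g a => algebraMap O (KBar O) a * χ g

theorem evalChar_character {d : ℕ} (ρ : Representation (KBar O) G (Fin d → KBar O))
    (x : MonoidAlgebra O G) : evalChar ρ.character x =
      LinearMap.trace (KBar O) _
        (ρ.asAlgebraHom (MonoidAlgebra.mapRingHom G (algebraMap O (KBar O)) x)) := by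
  have hadd : ∀ x y : MonoidAlgebra O G,
      evalChar ρ.character (x + y) = evalChar ρ.character x + evalChar ρ.character y := by
    intro x y
    rw [evalChar, MonoidAlgebra.coeff_add]
    exact Finsupp.sum_add_index' (fun g => by simp) fun g a b => by rw [map_add, add_mul]
  induction x using MonoidAlgebra.induction_linear with
  | zero => simp [evalChar]
  | add x y hx hy => rw [hadd, hx, hy, map_add, map_add, map_add]
  | single g a =>
    rw [MonoidAlgebra.mapRingHom_single, Representation.asAlgebraHom_single, map_smul, smul_eq_mul,
      evalChar, MonoidAlgebra.coeff_single, Finsupp.sum_single_index (by simp)]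
    rfl

theorem evalChar_mapRingHom {s : O ≃+* O} {τ : KBar O ≃+* KBar O}
    (h : ∀ a : O, τ (algebraMap O (KBar O) a) = algebraMap O (KBar O) (s a)) (χ : G → KBar O)
    (x : MonoidAlgebra O G) :
    evalChar (fun g => τ (χ g)) (MonoidAlgebra.mapRingHom G (s : O →+* O) x) =
      τ (evalChar χ x) := by
  rw [evalChar, evalChar, Finsupp.sum, Finsupp.sum, map_sum]
  have hsupp : (MonoidAlgebra.mapRingHom G (s : O →+* O) x).coeff.support = x.coeff.support := by
    ext g
    simp
  rw [hsupp]
  refine Finset.sum_congr rfl fun g _ => ?_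
  rw [map_mul, h, MonoidAlgebra.coeff_mapRingHom]
  rfl

theorem map_algebraMap_ne_zero [FaithfulSMul O (KBar O)] {x : MonoidAlgebra O G} (hx : x ≠ 0) :
    MonoidAlgebra.mapRingHom G (algebraMap O (KBar O)) x ≠ 0 := fun h => hx (by
  ext g
  refine FaithfulSMul.algebraMap_injective O (KBar O) ?_
  simpa using congrArg (fun z => z.coeff g) h)

variable [CharZero (KBar O)]

/-- An irreducible character belongs to a block if and only if the identity of the block acts as the
identity on the representation. -/
theorem evalChar_e_ne_zero_iff (B : CentralIdempotent O G) {d : ℕ}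
    {ρ : Representation (KBar O) G (Fin d → KBar O)} (hρ : ρ.IsIrreducible) :
    evalChar ρ.character B.e ≠ 0 ↔
      ρ.asAlgebraHom (MonoidAlgebra.mapRingHom G (algebraMap O (KBar O)) B.e) = 1 := by
  have hne : (1 : Module.End (KBar O) (Fin d → KBar O)) ≠ 0 := by
    have := ((ρ.isIrreducible_iff).1 hρ).1
    exact one_ne_zero
  have hd : LinearMap.trace (KBar O) (Fin d → KBar O) 1 ≠ 0 := by
    rw [LinearMap.trace_one, Module.finrank_fin_fun, Nat.cast_ne_zero]
    rintro rfl
    exact hne (Subsingleton.elim _ _)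
  rw [evalChar_character]
  rcases hρ.asAlgebraHom_eq_zero_or_one (B.map (algebraMap O (KBar O))).idem
    (B.map (algebraMap O (KBar O))).central with h | h
  all_goals
    change ρ.asAlgebraHom (MonoidAlgebra.mapRingHom G (algebraMap O (KBar O)) B.e) = _ at h
    rw [h]
  · simpa using hne.symm
  · simpa using hd

/-- If Frobenius twists are available over `O`, then the twist of a block is its image under
the automorphism of the coefficients. -/
theorem isBlockTwist_iff [FaithfulSMul O (KBar O)] [Finite G] {p : ℕ} [Fact p.Prime]
    {σ : O ≃+* O} {τ : KBar O ≃+* KBar O}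
    (hτσ : ∀ a : O, τ (algebraMap O (KBar O) a) = algebraMap O (KBar O) (σ a))
    (hτ : IsCyclotomicFrobenius p 1 τ) {B : CentralIdempotent O G} (hB : B.IsBlock)
    (n : ℕ) (B' : CentralIdempotent O G) :
    IsBlockTwist p n B B' ↔ B' = B.map ((σ ^ n : O ≃+* O) : O →+* O) := by
  have hτσn : ∀ a : O, (τ ^ n) (algebraMap O (KBar O) a) = algebraMap O (KBar O) ((σ ^ n) a) := by
    intro a
    induction n with
    | zero => rfl
    | succ n ih => rw [pow_succ', RingAut.mul_apply, ih, hτσ, pow_succ', RingAut.mul_apply]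
  constructor
  · rintro ⟨hB', χ, hχ, χ', hχ', τ', hτ', hχχ'⟩
    obtain ⟨⟨d, ρ, hρ, rfl⟩, hχB⟩ := hχ
    obtain ⟨⟨d', ρ', hρ', rfl⟩, hχB'⟩ := hχ'
    -- the values of characters are sums of roots of unity, so that the automorphism `τ'` in
    -- the definition of `χ ^ (q)` may be replaced by `τ ^ n`
    have h1 : ρ'.character = fun g => (τ ^ n) (ρ.character g) := by
      funext g
      obtain ⟨m, hm, hroot⟩ := ρ.exists_character_eq_sum g
      rw [hχχ', hm, map_multiset_sum, map_multiset_sum]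
      refine congrArg _ (Multiset.map_congr rfl fun ω hω => ?_)
      exact hτ'.apply_eq_apply (hτ.pow n) Nat.card_pos.ne' (hroot ω hω)
    have h2 : evalChar ρ'.character (B.map ((σ ^ n : O ≃+* O) : O →+* O)).e ≠ 0 := by
      rw [h1]
      refine (evalChar_mapRingHom hτσn ρ.character B.e).trans_ne ?_
      exact (map_ne_zero_iff _ (τ ^ n).injective).2 hχB
    rw [evalChar_e_ne_zero_iff _ hρ'] at h2
    have h3 := (evalChar_e_ne_zero_iff B' hρ').1 hχB'
    refine hB'.eq_of_mul_ne_zero (hB.map (σ ^ n)) fun h => ?_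
    have h4 := congrArg (fun x => ρ'.asAlgebraHom (MonoidAlgebra.mapRingHom G
      (algebraMap O (KBar O)) x)) h
    simp only [map_mul, map_zero, h2, h3] at h4
    have := ((ρ'.isIrreducible_iff).1 hρ').1
    exact one_ne_zero ((one_mul _).symm.trans h4)
  · rintro rfl
    obtain ⟨d, ρ, hρ, hρe⟩ := exists_isIrreducible_asAlgebraHom_ne_zero
      (B.map (algebraMap O (KBar O))).idem (B.map (algebraMap O (KBar O))).central
      (map_algebraMap_ne_zero hB.ne_zero)
    have h1 : evalChar ρ.character B.e ≠ 0 := (evalChar_e_ne_zero_iff B hρ).2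
      ((hρ.asAlgebraHom_eq_zero_or_one (B.map (algebraMap O (KBar O))).idem
        (B.map (algebraMap O (KBar O))).central).resolve_left hρe)
    have h2 : (ρ.twist (τ ^ n)).character = fun g => (τ ^ n) (ρ.character g) :=
      funext (ρ.character_twist (τ ^ n))
    refine ⟨hB.map _, ρ.character, ⟨⟨d, ρ, hρ, rfl⟩, h1⟩, (ρ.twist (τ ^ n)).character,
      ⟨⟨d, _, hρ.twist (τ ^ n), rfl⟩, ?_⟩, τ ^ n, hτ.pow n, ρ.character_twist (τ ^ n)⟩
    change evalChar (ρ.twist (τ ^ n)).character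
      (MonoidAlgebra.mapRingHom G ((σ ^ n : O ≃+* O) : O →+* O) B.e) ≠ 0
    rw [h2, evalChar_mapRingHom hτσn]
    exact (map_ne_zero_iff _ (τ ^ n).injective).2 h1

end Characters

section Main

variable (p : ℕ) [Fact p.Prime] {O : Type u} [CommRing O] [IsDomain O] [IsDiscreteValuationRing O]
  [CharZero O] [CharP (ResidueField O) p] {G : Type v} [Group G] [Finite G]
  {H : Type w} [Group H] [Finite H]

/-- If Frobenius twists are available over `O`, then the strong `O`-Frobenius number is determined by
the twisted automorphisms of the block algebra. -/
theorem strongOFrobeniusNumber_eq_sInf {σ : O ≃+* O} {τ : KBar O ≃+* KBar O}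
    (hσ : ∀ a : O, residue O (σ a) = residue O a ^ p)
    (hτσ : ∀ a : O, τ (algebraMap O (KBar O) a) = algebraMap O (KBar O) (σ a))
    (hτ : IsCyclotomicFrobenius p 1 τ) {B : CentralIdempotent O G} (hB : B.IsBlock) :
    strongOFrobeniusNumber p B = sInf {n : ℕ | 0 < n ∧ B.HasTwist p n (σ ^ n)} := by
  have hσn : ∀ (n : ℕ) (a : O), residue O ((σ ^ n) a) = residue O a ^ p ^ n := fun n a => by
    induction n with
    | zero => simp
    | succ n ih => rw [pow_succ', RingAut.mul_apply, hσ, ih, ← pow_mul, ← pow_succ]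
  rw [strongOFrobeniusNumber]
  congr 1
  ext n
  refine and_congr_right fun _ => ?_
  simp only [isBlockTwist_iff hτσ hτ hB, exists_eq_left]
  exact exists_isStrongOFrobeniusIso_iff p (hσn n) rfl

theorem strongOFrobeniusNumber_eq {B : CentralIdempotent O G} {C : CentralIdempotent O H}
    (hB : B.IsBlock) (hC : C.IsBlock) (h : IsMoritaEquivalent O B.Alg C.Alg)
    (hO : HasFrobeniusLift p O) : strongOFrobeniusNumber p B = strongOFrobeniusNumber p C := by
  obtain ⟨σ, τ, hσ, hτσ, hτ⟩ := hO
  obtain ⟨e⟩ := h.cond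
  rw [strongOFrobeniusNumber_eq_sInf p hσ hτσ hτ hB, strongOFrobeniusNumber_eq_sInf p hσ hτσ hτ hC]
  congr 1
  ext n
  exact and_congr_right fun _ => ⟨HasTwist.of_moritaEquivalence e.symm hτσ hτ,
    HasTwist.of_moritaEquivalence e hτσ hτ⟩

end Main

end CentralIdempotent

theorem mainTheorem3 (p : ℕ) [Fact p.Prime]
    {O : Type u} [CommRing O] [IsDomain O] [IsDiscreteValuationRing O] [CharZero O]
    [IsAdicComplete (IsLocalRing.maximalIdeal O) O]
    [CharP (IsLocalRing.ResidueField O) p] [IsAlgClosed (IsLocalRing.ResidueField O)]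
    {G : Type v} [Group G] [Finite G] {H : Type w} [Group H] [Finite H]
    (B : CentralIdempotent O G) (hB : B.IsBlock)
    (C : CentralIdempotent O H) (hC : C.IsBlock)
    (hBC : IsMoritaEquivalent O B.Alg C.Alg) :
    strongFrobeniusNumber p B.kRed = strongFrobeniusNumber p C.kRed ∧
      (HasFrobeniusLift p O →
        strongOFrobeniusNumber p B = strongOFrobeniusNumber p C) :=
  ⟨CentralIdempotent.strongFrobeniusNumber_kRed_eq p hBC,
    CentralIdempotent.strongOFrobeniusNumber_eq p hB hC hBC⟩
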